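/- Let $\rho>0$, $1<\beta<\alpha\le 2$, $\gamma=\beta/\alpha$, and let $\mu$ be a finite (non-negative) Borel measure on the unit sphere $\mathcal S\subset\mathbb R^3$. Let $Q$ be the pseudo-differential operator on $\mathbb R^3$ with symbol $\hat Q(k)=-\int_{\mathcal S}|k\cdot y|^\alpha\,\mu(dy)$ with respect to the Fourier transform $\hat u(k)=\int e^{-ik\cdot x}u(x)\,dx$, and put $F(k)=-\hat Q(k)/\rho$. For $b\in(1,2]$ let $D^b$ be the Caputo derivative in time: $D^b f(t)=\int_0^t \frac{(t-s)^{1-b}}{\Gamma(2-b)}f''(s)\,ds$ if $b<2$, and $D^2f=f''$. A solution on $[0,\infty)$ of the Cauchy problem $\rho D^b u=Qu$, $u(0)=u_0$, $u'(0)=v_0$ is a family $u(t)$ of tempered distributions on $\mathbb R^3$ whose Fourier transforms are functions $\hat u(t,k)$ such that, for almost every $k$, the function $t\mapsto\hat u(t,k)$ is $C^1$ on $[0,\infty)$ and $C^2$ on $(0,\infty)$ with second derivative integrable on each $(0,T]$, satisfies $\rho D^b\hat u(t,k)=\hat Q(k)\hat u(t,k)$ for all $t>0$, and has the initial values $\hat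 u_0(k)$, $\hat v_0(k)$ (where $\hat u_0,\hat v_0$ are functions as well). The first (second) fundamental solution of order $b$ is the solution with $u_0=\delta$, $v_0=0$ (resp. $u_0=0$, $v_0=\delta$). Let $M_\gamma(z)=\sum_{n\ge0}\frac{(-z)^n}{n!\,\Gamma(1-\gamma(n+1))}$, $N_\gamma(z)=\sum_{n\ge0}\frac{(-z)^n}{n!\,\Gamma(2-\gamma(n+1))}$ and $E_{\alpha,m}(z)=\sum_{n\ge0}z^n/\Gamma(\alpha n+m)$. For $\alpha<2$ let $$X_\alpha(y)=\frac1\pi\,\frac{|y|^{\alpha-1}\sin(\alpha\pi/2)}{1+2|y|^\alpha\cos(\alpha\pi/2)+|y|^{2\alpha}},\qquad Y_\alpha(y)=\frac{\sin(\alpha\pi/2)}{\pi}\int_{|y|}^\infty\frac{z^{\alpha-2}\,dz}{1+2z^\alpha\cos(\alpha\pi/2)+z^{2\alpha}},$$ and let $X_2(y)=\frac12(\delta(y-1)+\delta(y+1))$, $Y_2=\frac12\mathbf 1_{(-1,1)}$. Then the following hold. (1) The first and second fundamental solutions of order $\beta$, denoted $G^\mu_{\gamma,\alpha}$ and $H^\mu_{\gamma,\alpha}$,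 and those of order $\alpha$, denoted $G^\mu_{1,\alpha}$ and $H^\mu_{1,\alpha}$, exist and are unique. (2) For all $t>0$, $$G^\mu_{\gamma,\alpha}(t,x)=\int_0^\infty M_\gamma(\xi)\,G^\mu_{1,\alpha}(t^\gamma,x/\xi)\,\frac{d\xi}{\xi^3}=t^{-3\gamma}\int_0^\infty M_\gamma(\xi)\,G^\mu_{1,\alpha}\Big(1,\frac{x\,t^{-\gamma}}{\xi}\Big)\frac{d\xi}{\xi^3},$$ $$H^\mu_{\gamma,\alpha}(t,x)=t^{1-3\gamma}\int_0^\infty N_\gamma(\xi)\,G^\mu_{1,\alpha}\Big(1,\frac{x\,t^{-\gamma}}{\xi}\Big)\frac{d\xi}{\xi^3}.$$ (3) If $\mu\ne0$ then, for all $t>0$, with $\hat k\in\mathcal S$, surface measure $d_2\hat k$ on $\mathcal S$, and $\hat k\cdot x=\hat k\cdot\hat x\,r$ for $r=|x|$ and $\hat x=x/r$, $$G^\mu_{1,\alpha}(t,x)=-\frac1{8\pi^2t}\int_{\mathcal S}\frac{d_2\hat k}{F(\hat k)^{1/\alpha}}\,\nabla^2X_\alpha\Big(\frac{\hat k\cdot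 x}{t\,F(\hat k)^{1/\alpha}}\Big),\qquad H^\mu_{1,\alpha}(t,x)=-\frac1{8\pi^2}\int_{\mathcal S}\frac{d_2\hat k}{F(\hat k)^{1/\alpha}}\,\nabla^2Y_\alpha\Big(\frac{\hat k\cdot x}{t\,F(\hat k)^{1/\alpha}}\Big),$$ where $\nabla^2$ is the Laplacian in $x$. (4) If $\alpha<2$, then $E_{\alpha,1}(-|k|^\alpha)$ and $E_{\alpha,2}(-|k|^\alpha)$ are integrable over $k\in\mathbb R$, and $X_\alpha(y)=\frac1{2\pi}\int_{\mathbb R} e^{iky}E_{\alpha,1}(-|k|^\alpha)\,dk$ and $Y_\alpha(y)=\frac1{2\pi}\int_{\mathbb R} e^{iky}E_{\alpha,2}(-|k|^\alpha)\,dk$ for all $y\in\mathbb R$. The identities in (2) and (3) are identities of tempered distributions in $x$: after pairing with any Schwartz function (the Laplacian and the dilations $x\mapsto x/\xi$ being taken in the sense of distributions) the integrals over $\xi$ and $\hat k$ converge absolutely and the two sides agree. -/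

import Mathlib

open MeasureTheory Set
open scoped SchwartzMap FourierTransform Laplacian NNReal RealInnerProductSpace

namespace FracWave

noncomputable section

/-- Physical space, three-dimensional Euclidean space. -/
abbrev E3 : Type := EuclideanSpace ℝ (Fin 3)

/-- The unit sphere of `E3`. -/
abbrev S2 : Type := Metric.sphere (0 : E3) 1

/-! ### Special functions

`Real.Gamma` vanishes at the poles `0, -1, -2, …` and `x / 0 = 0`, so that `x / Real.Gamma y` is
`x` times the entire function `1 / Γ` at every real `y`. -/

/-- The Wright function `W_{l,m}(z) = ∑ zⁿ / (n! Γ(n l + m))`, for `l > -1`. -/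
def wright (l m z : ℝ) : ℝ :=
  ∑' n : ℕ, z ^ n / ((n.factorial : ℝ) * Real.Gamma (n * l + m))

/-- `M_γ(z) = W_{-γ,1-γ}(-z)`. -/
def wrightM (γ z : ℝ) : ℝ := wright (-γ) (1 - γ) (-z)

/-- `N_γ(z) = W_{-γ,2-γ}(-z)`. -/
def wrightN (γ z : ℝ) : ℝ := wright (-γ) (2 - γ) (-z)

/-- The Mittag-Leffler function `E_{l,m}(z) = ∑ zⁿ / Γ(l n + m)`. -/
def mittagLeffler (l m z : ℝ) : ℝ :=
  ∑' n : ℕ, z ^ n / Real.Gamma (l * n + m)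

/-- The function `X_α` for `1 < α < 2`. -/
def X (α y : ℝ) : ℝ :=
  1 / Real.pi * (|y| ^ (α - 1) * Real.sin (α * Real.pi / 2) /
    (1 + 2 * |y| ^ α * Real.cos (α * Real.pi / 2) + |y| ^ (2 * α)))

/-- The function `Y_α` for `1 < α ≤ 2`: `Y_α(y) = ∫_{|y|}^∞ X_α(z) dz / z`, written out. For
`α = 2`, where `X_2 = (δ(y - 1) + δ(y + 1)) / 2`, it is half the indicator of `(-1, 1)`. -/
def Y (α y : ℝ) : ℝ :=
  if α = 2 then (if |y| < 1 then 1 / 2 else 0)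
  else Real.sin (α * Real.pi / 2) / Real.pi * ∫ z in Ioi |y|,
    z ^ (α - 2) / (1 + 2 * z ^ α * Real.cos (α * Real.pi / 2) + z ^ (2 * α))

/-! ### Fractional calculus -/

/-- The fractional integral `I^γ f(t) = ∫_0^t (t - s)^(γ-1) / Γ(γ) f(s) ds`. -/
def fracIntegral (γ : ℝ) (f : ℝ → ℂ) (t : ℝ) : ℂ :=
  ∫ s in (0 : ℝ)..t, (((t - s) ^ (γ - 1) / Real.Gamma γ : ℝ) : ℂ) * f s

/-- The Caputo derivative of order `β > 0`: the ordinary derivative if `β` is an integer, and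
`I^(n-β) Dⁿ` with `n - 1 < β < n` otherwise. -/
def caputo (β : ℝ) (f : ℝ → ℂ) (t : ℝ) : ℂ :=
  if (⌈β⌉₊ : ℝ) = β then iteratedDeriv ⌈β⌉₊ f t
  else fracIntegral (⌈β⌉₊ - β) (iteratedDeriv ⌈β⌉₊ f) t

/-! ### The operator `Q` and the Cauchy problem -/

/-- The symbol `Q̂(k) = -∫_S |k · y|^α μ(dy)`. -/
def symbolQ (α : ℝ) (μ : Measure S2) (k : E3) : ℝ :=
  -∫ y : S2, |⟪k, (y : E3)⟫| ^ α ∂μ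

/-- `F(k) = -Q̂(k) / ρ`. -/
def angularF (ρ α : ℝ) (μ : Measure S2) (k : E3) : ℝ :=
  -symbolQ α μ k / ρ

/-- The Fourier transform of the tempered distribution `T`, in the normalization
`T̂(k) = ∫ exp(-i k·x) T(x) dx`, is the function `g`. (Mathlib's transform has the kernel
`exp(-2π i k·x)`.) -/
def HasFourierFunction (T : 𝓢'(E3, ℂ)) (g : E3 → ℂ) : Prop :=
  ∀ φ : 𝓢(E3, ℂ),
    Integrable (fun k : E3 => g ((2 * Real.pi) • k) * φ k) ∧
    (𝓕 T) φ = ∫ k : E3, g ((2 * Real.pi) • k) * φ k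

/-- Regularity of a function of time on `[0, ∞)` for which the Caputo derivatives of order
`β ∈ (1, 2]` and the initial values `f(0)`, `f'(0)` make classical sense. -/
structure TimeRegular (f : ℝ → ℂ) : Prop where
  contDiffOn_one : ContDiffOn ℝ 1 f (Ici 0)
  contDiffOn_two : ContDiffOn ℝ 2 f (Ioi 0)
  integrableOn : ∀ T : ℝ, IntegrableOn (iteratedDeriv 2 f) (Ioc 0 T)

/-- `u` solves the Cauchy problem `ρ D^β u = Q u`, `u(0) = u₀`, `u'(0) = v₀` on `[0, ∞)`. Here `u`
takes values in the tempered distributions, the Fourier transforms in `x` are functions, and `Q` is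
the pseudo-differential operator with symbol `symbolQ α μ`, that is, it acts on the Fourier
transforms as multiplication by the symbol. -/
def IsCauchySolution (ρ α β : ℝ) (μ : Measure S2) (u₀ v₀ : 𝓢'(E3, ℂ))
    (u : ℝ≥0 → 𝓢'(E3, ℂ)) : Prop :=
  ∃ (U : ℝ → E3 → ℂ) (U₀ V₀ : E3 → ℂ),
    HasFourierFunction u₀ U₀ ∧ HasFourierFunction v₀ V₀ ∧
    (∀ t : ℝ≥0, HasFourierFunction (u t) (U t)) ∧
    ∀ᵐ k : E3,
      TimeRegular (fun t => U t k) ∧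
      U 0 k = U₀ k ∧
      derivWithin (fun t => U t k) (Ici 0) 0 = V₀ k ∧
      ∀ t : ℝ, 0 < t → (ρ : ℂ) * caputo β (fun s => U s k) t = (symbolQ α μ k : ℂ) * U t k

/-- First fundamental solution: `u(0) = δ`, `u'(0) = 0`. -/
def IsFirstFundamental (ρ α β : ℝ) (μ : Measure S2) (G : ℝ≥0 → 𝓢'(E3, ℂ)) : Prop :=
  IsCauchySolution ρ α β μ (TemperedDistribution.delta 0) 0 G

/-- Second fundamental solution: `u(0) = 0`, `u'(0) = δ`. -/
def IsSecondFundamental (ρ α β : ℝ) (μ : Measure S2) (H : ℝ≥0 → 𝓢'(E3, ℂ)) : Prop :=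
  IsCauchySolution ρ α β μ 0 (TemperedDistribution.delta 0) H

/-! ### Operations on distributions -/

/-- The distribution `x ↦ T(x / c)`, for `c ≠ 0`: `φ ↦ |c|³ T(φ(c ·))`. -/
def dilate (c : ℝ) (T : 𝓢'(E3, ℂ)) : 𝓢'(E3, ℂ) :=
  if hc : c ≠ 0 then
    ((|c| ^ 3 : ℝ) : ℂ) • PointwiseConvergenceCLM.precomp ℂ
      (SchwartzMap.compCLMOfContinuousLinearEquiv ℂ
        (ContinuousLinearEquiv.smulLeft (R₁ := ℝ) (M₁ := E3) (Units.mk0 c hc))) T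
  else 0

/-- The pairing of the plane distribution `x ↦ X_α(ω · x / c)`, `c > 0`, with the test function
`ψ`. For `α = 2`, `X_2(ω · x / c) = (c / 2) (δ(ω · x - c) + δ(ω · x + c))`, which is `c / 2` times
the sum of the surface measures of the two planes `ω · x = ± c`. -/
def planeX (α : ℝ) (ω : S2) (c : ℝ) (ψ : 𝓢(E3, ℂ)) : ℂ :=
  if α = 2 then
    ((c / 2 : ℝ) : ℂ) *
      ((∫ w : (Submodule.span ℝ {(ω : E3)})ᗮ, ψ (c • (ω : E3) + (w : E3))) +
        ∫ w : (Submodule.span ℝ {(ω : E3)})ᗮ, ψ (-(c • (ω : E3)) + (w : E3)))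
  else ∫ x : E3, (X α (⟪(ω : E3), x⟫ / c) : ℂ) * ψ x

/-- The pairing of the plane function `x ↦ Y_α(ω · x / c)`, `c > 0`, with the test function `ψ`. -/
def planeY (α : ℝ) (ω : S2) (c : ℝ) (ψ : 𝓢(E3, ℂ)) : ℂ :=
  ∫ x : E3, (Y α (⟪(ω : E3), x⟫ / c) : ℂ) * ψ x

end

end FracWave

open FracWave

namespace FracWave

open Filter Topology

/-! ### Hankel's formula for `1 / Γ` on a ray -/

/-! In Fourier variables the Cauchy problem decouples: for each `k` it is the scalar equation `D^b f
= -F(k) f`. The two sets of initial data are solved by `E_{b,1}(-F(k) t^b)` and `t E_{b,2}(-F(k)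
t^b)` (`isOdeSolution_first`, `isOdeSolution_second`). Uniqueness follows by passing to a Volterra
equation and applying Gronwall's inequality (`IsOdeSolution.unique`). For existence it is enough
that these multipliers are continuous and bounded in `k`.

The subordination formulas all come from one identity, `E_{γa,m}(x) = ∫ W_{-γ,m-γ}(-ξ) E_{a,1}(x
ξ^a) dξ` (`integral_wright_mul_mittagLeffler`), where `m = 1` gives `M_γ` and `m = 2` gives `N_γ`.
It is proved term by term from the moments of the Wright function (`integral_rpow_mul_wright`).
These moments, and decay faster than any exponential (`exists_norm_wright_le`), are read off a
contour integral: Hankel's formula for `1/Γ` with a factor `exp(-z σ^γ)` inserted. By conjugation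
symmetry half of the Hankel contour suffices, so only the imaginary part of an integral along one
ray from a point `a > 0` appears (`hankelRay_im`). Since `F` is homogeneous of degree `α`, the
factor `ξ^α` in the argument is a dilation of the first fundamental solution, and Fubini's theorem
concludes. The case `a = 2`, where `E_{2,1}(-y²) = cos y`, also yields the bounds on Mittag-Leffler
functions, by integrating a cosine transform by parts twice (`exists_abs_mittagLeffler_le`).

For the spherical formulas, a plane wave `Z(ω·x/c)` has its Fourier transform on the line `ℝω`, with
the cosine transform of `Z` as density (`plane_pairing`). The Laplacian contributes `r²`, the
Jacobian of polar coordinates, so integrating over `ω` reassembles an integral over all `k`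
(`spherical_integral`). It remains to identify the profiles. `X_α` is, up to the factor `π`, the
real part on the imaginary axis of the Laplace transform `s^(α-1)/(1+s^α)` of `E_{α,1}(-t^α)`
(`X_eq_integral_cos`). The statement for `Y_α` follows because `E_{α,2}(-|k|^α)` is the average of
`E_{α,1}(-|vk|^α)` over `v ∈ [0,1]` (`mittagLeffler_eq_integral_Y`). -/

/-- The point at distance `r` from `a` in the direction `θ`. -/
noncomputable def ray (θ a r : ℝ) : ℂ := a + r * Complex.exp (θ * Complex.I)

lemma ray_re (θ a r : ℝ) : (ray θ a r).re = a + r * Real.cos θ := by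
  simp [ray, Complex.exp_ofReal_mul_I_re]

lemma ray_im (θ a r : ℝ) : (ray θ a r).im = r * Real.sin θ := by
  simp [ray, Complex.exp_ofReal_mul_I_im]

lemma ray_zero (θ a : ℝ) : ray θ a 0 = a := by simp [ray]

lemma hasDerivAt_ray (θ a r : ℝ) :
    HasDerivAt (ray θ a) (Complex.exp (θ * Complex.I)) r := by
  have : HasDerivAt (ray θ a) (1 * Complex.exp (θ * Complex.I)) r :=
    ((Complex.ofRealCLM.hasDerivAt (x := r)).mul_const _).const_add (a : ℂ)
  rwa [one_mul] at this

lemma hasDerivAt_ray_base (θ a r : ℝ) : HasDerivAt (fun a => ray θ a r) 1 a := by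
  exact (Complex.ofRealCLM.hasDerivAt (x := a)).add_const (r * Complex.exp (θ * Complex.I))

lemma continuous_ray (θ a : ℝ) : Continuous (ray θ a) := by unfold ray; fun_prop

lemma norm_exp_angle (θ : ℝ) : ‖Complex.exp (θ * Complex.I)‖ = 1 :=
  Complex.norm_exp_ofReal_mul_I θ

lemma ray_mem_slitPlane {θ a r : ℝ} (hθ : θ ∈ Ioo 0 Real.pi) (ha : 0 < a) (hr : 0 ≤ r) :
    ray θ a r ∈ Complex.slitPlane := by
  rw [Complex.mem_slitPlane_iff, ray_re, ray_im]
  rcases hr.eq_or_lt with rfl | hr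
  · left; simpa using ha
  · right; exact (mul_pos hr (Real.sin_pos_of_pos_of_lt_pi hθ.1 hθ.2)).ne'

lemma ray_ne_zero {θ a r : ℝ} (hθ : θ ∈ Ioo 0 Real.pi) (ha : 0 < a) (hr : 0 ≤ r) :
    ray θ a r ≠ 0 := Complex.slitPlane_ne_zero (ray_mem_slitPlane hθ ha hr)

lemma norm_ray_le {θ a r : ℝ} (ha : 0 ≤ a) (hr : 0 ≤ r) : ‖ray θ a r‖ ≤ a + r := by
  refine (norm_add_le _ _).trans ?_
  rw [norm_mul, norm_exp_angle, Complex.norm_real, Complex.norm_real, Real.norm_of_nonneg ha,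
    Real.norm_of_nonneg hr, mul_one]

/-- `a sin θ` is the distance from the origin to the line containing the ray. -/
lemma le_norm_ray {θ a r : ℝ} (hθ : θ ∈ Ioo 0 Real.pi) (ha : 0 ≤ a) :
    a * Real.sin θ ≤ ‖ray θ a r‖ := by
  have hs := (Real.sin_pos_of_pos_of_lt_pi hθ.1 hθ.2).le
  rw [← abs_of_nonneg (mul_nonneg ha hs), ← abs_of_nonneg (norm_nonneg (ray θ a r)), ← sq_le_sq,
    Complex.sq_norm, Complex.normSq_apply, ray_re, ray_im]
  have h : (a + r * Real.cos θ) * (a + r * Real.cos θ) + r * Real.sin θ * (r * Real.sin θ) =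
      (r + a * Real.cos θ) ^ 2 + (a * Real.sin θ) ^ 2 := by
    linear_combination (r ^ 2 - a ^ 2) * Real.sin_sq_add_cos_sq θ
  rw [h]
  exact le_add_of_nonneg_left (sq_nonneg _)

lemma rpow_le_rpow_abs {x B q : ℝ} (hx : 0 < x) (hxB : x ≤ B) (hB : x⁻¹ ≤ B) :
    x ^ q ≤ B ^ |q| := by
  rcases le_total 0 q with h | h
  · rw [abs_of_nonneg h]; exact Real.rpow_le_rpow hx.le hxB h
  · rw [abs_of_nonpos h, ← neg_neg q, Real.rpow_neg hx.le, ← Real.inv_rpow hx.le, neg_neg]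
    exact Real.rpow_le_rpow (inv_nonneg.2 hx.le) hB (by linarith)

lemma norm_ray_rpow_le {θ a₀ a₁ a r q W : ℝ} (hθ : θ ∈ Ioo 0 Real.pi) (ha₀ : 0 < a₀)
    (h₀ : a₀ ≤ a) (h₁ : a ≤ a₁) (hr : 0 ≤ r) (hq : |q| ≤ W) :
    ‖ray θ a r‖ ^ q ≤ ((a₀ * Real.sin θ)⁻¹ + 1 + a₁ + r) ^ W := by
  have hs := Real.sin_pos_of_pos_of_lt_pi hθ.1 hθ.2
  have hd : 0 < a₀ * Real.sin θ := mul_pos ha₀ hs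
  have hn : a₀ * Real.sin θ ≤ ‖ray θ a r‖ :=
    (mul_le_mul_of_nonneg_right h₀ hs.le).trans (le_norm_ray hθ (by linarith))
  have hn' : ‖ray θ a r‖ ≤ a + r := norm_ray_le (by linarith) hr
  have hi : 0 < (a₀ * Real.sin θ)⁻¹ := inv_pos.2 hd
  refine (rpow_le_rpow_abs (hd.trans_le hn) (by linarith) ?_).trans
    (Real.rpow_le_rpow_of_exponent_le (by linarith) hq)
  have := inv_anti₀ hd hn
  linarith

/-- Since `γ < 1`, the power and the inner exponential are together `exp(o(r))`, so half of the
decay rate `c` absorbs them. -/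
lemma integrableOn_exp_neg_mul_rpow_mul_exp {c b W Z γ : ℝ} (hc : 0 < c) (hb : 0 < b)
    (hγ : γ < 1) :
    IntegrableOn (fun r => Real.exp (-c * r) * ((b + r) ^ W * Real.exp (Z * (b + r) ^ γ)))
      (Ioi 0) := by
  have hpos : ∀ r ∈ Ici (0 : ℝ), b + r ≠ 0 := fun r hr => by have : (0:ℝ) ≤ r := hr; positivity
  refine integrable_of_isBigO_exp_neg (b := c / 2) (by positivity) ?_ ?_
  · refine ContinuousOn.mul (by fun_prop) (ContinuousOn.mul ?_ ?_)
    · exact ContinuousOn.rpow_const (by fun_prop) fun r hr => Or.inl (hpos r hr)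
    · refine Real.continuous_exp.comp_continuousOn (continuousOn_const.mul ?_)
      exact ContinuousOn.rpow_const (by fun_prop) fun r hr => Or.inl (hpos r hr)
  · have h1 : (fun x : ℝ => W * Real.log x + Z * x ^ γ) =o[atTop] (fun x => x) := by
      refine (Real.isLittleO_log_id_atTop.const_mul_left W).add (Asymptotics.IsLittleO.const_mul_left ?_ Z)
      refine Asymptotics.isLittleO_of_tendsto' ?_ ?_
      · filter_upwards [eventually_gt_atTop 0] with x hx h using absurd h hx.ne'
      · refine (tendsto_rpow_neg_atTop (y := 1 - γ) (by linarith)).congr' ?_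
        filter_upwards [eventually_gt_atTop 0] with x hx
        rw [neg_sub, Real.rpow_sub_one hx.ne', id]
    have h2 : ∀ᶠ x : ℝ in atTop, W * Real.log x + Z * x ^ γ ≤ (c / 2) * x := by
      filter_upwards [h1.bound (half_pos hc), eventually_ge_atTop 0] with x hx h0
      exact (le_abs_self _).trans (by simpa [abs_of_nonneg h0] using hx)
    refine Asymptotics.IsBigO.of_bound (Real.exp (c / 2 * b)) ?_
    have h3 : Tendsto (fun r : ℝ => b + r) atTop atTop := tendsto_atTop_add_const_left _ _ tendsto_id
    filter_upwards [h3.eventually h2, eventually_ge_atTop 0] with r hr h0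
    have hbr : 0 < b + r := by positivity
    rw [Real.norm_of_nonneg (by positivity), Real.norm_of_nonneg (by positivity),
      Real.rpow_def_of_pos hbr, ← Real.exp_add, ← Real.exp_add, ← Real.exp_add, Real.exp_le_exp]
    nlinarith

lemma integrableOn_exp_neg_mul_rpow {c b W : ℝ} (hc : 0 < c) (hb : 0 < b) :
    IntegrableOn (fun r => Real.exp (-c * r) * (b + r) ^ W) (Ioi 0) := by
  simpa using integrableOn_exp_neg_mul_rpow_mul_exp (W := W) (Z := 0) (γ := 0) hc hb one_pos

/-- The integrand `e^σ σ^(-w)` of Hankel's formula. -/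
noncomputable def hankelFun (w : ℝ) (σ : ℂ) : ℂ := Complex.exp σ * σ ^ (-(w : ℂ))

/-- The integral of `e^σ σ^(-w)` along a ray. -/
noncomputable def hankelRay (w θ a : ℝ) : ℂ :=
  ∫ r in Ioi (0 : ℝ), hankelFun w (ray θ a r) * Complex.exp (θ * Complex.I)

lemma norm_hankelFun (w : ℝ) (σ : ℂ) : ‖hankelFun w σ‖ = Real.exp σ.re * ‖σ‖ ^ (-w) := by
  rw [hankelFun, norm_mul, Complex.norm_exp, ← Complex.ofReal_neg, Complex.norm_cpow_real]

/-- The bound is uniform in `a ∈ [a₀, a₁]` and `|w| ≤ W`. It therefore dominates both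
differentiation in the base point and passage to the limit in the exponent. -/
lemma norm_hankelFun_ray_le {θ a₀ a₁ a r w W : ℝ} (hθ : θ ∈ Ioo 0 Real.pi) (ha₀ : 0 < a₀)
    (h₀ : a₀ ≤ a) (h₁ : a ≤ a₁) (hr : 0 ≤ r) (hq : |w| ≤ W) :
    ‖hankelFun w (ray θ a r)‖ ≤ Real.exp a₁ * (Real.exp (-(-Real.cos θ) * r) *
      ((a₀ * Real.sin θ)⁻¹ + 1 + a₁ + r) ^ W) := by
  rw [norm_hankelFun, ray_re, ← mul_assoc, ← Real.exp_add]
  refine mul_le_mul ?_ (norm_ray_rpow_le hθ ha₀ h₀ h₁ hr (by simpa using hq)) (by positivity)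
    (by positivity)
  rw [Real.exp_le_exp]; nlinarith

lemma hasDerivAt_hankelFun (w : ℝ) {σ : ℂ} (h : σ ∈ Complex.slitPlane) :
    HasDerivAt (hankelFun w) (hankelFun w σ - w * hankelFun (w + 1) σ) σ := by
  have h1 : HasDerivAt (hankelFun w) _ σ := (Complex.hasDerivAt_exp σ).mul
    ((hasDerivAt_id σ).cpow_const (c := -(w : ℂ)) h)
  refine h1.congr_deriv ?_
  simp only [hankelFun, id]
  push_cast
  rw [show -((w : ℂ) + 1) = -w - 1 by ring]
  ring

lemma continuousOn_hankelFun_ray {θ a : ℝ} (w : ℝ) (hθ : θ ∈ Ioo 0 Real.pi) (ha : 0 < a) :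
    ContinuousOn (fun r => hankelFun w (ray θ a r)) (Ici 0) := fun _ hr =>
  ((hasDerivAt_hankelFun w (ray_mem_slitPlane hθ ha hr)).continuousAt.comp
    (continuous_ray θ a).continuousAt).continuousWithinAt

lemma aesm_hankelFun_ray {θ a : ℝ} (w : ℝ) (hθ : θ ∈ Ioo 0 Real.pi) (ha : 0 < a) :
    AEStronglyMeasurable (fun r => hankelFun w (ray θ a r)) (volume.restrict (Ioi 0)) :=
  ((continuousOn_hankelFun_ray w hθ ha).mono Ioi_subset_Ici_self).aestronglyMeasurable
    measurableSet_Ioi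

lemma angle_mem {θ : ℝ} (hθ : θ ∈ Ioo (Real.pi / 2) Real.pi) : θ ∈ Ioo 0 Real.pi :=
  ⟨Real.pi_div_two_pos.trans hθ.1, hθ.2⟩

lemma neg_cos_pos {θ : ℝ} (hθ : θ ∈ Ioo (Real.pi / 2) Real.pi) : 0 < -Real.cos θ := by
  have := Real.cos_neg_of_pi_div_two_lt_of_lt hθ.1 (by linarith [hθ.2, Real.pi_pos])
  linarith

lemma integrableOn_hankel_bound {θ a₀ a₁ : ℝ} (W : ℝ) (hθ : θ ∈ Ioo (Real.pi / 2) Real.pi)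
    (ha₀ : 0 < a₀) (ha₁ : 0 ≤ a₁) :
    IntegrableOn (fun r => Real.exp a₁ * (Real.exp (-(-Real.cos θ) * r) *
      ((a₀ * Real.sin θ)⁻¹ + 1 + a₁ + r) ^ W)) (Ioi 0) := by
  have := Real.sin_pos_of_pos_of_lt_pi (angle_mem hθ).1 hθ.2
  exact (integrableOn_exp_neg_mul_rpow (neg_cos_pos hθ) (by positivity)).const_mul _

lemma integrableOn_hankelFun_ray {θ a : ℝ} (w : ℝ) (hθ : θ ∈ Ioo (Real.pi / 2) Real.pi)
    (ha : 0 < a) : IntegrableOn (fun r => hankelFun w (ray θ a r)) (Ioi 0) := by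
  refine (integrableOn_hankel_bound |w| hθ ha ha.le).mono' (aesm_hankelFun_ray w (angle_mem hθ) ha) ?_
  refine (ae_restrict_iff' measurableSet_Ioi).2 (ae_of_all _ fun r hr => ?_)
  exact norm_hankelFun_ray_le (angle_mem hθ) ha le_rfl le_rfl (le_of_lt hr) le_rfl

lemma tendsto_hankelFun_ray {θ a : ℝ} (w : ℝ) (hθ : θ ∈ Ioo (Real.pi / 2) Real.pi)
    (ha : 0 < a) : Tendsto (fun r => hankelFun w (ray θ a r)) atTop (𝓝 0) := by
  have hs := Real.sin_pos_of_pos_of_lt_pi (angle_mem hθ).1 hθ.2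
  set b := (a * Real.sin θ)⁻¹ + 1 + a with hb
  have h1 : Tendsto (fun x : ℝ => x ^ |w| * Real.exp (-(-Real.cos θ) * x)) atTop (𝓝 0) :=
    tendsto_rpow_mul_exp_neg_mul_atTop_nhds_zero _ _ (neg_cos_pos hθ)
  have h3 : Tendsto (fun r : ℝ => b + r) atTop atTop := tendsto_atTop_add_const_left _ _ tendsto_id
  have h4 := (h1.comp h3).const_mul (Real.exp a * Real.exp (-Real.cos θ * b))
  rw [mul_zero] at h4
  refine squeeze_zero_norm' ?_ h4
  filter_upwards [eventually_ge_atTop 0] with r hr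
  refine (norm_hankelFun_ray_le (angle_mem hθ) ha le_rfl le_rfl hr le_rfl).trans (le_of_eq ?_)
  simp only [Function.comp_apply]
  rw [← hb, show -(-Real.cos θ) * (b + r) = Real.cos θ * b + Real.cos θ * r by ring, Real.exp_add,
    show -Real.cos θ * b = -(Real.cos θ * b) by ring, Real.exp_neg]
  field_simp

/-- The integrand is the derivative of `hankelFun w` along the ray, and the boundary term at
infinity vanishes because `cos θ < 0`. This one identity serves both as a recurrence in `w` and as
the derivative in `a`. -/
lemma hankelRay_sub {θ a : ℝ} (w : ℝ) (hθ : θ ∈ Ioo (Real.pi / 2) Real.pi) (ha : 0 < a) :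
    ∫ r in Ioi (0 : ℝ), (hankelFun w (ray θ a r) - w * hankelFun (w + 1) (ray θ a r)) *
      Complex.exp (θ * Complex.I) = -hankelFun w a := by
  have h := integral_Ioi_of_hasDerivAt_of_tendsto (f := fun r => hankelFun w (ray θ a r)) (a := 0)
    (f' := fun r => (hankelFun w (ray θ a r) - w * hankelFun (w + 1) (ray θ a r)) *
      Complex.exp (θ * Complex.I)) (m := 0)
    (continuousOn_hankelFun_ray w (angle_mem hθ) ha 0 self_mem_Ici)
    (fun _ hr => (hasDerivAt_hankelFun w (ray_mem_slitPlane (angle_mem hθ) ha (le_of_lt hr))).comp _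
      (hasDerivAt_ray θ a _))
    (((integrableOn_hankelFun_ray w hθ ha).sub
      ((integrableOn_hankelFun_ray (w + 1) hθ ha).const_mul _)).mul_const _)
    (tendsto_hankelFun_ray w hθ ha)
  rw [h, ray_zero, zero_sub]

lemma hankelFun_ofReal_im (w : ℝ) {a : ℝ} (ha : 0 < a) : (hankelFun w a).im = 0 := by
  rw [hankelFun, ← Complex.ofReal_neg, ← Complex.ofReal_cpow ha.le, ← Complex.ofReal_exp,
    ← Complex.ofReal_mul, Complex.ofReal_im]

/-- The boundary term of `hankelRay_sub` is real, so it drops out of the imaginary part. -/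
lemma hankelRay_im_recurrence {θ a : ℝ} (w : ℝ) (hθ : θ ∈ Ioo (Real.pi / 2) Real.pi)
    (ha : 0 < a) : (hankelRay w θ a).im = w * (hankelRay (w + 1) θ a).im := by
  have h := hankelRay_sub w hθ ha
  simp only [sub_mul, mul_assoc] at h
  rw [integral_sub ((integrableOn_hankelFun_ray w hθ ha).mul_const _)
    (((integrableOn_hankelFun_ray (w + 1) hθ ha).mul_const _).const_mul _),
    integral_const_mul] at h
  have h2 := congrArg Complex.im h
  rw [Complex.neg_im, hankelFun_ofReal_im w ha, Complex.sub_im, Complex.im_ofReal_mul] at h2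
  simp only [hankelRay]
  linarith

/-- Moving the base point translates the ray, so differentiating under the integral produces exactly
the integrand of `hankelRay_sub`. -/
lemma hasDerivAt_hankelRay {θ a : ℝ} (w : ℝ) (hθ : θ ∈ Ioo (Real.pi / 2) Real.pi)
    (ha : 0 < a) : HasDerivAt (hankelRay w θ) (-hankelFun w a) a := by
  have hs : Ioo (a / 2) (a + 1) ∈ 𝓝 a := Ioo_mem_nhds (by linarith) (by linarith)
  rw [← hankelRay_sub w hθ ha]
  refine (hasDerivAt_integral_of_dominated_loc_of_deriv_le (𝕜 := ℝ)
    (F := fun a r => hankelFun w (ray θ a r) * Complex.exp (θ * Complex.I))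
    (F' := fun a r => (hankelFun w (ray θ a r) - w * hankelFun (w + 1) (ray θ a r)) *
      Complex.exp (θ * Complex.I)) (μ := volume.restrict (Ioi 0))
    (bound := fun r => Real.exp (a + 1) * (Real.exp (-(-Real.cos θ) * r) *
      ((a / 2 * Real.sin θ)⁻¹ + 1 + (a + 1) + r) ^ (|w|)) + |w| * (Real.exp (a + 1) *
      (Real.exp (-(-Real.cos θ) * r) * ((a / 2 * Real.sin θ)⁻¹ + 1 + (a + 1) + r) ^ (|w + 1|))))
    hs ?_ ?_ ?_ ?_ ?_ ?_).2
  · filter_upwards [hs] with x hx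
    exact (aesm_hankelFun_ray w (angle_mem hθ) (by linarith [hx.1])).mul_const _
  · exact (integrableOn_hankelFun_ray w hθ ha).mul_const _
  · exact ((aesm_hankelFun_ray w (angle_mem hθ) ha).sub
      ((aesm_hankelFun_ray (w + 1) (angle_mem hθ) ha).const_mul _)).mul_const _
  · refine (ae_restrict_iff' measurableSet_Ioi).2 (ae_of_all _ fun r hr x hx => ?_)
    rw [norm_mul, norm_exp_angle, mul_one]
    refine (norm_sub_le _ _).trans (add_le_add ?_ ?_)
    · exact norm_hankelFun_ray_le (angle_mem hθ) (half_pos ha) hx.1.le hx.2.le (le_of_lt hr) le_rfl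
    · rw [norm_mul, Complex.norm_real, Real.norm_eq_abs]
      exact mul_le_mul_of_nonneg_left (norm_hankelFun_ray_le (angle_mem hθ) (half_pos ha) hx.1.le
        hx.2.le (le_of_lt hr) le_rfl) (abs_nonneg _)
  · exact (integrableOn_hankel_bound _ hθ (half_pos ha) (by linarith)).add
      ((integrableOn_hankel_bound _ hθ (half_pos ha) (by linarith)).const_mul _)
  · refine (ae_restrict_iff' measurableSet_Ioi).2 (ae_of_all _ fun r hr x hx => ?_)
    have := (hasDerivAt_hankelFun w (ray_mem_slitPlane (angle_mem hθ)
      (show 0 < x by linarith [hx.1]) (le_of_lt hr))).comp x (hasDerivAt_ray_base θ x r)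
    simpa using this.mul_const _

/-- The derivative in the base point is real, so the imaginary part is constant. This replaces a
contour deformation. -/
lemma hankelRay_im_eq {θ a a' : ℝ} (w : ℝ) (hθ : θ ∈ Ioo (Real.pi / 2) Real.pi)
    (ha : 0 < a) (ha' : 0 < a') : (hankelRay w θ a).im = (hankelRay w θ a').im := by
  have hd : ∀ x ∈ Ioi (0 : ℝ), HasDerivAt (fun x => (hankelRay w θ x).im) 0 x := fun x hx => by
    have := (Complex.imCLM.hasFDerivAt.comp_hasDerivAt x (hasDerivAt_hankelRay w hθ hx))
    simpa [hankelFun_ofReal_im w hx, Function.comp_def] using this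
  exact isOpen_Ioi.is_const_of_deriv_eq_zero isPreconnected_Ioi
    (fun x hx => (hd x hx).differentiableAt.differentiableWithinAt)
    (fun x hx => (hd x hx).deriv) ha ha'

/-! ### Laplace transforms -/

lemma aemeasurable_of_laplace {g : ℝ → ℂ} {ε : ℝ}
    (hg : IntegrableOn (fun t => Real.exp (-ε * t) • g t) (Ioi 0)) :
    AEStronglyMeasurable g (volume.restrict (Ioi 0)) := by
  have h : AEStronglyMeasurable (fun t : ℝ => Real.exp (ε * t)) (volume.restrict (Ioi 0)) :=
    (by fun_prop : Continuous fun t : ℝ => Real.exp (ε * t)).aestronglyMeasurable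
  refine (h.smul hg.aestronglyMeasurable).congr (ae_of_all _ fun t => ?_)
  simp only [Pi.smul_apply', smul_smul, ← Real.exp_add]
  simp

lemma norm_cexp_neg_mul_ofReal (s : ℂ) (t : ℝ) :
    ‖Complex.exp (-s * t)‖ = Real.exp (-s.re * t) := by
  rw [Complex.norm_exp, Complex.re_mul_ofReal, Complex.neg_re]

lemma integrableOn_laplace {g : ℝ → ℂ}
    (hg : ∀ ε > 0, IntegrableOn (fun t => Real.exp (-ε * t) • g t) (Ioi 0)) {s : ℂ}
    (hs : 0 < s.re) : IntegrableOn (fun t : ℝ => Complex.exp (-s * t) * g t) (Ioi 0) := by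
  have hgm := aemeasurable_of_laplace (hg 1 one_pos)
  refine (hg s.re hs).norm.mono' ((by fun_prop : Continuous
    fun t : ℝ => Complex.exp (-s * t)).aestronglyMeasurable.mul hgm) (ae_of_all _ fun t => ?_)
  rw [norm_mul, norm_cexp_neg_mul_ofReal, norm_smul, Real.norm_of_nonneg (Real.exp_pos _).le]

lemma hasDerivAt_laplace {g : ℝ → ℂ}
    (hg : ∀ ε > 0, IntegrableOn (fun t => Real.exp (-ε * t) • g t) (Ioi 0)) {s : ℂ}
    (hs : 0 < s.re) : HasDerivAt (fun s : ℂ => ∫ t in Ioi (0 : ℝ), Complex.exp (-s * t) * g t)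
      (∫ t in Ioi (0 : ℝ), -t * Complex.exp (-s * t) * g t) s := by
  have hgm := aemeasurable_of_laplace (hg 1 one_pos)
  -- On the ball of radius `Re s / 3` the real part stays above `2 Re s / 3`. One third of the decay
  -- pays for the factor `t`, and the other is kept for integrability.
  have hδ : 0 < s.re / 3 := by positivity
  have hc : ∀ s : ℂ, Continuous fun t : ℝ => Complex.exp (-s * t) := fun _ => by fun_prop
  refine (hasDerivAt_integral_of_dominated_loc_of_deriv_le (𝕜 := ℂ)
    (F' := fun s t => -t * Complex.exp (-s * t) * g t) (μ := volume.restrict (Ioi (0 : ℝ)))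
    (bound := fun t => (s.re / 3)⁻¹ * ‖Real.exp (-(s.re / 3) * t) • g t‖)
    (Metric.ball_mem_nhds s hδ) ?_ ?_ ?_ ?_ ?_ ?_).2
  · exact Eventually.of_forall fun s => (hc s).aestronglyMeasurable.mul hgm
  · exact integrableOn_laplace hg hs
  · exact ((by fun_prop : Continuous fun t : ℝ => -(t : ℂ) * Complex.exp (-s * t)).aestronglyMeasurable).mul hgm
  · refine (ae_restrict_iff' measurableSet_Ioi).2 (ae_of_all _ fun t (ht : 0 < t) x hx => ?_)
    rw [norm_mul, norm_mul, norm_neg, Complex.norm_real, norm_cexp_neg_mul_ofReal, norm_smul,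
      Real.norm_of_nonneg ht.le, Real.norm_of_nonneg (Real.exp_pos _).le, ← mul_assoc]
    refine mul_le_mul_of_nonneg_right ?_ (norm_nonneg _)
    have h1 : 2 * (s.re / 3) ≤ x.re := by
      have := (Complex.abs_re_le_norm (x - s)).trans (le_of_lt (mem_ball_iff_norm.1 hx))
      rw [Complex.sub_re, abs_le] at this
      linarith
    have h2 : t ≤ (s.re / 3)⁻¹ * Real.exp (s.re / 3 * t) := by
      rw [inv_mul_eq_div, le_div_iff₀ hδ, mul_comm]
      linarith [Real.add_one_le_exp (s.re / 3 * t)]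
    calc t * Real.exp (-x.re * t)
        ≤ ((s.re / 3)⁻¹ * Real.exp (s.re / 3 * t)) * Real.exp (-(2 * (s.re / 3)) * t) := by
          refine mul_le_mul h2 (Real.exp_le_exp.2 (by nlinarith)) (by positivity) (by positivity)
      _ = _ := by
          rw [mul_assoc, ← Real.exp_add]; congr 2; ring
  · exact (hg _ hδ).norm.const_mul _
  · refine ae_of_all _ fun t x _ => ?_
    have h : HasDerivAt (fun s : ℂ => -s * t) (-1 * t) x := (hasDerivAt_id x).neg.mul_const _
    refine (h.cexp.mul_const (g t)).congr_deriv ?_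
    ring

lemma analyticOnNhd_laplace {g : ℝ → ℂ}
    (hg : ∀ ε > 0, IntegrableOn (fun t => Real.exp (-ε * t) • g t) (Ioi 0)) :
    AnalyticOnNhd ℂ (fun s : ℂ => ∫ t in Ioi (0 : ℝ), Complex.exp (-s * t) * g t)
      {s | 0 < s.re} :=
  DifferentiableOn.analyticOnNhd
    (fun _ hs => (hasDerivAt_laplace hg hs).differentiableAt.differentiableWithinAt)
    (isOpen_lt continuous_const Complex.continuous_re)

lemma isPreconnected_rightHalfPlane : IsPreconnected {s : ℂ | 0 < s.re} :=
  (convex_halfSpace_re_gt 0).isPreconnected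

lemma analyticOnNhd_cpow_rightHalfPlane (c : ℂ) :
    AnalyticOnNhd ℂ (fun s : ℂ => s ^ c) {s | 0 < s.re} := fun _ hs =>
  analyticAt_id.cpow analyticAt_const (Complex.mem_slitPlane_iff.2 (Or.inl hs))

lemma integrableOn_exp_neg_smul_rpow {p ε : ℝ} (hp : 0 < p) (hε : 0 < ε) :
    IntegrableOn (fun t : ℝ => Real.exp (-ε * t) • ((t ^ (p - 1) : ℝ) : ℂ)) (Ioi 0) := by
  have := (integrableOn_rpow_mul_exp_neg_mul_rpow (s := p - 1) (p := 1) (b := ε)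
    (by linarith) one_pos hε).ofReal (𝕜 := ℂ)
  refine this.congr (ae_of_all _ fun t => ?_)
  simp [mul_comm]

/-- Euler's integral for the Gamma function in the right half-plane. -/
lemma integral_cexp_neg_mul_rpow {p : ℝ} (hp : 0 < p) {s : ℂ} (hs : 0 < s.re) :
    ∫ t in Ioi (0 : ℝ), Complex.exp (-s * t) * ((t ^ (p - 1) : ℝ) : ℂ) =
      Real.Gamma p * s ^ (-p : ℂ) := by
  -- Both sides are analytic in the half-plane and agree at positive reals, which accumulate at `1`.
  have h := AnalyticOnNhd.eqOn_of_preconnected_of_frequently_eq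
    (analyticOnNhd_laplace fun ε hε => integrableOn_exp_neg_smul_rpow hp hε)
    ((analyticOnNhd_const (v := (Real.Gamma p : ℂ))).mul
      (analyticOnNhd_cpow_rightHalfPlane (-p : ℂ)))
    isPreconnected_rightHalfPlane (z₀ := ((1 : ℝ) : ℂ)) (by simp) ?_
  · exact h hs
  · have ht : Tendsto (fun x : ℝ => (x : ℂ)) (𝓝[≠] 1) (𝓝[≠] ((1 : ℝ) : ℂ)) :=
      Complex.continuous_ofReal.continuousAt.continuousWithinAt.tendsto_nhdsWithin
        fun x hx => by simpa using hx
    refine ht.frequently (Eventually.frequently ?_)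
    filter_upwards [nhdsWithin_le_nhds (Ioi_mem_nhds one_pos)] with x (hx : 0 < x)
    have h1 := Real.integral_rpow_mul_exp_neg_mul_Ioi hp hx
    rw [one_div, Real.inv_rpow hx.le, ← Real.rpow_neg hx.le] at h1
    rw [show (-(p : ℂ)) = ((-p : ℝ) : ℂ) from (Complex.ofReal_neg p).symm,
      ← Complex.ofReal_cpow hx.le, ← Complex.ofReal_mul, mul_comm, ← h1, ← integral_complex_ofReal]
    refine integral_congr_ae (ae_of_all _ fun t => ?_)
    push_cast
    ring_nf

lemma ray_base_zero (θ r : ℝ) : ray θ 0 r = r * Complex.exp (θ * Complex.I) := by simp [ray]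

/-- The reflection formula in a form that survives at the poles `w = 0, -1, …`, where both sides are
zero under the conventions for `Real.Gamma` and division. -/
lemma sin_mul_Gamma_one_sub {w : ℝ} (hw : w < 1) :
    Real.sin (Real.pi * w) * Real.Gamma (1 - w) = Real.pi / Real.Gamma w := by
  have h := Real.Gamma_mul_Gamma_one_sub w
  have hG : Real.Gamma (1 - w) ≠ 0 := (Real.Gamma_pos_of_pos (by linarith)).ne'
  by_cases hs : Real.sin (Real.pi * w) = 0
  · rw [hs, div_zero, mul_eq_zero, or_iff_left hG] at h
    rw [hs, h, zero_mul, div_zero]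
  · have : Real.Gamma w ≠ 0 := fun h0 => by
      rw [h0, zero_mul, eq_comm, div_eq_zero_iff] at h
      exact h.elim Real.pi_ne_zero hs
    rw [eq_div_iff this]
    rw [eq_div_iff hs] at h
    linarith

lemma ofReal_mul_cpow {r : ℝ} (hr : 0 < r) {z : ℂ} (hz : z ≠ 0) (c : ℂ) :
    ((r : ℂ) * z) ^ c = (r : ℂ) ^ c * z ^ c := by
  have h0 : (r : ℂ) ≠ 0 := Complex.ofReal_ne_zero.2 hr.ne'
  rw [Complex.cpow_def_of_ne_zero (mul_ne_zero h0 hz), Complex.cpow_def_of_ne_zero h0,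
    Complex.cpow_def_of_ne_zero hz, Complex.log_ofReal_mul hr hz, add_mul, Complex.exp_add,
    Complex.ofReal_log hr.le]

/-- From the origin the ray integral is Euler's integral at `s = -exp(iθ)`, which lies in the right
half-plane because `θ > π/2`. -/
lemma hankelRay_zero {θ w : ℝ} (hθ : θ ∈ Ioo (Real.pi / 2) Real.pi) (hw : w < 1) :
    hankelRay w θ 0 = Complex.exp ((Real.pi * (1 - w) : ℝ) * Complex.I) * Real.Gamma (1 - w) := by
  have hre : 0 < (-Complex.exp (θ * Complex.I)).re := by
    rw [Complex.neg_re, Complex.exp_ofReal_mul_I_re]; exact neg_cos_pos hθ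
  have h := integral_cexp_neg_mul_rpow (p := 1 - w) (by linarith) hre
  -- The angle `θ - π` is the principal argument of `-exp(iθ)`, as complex powers require.
  have harg : Complex.exp (((θ - Real.pi : ℝ) : ℂ) * Complex.I) = -Complex.exp (θ * Complex.I) := by
    rw [Complex.ofReal_sub, sub_mul, Complex.exp_sub, Complex.exp_pi_mul_I, div_neg, div_one]
  have hpow : ∀ x ∈ Ioc (-Real.pi) Real.pi, ∀ c : ℂ,
      Complex.exp ((x : ℂ) * Complex.I) ^ c = Complex.exp (x * Complex.I * c) := fun x hx c => by
    rw [Complex.cpow_def_of_ne_zero (Complex.exp_ne_zero _), Complex.log_exp] <;> simp [hx.1, hx.2]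
  have hπ := Real.pi_pos
  rw [← harg, hpow _ ⟨by linarith [hθ.1], by linarith [hθ.2]⟩, harg] at h
  have h2 : hankelRay w θ 0 = Complex.exp (θ * Complex.I * (1 - w)) *
      ∫ t in Ioi (0 : ℝ), Complex.exp (-(-Complex.exp (θ * Complex.I)) * t) *
        ((t ^ (1 - w - 1) : ℝ) : ℂ) := by
    rw [hankelRay, ← integral_const_mul]
    refine setIntegral_congr_fun measurableSet_Ioi fun r (hr : 0 < r) => ?_
    simp only [hankelFun, ray_base_zero]
    rw [ofReal_mul_cpow hr (Complex.exp_ne_zero _), hpow _ ⟨by linarith [hθ.1], hθ.2.le⟩,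
      show 1 - w - 1 = -w by ring, Complex.ofReal_cpow hr.le,
      show (θ : ℂ) * Complex.I * (1 - w) = θ * Complex.I * -w + θ * Complex.I by ring,
      Complex.exp_add, neg_neg, mul_comm (r : ℂ), Complex.ofReal_neg]
    ring
  rw [h2, h, mul_left_comm, ← Complex.exp_add, mul_comm]
  congr 2
  push_cast
  ring

/-- For `w < 0` the factor `|σ|^(-w)` is bounded near the origin, so the limit `a → 0` is dominated.
-/
lemma tendsto_hankelRay_zero {θ w : ℝ} (hθ : θ ∈ Ioo (Real.pi / 2) Real.pi) (hw : w < 0) :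
    Tendsto (hankelRay w θ) (𝓝[>] 0) (𝓝 (hankelRay w θ 0)) := by
  refine tendsto_integral_filter_of_dominated_convergence
    (fun r => Real.exp 1 * (Real.exp (-(-Real.cos θ) * r) * (1 + r) ^ (-w))) ?_ ?_
    ((integrableOn_exp_neg_mul_rpow (neg_cos_pos hθ) one_pos).const_mul _) ?_
  · filter_upwards [self_mem_nhdsWithin] with a ha
    exact (aesm_hankelFun_ray w (angle_mem hθ) ha).mul_const _
  · filter_upwards [Ioc_mem_nhdsGT one_pos] with a ha
    refine (ae_restrict_iff' measurableSet_Ioi).2 (ae_of_all _ fun r (hr : 0 < r) => ?_)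
    rw [norm_mul, norm_exp_angle, mul_one, norm_hankelFun, ray_re, ← mul_assoc, ← Real.exp_add]
    have := norm_ray_le (θ := θ) ha.1.le hr.le
    refine mul_le_mul (Real.exp_le_exp.2 (by linarith [ha.2])) (Real.rpow_le_rpow (norm_nonneg _)
      (by linarith [ha.2]) (by linarith)) (by positivity) (by positivity)
  · refine (ae_restrict_iff' measurableSet_Ioi).2 (ae_of_all _ fun r (hr : 0 < r) => ?_)
    have hsl : ray θ 0 r ∈ Complex.slitPlane := by
      rw [Complex.mem_slitPlane_iff, ray_im]
      exact Or.inr (mul_pos hr (Real.sin_pos_of_pos_of_lt_pi (angle_mem hθ).1 hθ.2)).ne'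
    exact ((ContinuousAt.comp (x := (0 : ℝ)) (f := fun a => ray θ a r)
      (hasDerivAt_hankelFun w hsl).continuousAt
      (hasDerivAt_ray_base θ 0 r).continuousAt).mul_const _).continuousWithinAt

/-- Needed to reach `w = 1`: the recurrence at `w = 0` reads `0 = 0` and says nothing there. -/
lemma continuousAt_hankelRay_exponent {θ a : ℝ} (w : ℝ) (hθ : θ ∈ Ioo (Real.pi / 2) Real.pi)
    (ha : 0 < a) : ContinuousAt (fun w => hankelRay w θ a) w := by
  refine tendsto_integral_filter_of_dominated_convergence _
    (Eventually.of_forall fun w => (aesm_hankelFun_ray w (angle_mem hθ) ha).mul_const _) ?_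
    (integrableOn_hankel_bound (|w| + 1) hθ ha ha.le) ?_
  · have h1 : ∀ᶠ v in 𝓝 w, |v| < |w| + 1 :=
      continuous_abs.continuousAt.eventually_lt continuousAt_const (by linarith)
    filter_upwards [h1] with v hv
    refine (ae_restrict_iff' measurableSet_Ioi).2 (ae_of_all _ fun r (hr : 0 < r) => ?_)
    rw [norm_mul, norm_exp_angle, mul_one]
    exact norm_hankelFun_ray_le (angle_mem hθ) ha le_rfl le_rfl hr.le hv.le
  · refine (ae_restrict_iff' measurableSet_Ioi).2 (ae_of_all _ fun r (hr : 0 < r) => ?_)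
    have h0 := ray_ne_zero (angle_mem hθ) ha hr.le
    have : Continuous fun w : ℝ => hankelFun w (ray θ a r) * Complex.exp (θ * Complex.I) := by
      unfold hankelFun
      exact (continuous_const.mul (Continuous.const_cpow (by fun_prop) (Or.inl h0))).mul
        continuous_const
    exact this.continuousAt

/-- Hankel's formula for the reciprocal Gamma function. -/
theorem hankelRay_im {θ a : ℝ} (w : ℝ) (hθ : θ ∈ Ioo (Real.pi / 2) Real.pi) (ha : 0 < a) :
    (hankelRay w θ a).im = Real.pi / Real.Gamma w := by
  have hstep : ∀ w : ℝ, w ≠ 0 → (hankelRay w θ a).im = Real.pi / Real.Gamma w →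
      (hankelRay (w + 1) θ a).im = Real.pi / Real.Gamma (w + 1) := fun w hw h => by
    rw [hankelRay_im_recurrence w hθ ha] at h
    rw [Real.Gamma_add_one hw, div_mul_eq_div_div_swap, ← h, mul_div_cancel_left₀ _ hw]
  -- For negative `w` the imaginary part does not depend on the base point, which may thus be sent
  -- to the origin and Euler's integral used.
  have hneg : ∀ w < 0, (hankelRay w θ a).im = Real.pi / Real.Gamma w := fun w hw => by
    have h1 := (Complex.continuous_im.tendsto _).comp (tendsto_hankelRay_zero hθ hw)
    have h2 : Tendsto (Complex.im ∘ hankelRay w θ) (𝓝[>] 0) (𝓝 (hankelRay w θ a).im) := by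
      refine tendsto_const_nhds.congr' ?_
      filter_upwards [self_mem_nhdsWithin] with x hx
      exact hankelRay_im_eq w hθ ha hx
    rw [tendsto_nhds_unique h2 h1, hankelRay_zero hθ (by linarith), mul_comm, Complex.im_ofReal_mul,
      Complex.exp_ofReal_mul_I_im, ← sin_mul_Gamma_one_sub (by linarith),
      show Real.pi * (1 - w) = Real.pi - Real.pi * w by ring, Real.sin_pi_sub, mul_comm]
  have hlt : ∀ w < 1, (hankelRay w θ a).im = Real.pi / Real.Gamma w := fun w hw => by
    have := hstep (w - 1) (by linarith) (hneg _ (by linarith))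
    rwa [sub_add_cancel] at this
  -- The recurrence cannot pass from `0` to `1`, so this value is taken as a limit from the left.
  have hone : (hankelRay 1 θ a).im = Real.pi / Real.Gamma 1 := by
    have h1 : Tendsto (fun w => (hankelRay w θ a).im) (𝓝[<] 1) (𝓝 (hankelRay 1 θ a).im) :=
      (Complex.continuous_im.continuousAt.comp
        (continuousAt_hankelRay_exponent 1 hθ ha)).continuousWithinAt
    have h2 : Tendsto (fun w => Real.pi / Real.Gamma w) (𝓝[<] 1) (𝓝 (Real.pi / Real.Gamma 1)) :=
      (continuousAt_const.div (Real.differentiableAt_Gamma fun m => by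
        have : (0 : ℝ) ≤ m := m.cast_nonneg
        linarith).continuousAt
        (by simp)).continuousWithinAt
    refine tendsto_nhds_unique h1 (h2.congr' ?_)
    filter_upwards [self_mem_nhdsWithin] with x hx using (hlt x hx).symm
  have hall : ∀ n : ℕ, ∀ w ≤ (n : ℝ) + 1, (hankelRay w θ a).im = Real.pi / Real.Gamma w := by
    intro n
    induction n with
    | zero =>
      intro w hw
      rcases hw.lt_or_eq with h | h
      · exact hlt w (by simpa using h)
      · rw [h]; simpa using hone
    | succ n ih =>
      intro w hw
      rcases le_or_gt w 1 with h | h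
      · exact ih w (by linarith [(Nat.cast_nonneg n : (0 : ℝ) ≤ n)])
      · have := hstep (w - 1) (by linarith) (ih _ (by push_cast at hw; linarith))
        rwa [sub_add_cancel] at this
  obtain ⟨n, hn⟩ := exists_nat_ge w
  exact hall n w (by linarith)

/-! ### The Wright function -/

/-- `θ > π/2` makes `exp σ` decay along the ray, while `γ θ < π/2` keeps `Re σ^γ` positive. -/
lemma exists_angle {γ : ℝ} (hγ : γ ∈ Ioo 0 1) :
    ∃ θ ∈ Ioo (Real.pi / 2) Real.pi, γ * θ < Real.pi / 2 := by
  have h1 : Real.pi / 2 < min Real.pi (Real.pi / (2 * γ)) := by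
    have hπ := Real.pi_pos
    refine lt_min (by linarith) ?_
    rw [lt_div_iff₀ (by linarith [hγ.1])]
    nlinarith [hγ.2]
  obtain ⟨θ, h2, h3⟩ := exists_between h1
  refine ⟨θ, ⟨h2, h3.trans_le (min_le_left _ _)⟩, ?_⟩
  have h4 := h3.trans_le (min_le_right _ _)
  rw [lt_div_iff₀ (by linarith [hγ.1])] at h4
  linarith

/-- `|σ| sin(arg σ - θ) = -a sin θ` is negative, which excludes `arg σ > θ`. -/
lemma arg_ray_mem {θ a r : ℝ} (hθ : θ ∈ Ioo 0 Real.pi) (ha : 0 < a) (hr : 0 ≤ r) :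
    (ray θ a r).arg ∈ Icc 0 θ := by
  have hs := Real.sin_pos_of_pos_of_lt_pi hθ.1 hθ.2
  have h0 : 0 ≤ (ray θ a r).arg := by
    rw [Complex.arg_nonneg_iff, ray_im]; positivity
  refine ⟨h0, le_of_not_gt fun hlt => ?_⟩
  have h1 : 0 < Real.sin ((ray θ a r).arg - θ) :=
    Real.sin_pos_of_pos_of_lt_pi (by linarith) (by linarith [Complex.arg_le_pi (ray θ a r), hθ.1])
  have hn := norm_pos_iff.2 (ray_ne_zero hθ ha hr)
  have h2 := mul_pos hn h1
  rw [Real.sin_sub, mul_sub, ← mul_assoc, ← mul_assoc, Complex.norm_mul_sin_arg,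
    Complex.norm_mul_cos_arg, ray_re, ray_im] at h2
  nlinarith

lemma cpow_re_eq (σ : ℂ) (γ : ℝ) (hσ : σ ≠ 0) :
    (σ ^ (γ : ℂ)).re = ‖σ‖ ^ γ * Real.cos (γ * σ.arg) := by
  rw [Complex.cpow_def_of_ne_zero hσ, Complex.exp_re, Complex.re_mul_ofReal, Complex.im_mul_ofReal,
    Complex.log_re, Complex.log_im, Real.rpow_def_of_pos (norm_pos_iff.2 hσ), mul_comm γ]

/-- The argument of `σ^γ` stays in `[0, γθ]`, below `π/2`. The lower bound tends to infinity with
`a`, and this is the source of the arbitrary exponential decay of the Wright functions. -/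
lemma le_cpow_ray_re {θ a r γ : ℝ} (hθ : θ ∈ Ioo 0 Real.pi) (hγ : 0 ≤ γ)
    (hγθ : γ * θ < Real.pi / 2) (ha : 0 < a) (hr : 0 ≤ r) :
    (a * Real.sin θ) ^ γ * Real.cos (γ * θ) ≤ (ray θ a r ^ (γ : ℂ)).re := by
  have hs := Real.sin_pos_of_pos_of_lt_pi hθ.1 hθ.2
  have h1 := arg_ray_mem hθ ha hr
  have h2 : γ * (ray θ a r).arg ≤ γ * θ := mul_le_mul_of_nonneg_left h1.2 hγ
  have h3 : 0 ≤ γ * (ray θ a r).arg := mul_nonneg hγ h1.1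
  have hπ := Real.pi_pos
  rw [cpow_re_eq _ _ (ray_ne_zero hθ ha hr)]
  refine mul_le_mul (Real.rpow_le_rpow (by positivity) (le_norm_ray hθ ha.le) hγ)
    (Real.cos_le_cos_of_nonneg_of_le_pi h3 (by linarith) h2)
    (Real.cos_nonneg_of_neg_pi_div_two_le_of_le (by linarith) hγθ.le) (by positivity)

lemma hankelFun_sub_mul {σ : ℂ} (hσ : σ ≠ 0) (m γ : ℝ) (n : ℕ) :
    hankelFun (m - n * γ) σ = hankelFun m σ * (σ ^ (γ : ℂ)) ^ n := by
  rw [hankelFun, hankelFun, mul_assoc, ← Complex.cpow_nat_mul, ← Complex.cpow_add _ _ hσ]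
  congr 2
  push_cast
  ring

lemma hankelFun_sub {σ : ℂ} (hσ : σ ≠ 0) (m γ : ℝ) :
    hankelFun (m - γ) σ = hankelFun m σ * σ ^ (γ : ℂ) := by
  simpa using hankelFun_sub_mul hσ m γ 1

lemma measurable_hankelFun (w : ℝ) : Measurable (hankelFun w) := by
  unfold hankelFun; exact Complex.measurable_exp.mul (measurable_id.pow_const _)

/-- The integral of `e^(σ - z σ^γ) σ^(-m)` along a ray. -/
noncomputable def wrightRay (γ m θ a z : ℝ) : ℂ :=
  ∫ r in Ioi (0 : ℝ), hankelFun m (ray θ a r) * Complex.exp (-z * ray θ a r ^ (γ : ℂ)) *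
    Complex.exp (θ * Complex.I)

lemma norm_ray_cpow (θ a r γ : ℝ) : ‖ray θ a r ^ (γ : ℂ)‖ = ‖ray θ a r‖ ^ γ :=
  Complex.norm_cpow_real _ _

/-- An integrable majorant for the integrands of `wrightRay`. -/
noncomputable def wrightBound (γ m θ a Z r : ℝ) : ℝ :=
  Real.exp a * (Real.exp (-(-Real.cos θ) * r) * (((a * Real.sin θ)⁻¹ + 1 + a + r) ^ |m| *
    Real.exp (Z * ((a * Real.sin θ)⁻¹ + 1 + a + r) ^ γ)))

lemma integrableOn_wrightBound {γ θ a : ℝ} (m Z : ℝ) (hγ : γ < 1)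
    (hθ : θ ∈ Ioo (Real.pi / 2) Real.pi) (ha : 0 < a) :
    IntegrableOn (wrightBound γ m θ a Z) (Ioi 0) := by
  have := Real.sin_pos_of_pos_of_lt_pi (angle_mem hθ).1 hθ.2
  exact (integrableOn_exp_neg_mul_rpow_mul_exp (neg_cos_pos hθ) (by positivity) hγ).const_mul _

lemma norm_hankelFun_mul_exp_le {γ m θ a Z r : ℝ} (hγ : 0 ≤ γ) (hθ : θ ∈ Ioo 0 Real.pi)
    (ha : 0 < a) (hr : 0 ≤ r) (hZ : 0 ≤ Z) :
    ‖hankelFun m (ray θ a r)‖ * Real.exp (Z * ‖ray θ a r‖ ^ γ) ≤ wrightBound γ m θ a Z r := by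
  have hs := Real.sin_pos_of_pos_of_lt_pi hθ.1 hθ.2
  have h1 := norm_hankelFun_ray_le (w := m) hθ ha le_rfl le_rfl hr le_rfl
  have h2 := norm_ray_le (θ := θ) ha.le hr
  have h3 : 0 < (a * Real.sin θ)⁻¹ := by positivity
  rw [wrightBound, ← mul_assoc (Real.exp (-(-Real.cos θ) * r)), ← mul_assoc]
  refine mul_le_mul h1 (Real.exp_le_exp.2 (mul_le_mul_of_nonneg_left ?_ hZ)) (by positivity)
    (by positivity)
  exact Real.rpow_le_rpow (norm_nonneg _) (by linarith) hγ

lemma norm_cexp_neg_mul_le (z : ℝ) {Z : ℝ} (hZ : |z| ≤ Z) (w : ℂ) :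
    ‖Complex.exp (-z * w)‖ ≤ Real.exp (Z * ‖w‖) := by
  refine (Complex.norm_exp_le_exp_norm _).trans (Real.exp_le_exp.2 ?_)
  rw [norm_mul, norm_neg, Complex.norm_real]
  exact mul_le_mul_of_nonneg_right hZ (norm_nonneg _)

lemma measurable_wrightRay_integrand (γ m θ a : ℝ) : Measurable fun p : ℝ × ℝ =>
    hankelFun m (ray θ a p.2) * Complex.exp (-p.1 * ray θ a p.2 ^ (γ : ℂ)) *
      Complex.exp (θ * Complex.I) := by
  have hr : Measurable fun p : ℝ × ℝ => ray θ a p.2 :=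
    (continuous_ray θ a).measurable.comp measurable_snd
  refine (((measurable_hankelFun m).comp hr).mul ?_).mul_const _
  exact (Complex.measurable_ofReal.comp measurable_fst).neg.mul (hr.pow_const _) |>.cexp

lemma aesm_wrightRay_integrand (γ m θ a z : ℝ) (μ : Measure ℝ) : AEStronglyMeasurable (fun r =>
    hankelFun m (ray θ a r) * Complex.exp (-z * ray θ a r ^ (γ : ℂ)) *
      Complex.exp (θ * Complex.I)) μ :=
  ((measurable_wrightRay_integrand γ m θ a).comp measurable_prodMk_left).aestronglyMeasurable

lemma norm_wrightRay_integrand_le {γ m θ a z Z r : ℝ} (hγ : 0 ≤ γ) (hθ : θ ∈ Ioo 0 Real.pi)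
    (ha : 0 < a) (hr : 0 ≤ r) (hZ : |z| ≤ Z) :
    ‖hankelFun m (ray θ a r) * Complex.exp (-z * ray θ a r ^ (γ : ℂ)) *
      Complex.exp (θ * Complex.I)‖ ≤ wrightBound γ m θ a Z r := by
  rw [norm_mul, norm_exp_angle, mul_one, norm_mul]
  refine le_trans ?_ (norm_hankelFun_mul_exp_le hγ hθ ha hr ((abs_nonneg z).trans hZ))
  rw [← norm_ray_cpow]
  exact mul_le_mul_of_nonneg_left (norm_cexp_neg_mul_le z hZ _) (norm_nonneg _)

lemma integrableOn_wrightRay_integrand {γ θ a : ℝ} (m z : ℝ) (hγ : γ ∈ Ioo 0 1)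
    (hθ : θ ∈ Ioo (Real.pi / 2) Real.pi) (ha : 0 < a) : IntegrableOn (fun r =>
    hankelFun m (ray θ a r) * Complex.exp (-z * ray θ a r ^ (γ : ℂ)) *
      Complex.exp (θ * Complex.I)) (Ioi 0) := by
  refine (integrableOn_wrightBound m |z| hγ.2 hθ ha).mono' (aesm_wrightRay_integrand _ _ _ _ _ _)
    ((ae_restrict_iff' measurableSet_Ioi).2 (ae_of_all _ fun r (hr : 0 < r) => ?_))
  exact norm_wrightRay_integrand_le hγ.1.le (angle_mem hθ) ha hr.le le_rfl

/-- The Wright function as a contour integral. -/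
theorem wright_eq_ray {γ θ a : ℝ} (m z : ℝ) (hγ : γ ∈ Ioo 0 1)
    (hθ : θ ∈ Ioo (Real.pi / 2) Real.pi) (ha : 0 < a) :
    wright (-γ) m (-z) = (wrightRay γ m θ a z).im / Real.pi := by
  have hexp : ∀ x : ℝ, HasSum (fun n : ℕ => x ^ n / (n.factorial : ℝ)) (Real.exp x) := fun x => by
    rw [Real.exp_eq_exp_ℝ]; exact NormedSpace.expSeries_div_hasSum_exp x
  have hcexp : ∀ x : ℂ, HasSum (fun n : ℕ => x ^ n / (n.factorial : ℂ)) (Complex.exp x) :=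
    fun x => by rw [Complex.exp_eq_exp_ℂ]; exact NormedSpace.expSeries_div_hasSum_exp x
  have hb : ∀ r, HasSum (fun n : ℕ => ‖hankelFun m (ray θ a r)‖ *
      ((|z| * ‖ray θ a r‖ ^ γ) ^ n / (n.factorial : ℝ)))
      (‖hankelFun m (ray θ a r)‖ * Real.exp (|z| * ‖ray θ a r‖ ^ γ)) :=
    fun r => (hexp _).mul_left _
  -- Expanding `exp(-z σ^γ)` makes the `n`-th term Hankel's integral with exponent `m - nγ`. The
  -- series of norms sums to `‖hankelFun m σ‖ exp(|z| |σ|^γ)`, which is integrable because `γ < 1`.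
  have h := hasSum_integral_of_dominated_convergence (μ := volume.restrict (Ioi (0 : ℝ)))
    (F := fun (n : ℕ) r => (((-z) ^ n / n.factorial : ℝ) : ℂ) *
      (hankelFun (m - n * γ) (ray θ a r) * Complex.exp (θ * Complex.I)))
    (f := fun r => hankelFun m (ray θ a r) * Complex.exp (-z * ray θ a r ^ (γ : ℂ)) *
      Complex.exp (θ * Complex.I))
    (fun n r => ‖hankelFun m (ray θ a r)‖ * ((|z| * ‖ray θ a r‖ ^ γ) ^ n / (n.factorial : ℝ)))
    (fun n => ((aesm_hankelFun_ray _ (angle_mem hθ) ha).mul_const _).const_mul _) ?_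
    (ae_of_all _ fun r => (hb r).summable) ?_ ?_
  · have h2 := (Complex.imCLM.hasSum h).div_const Real.pi
    rw [wright, wrightRay, ← Complex.imCLM_apply, ← h2.tsum_eq]
    refine tsum_congr fun n => ?_
    simp only [integral_const_mul, Complex.imCLM_apply, Complex.im_ofReal_mul]
    have := hankelRay_im (m - n * γ) hθ ha
    rw [hankelRay] at this
    rw [this, show (n : ℝ) * -γ + m = m - n * γ by ring]
    have := Real.pi_ne_zero
    field_simp
  · intro n
    refine (ae_restrict_iff' measurableSet_Ioi).2 (ae_of_all _ fun r (hr : 0 < r) => le_of_eq ?_)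
    rw [hankelFun_sub_mul (ray_ne_zero (angle_mem hθ) ha hr.le), norm_mul, norm_mul, norm_mul,
      norm_exp_angle, norm_pow, norm_ray_cpow, Complex.norm_real, norm_div, norm_pow, norm_neg,
      Real.norm_eq_abs, Real.norm_natCast, mul_pow]
    ring
  · simp_rw [(hb _).tsum_eq]
    refine (integrableOn_wrightBound m |z| hγ.2 hθ ha).mono' ?_
      ((ae_restrict_iff' measurableSet_Ioi).2 (ae_of_all _ fun r (hr : 0 < r) => ?_))
    · have hr : Measurable (ray θ a) := (continuous_ray θ a).measurable
      exact (((measurable_hankelFun m).comp hr).norm.mul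
        ((hr.norm.pow_const _).const_mul _).exp).aestronglyMeasurable
    · rw [Real.norm_of_nonneg (by positivity)]
      exact norm_hankelFun_mul_exp_le hγ.1.le (angle_mem hθ) ha hr.le (abs_nonneg z)
  · refine (ae_restrict_iff' measurableSet_Ioi).2 (ae_of_all _ fun r (hr : 0 < r) => ?_)
    have := ((hcexp (-z * ray θ a r ^ (γ : ℂ))).mul_left (hankelFun m (ray θ a r))).mul_right
      (Complex.exp (θ * Complex.I))
    refine this.congr_fun fun n => ?_
    rw [hankelFun_sub_mul (ray_ne_zero (angle_mem hθ) ha hr.le), mul_pow]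
    push_cast
    ring

/-- The Wright functions decay faster than any exponential. -/
theorem exists_norm_wright_le {γ : ℝ} (hγ : γ ∈ Ioo 0 1) (m c : ℝ) :
    ∃ K : ℝ, 0 ≤ K ∧ ∀ z : ℝ, 0 ≤ z → |wright (-γ) m (-z)| ≤ K * Real.exp (-c * z) := by
  obtain ⟨θ, hθ, hγθ⟩ := exists_angle hγ
  have hθ' := angle_mem hθ
  have hs := Real.sin_pos_of_pos_of_lt_pi hθ'.1 hθ'.2
  have hπ := Real.pi_pos
  have hcos : 0 < Real.cos (γ * θ) :=
    Real.cos_pos_of_mem_Ioo ⟨by linarith [mul_pos hγ.1 hθ'.1], hγθ⟩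
  have ht : Tendsto (fun a : ℝ => (a * Real.sin θ) ^ γ * Real.cos (γ * θ)) atTop atTop :=
    ((tendsto_rpow_atTop hγ.1).comp (tendsto_id.atTop_mul_const hs)).atTop_mul_const hcos
  -- The contour may start at any `a > 0`; far enough out, `Re σ^γ ≥ c` on the whole ray.
  obtain ⟨a, hac, ha⟩ := ((ht.eventually_ge_atTop c).and (eventually_gt_atTop 0)).exists
  refine ⟨(∫ r in Ioi (0 : ℝ), ‖hankelFun m (ray θ a r)‖) / Real.pi, by positivity, fun z hz => ?_⟩
  rw [wright_eq_ray m z hγ hθ ha, abs_div, abs_of_pos hπ, div_mul_eq_mul_div]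
  refine div_le_div_of_nonneg_right ((Complex.abs_im_le_norm _).trans ?_) hπ.le
  rw [← integral_mul_const]
  refine norm_integral_le_of_norm_le ((integrableOn_hankelFun_ray m hθ ha).norm.mul_const _)
    ((ae_restrict_iff' measurableSet_Ioi).2 (ae_of_all _ fun r (hr : 0 < r) => ?_))
  rw [norm_mul, norm_exp_angle, mul_one, norm_mul]
  refine mul_le_mul_of_nonneg_left ?_ (norm_nonneg _)
  rw [Complex.norm_exp, Real.exp_le_exp, ← Complex.ofReal_neg, Complex.re_ofReal_mul]
  have := le_cpow_ray_re hθ' hγ.1.le hγθ ha hr.le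
  nlinarith

/-- Differentiating the contour integral brings down `-σ^γ`, which lowers the exponent `m` by `γ`.
-/
theorem hasDerivAt_wright {γ : ℝ} (hγ : γ ∈ Ioo 0 1) (m z : ℝ) :
    HasDerivAt (fun z => wright (-γ) m (-z)) (-wright (-γ) (m - γ) (-z)) z := by
  obtain ⟨θ, hθ, hγθ⟩ := exists_angle hγ
  have h : HasDerivAt (wrightRay γ m θ 1) (∫ r in Ioi (0 : ℝ), -(hankelFun (m - γ) (ray θ 1 r) *
      Complex.exp (-z * ray θ 1 r ^ (γ : ℂ)) * Complex.exp (θ * Complex.I))) z := by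
    refine (hasDerivAt_integral_of_dominated_loc_of_deriv_le (𝕜 := ℝ)
      (F := fun z r => hankelFun m (ray θ 1 r) * Complex.exp (-z * ray θ 1 r ^ (γ : ℂ)) *
        Complex.exp (θ * Complex.I)) (bound := wrightBound γ (m - γ) θ 1 (|z| + 1))
      (F' := fun z r => -(hankelFun (m - γ) (ray θ 1 r) * Complex.exp (-z * ray θ 1 r ^ (γ : ℂ)) *
        Complex.exp (θ * Complex.I))) (Metric.ball_mem_nhds z one_pos)
      (Eventually.of_forall fun z => aesm_wrightRay_integrand _ _ _ _ _ _)
      (integrableOn_wrightRay_integrand m z hγ hθ one_pos)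
      (aesm_wrightRay_integrand _ _ _ _ _ _).neg ?_
      (integrableOn_wrightBound _ _ hγ.2 hθ one_pos) ?_).2
    · refine (ae_restrict_iff' measurableSet_Ioi).2 (ae_of_all _ fun r (hr : 0 < r) x hx => ?_)
      rw [norm_neg]
      refine norm_wrightRay_integrand_le hγ.1.le (angle_mem hθ) one_pos hr.le ?_
      have h1 := abs_sub_abs_le_abs_sub x z
      have h2 : |x - z| < 1 := by simpa [Real.dist_eq] using hx
      linarith
    · refine (ae_restrict_iff' measurableSet_Ioi).2 (ae_of_all _ fun r (hr : 0 < r) x hx => ?_)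
      have h1 : HasDerivAt (fun x : ℝ => -(x : ℂ) * ray θ 1 r ^ (γ : ℂ))
          (-1 * ray θ 1 r ^ (γ : ℂ)) x :=
        (Complex.ofRealCLM.hasDerivAt (x := x)).neg.mul_const _
      refine ((h1.cexp.const_mul (hankelFun m (ray θ 1 r))).mul_const _).congr_deriv ?_
      rw [hankelFun_sub (ray_ne_zero (angle_mem hθ) one_pos hr.le)]
      ring
  have h2 := (Complex.imCLM.hasFDerivAt.comp_hasDerivAt z h).div_const Real.pi
  have h3 : (fun z => wright (-γ) m (-z)) = fun z => (wrightRay γ m θ 1 z).im / Real.pi :=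
    funext fun z => wright_eq_ray m z hγ hθ one_pos
  rw [h3, wright_eq_ray (m - γ) z hγ hθ one_pos]
  refine h2.congr_deriv ?_
  rw [integral_neg, Complex.imCLM_apply, Complex.neg_im, neg_div, wrightRay]

lemma continuous_wright {γ : ℝ} (hγ : γ ∈ Ioo 0 1) (m : ℝ) :
    Continuous fun z => wright (-γ) m (-z) :=
  continuous_iff_continuousAt.2 fun z => (hasDerivAt_wright hγ m z).continuousAt

/-- The Mellin transform of the Wright functions. -/
theorem integral_rpow_mul_wright {γ : ℝ} (hγ : γ ∈ Ioo 0 1) (m : ℝ) {p : ℝ} (hp : 0 < p) :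
    ∫ z in Ioi (0 : ℝ), z ^ (p - 1) * wright (-γ) m (-z) =
      Real.Gamma p / Real.Gamma (m + γ * p) := by
  obtain ⟨θ, hθ, hγθ⟩ := exists_angle hγ
  have hθ' := angle_mem hθ
  have hs := Real.sin_pos_of_pos_of_lt_pi hθ'.1 hθ'.2
  have hπ := Real.pi_pos
  have hcos : 0 < Real.cos (γ * θ) :=
    Real.cos_pos_of_mem_Ioo ⟨by linarith [mul_pos hγ.1 hθ'.1], hγθ⟩
  set c := (1 * Real.sin θ) ^ γ * Real.cos (γ * θ) with hc
  have hc0 : 0 < c := by positivity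
  have hre : ∀ r : ℝ, 0 < r → c ≤ (ray θ 1 r ^ (γ : ℂ)).re := fun r hr =>
    le_cpow_ray_re hθ' hγ.1.le hγθ one_pos hr.le
  set f : ℝ × ℝ → ℂ := fun q => ((q.1 ^ (p - 1) : ℝ) : ℂ) * (hankelFun m (ray θ 1 q.2) *
    Complex.exp (-q.1 * ray θ 1 q.2 ^ (γ : ℂ)) * Complex.exp (θ * Complex.I)) with hf
  have hfi : Integrable f ((volume.restrict (Ioi 0)).prod (volume.restrict (Ioi 0))) := by
    have h1 := (integrableOn_exp_neg_smul_rpow hp hc0).norm.mul_prod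
      (integrableOn_hankelFun_ray m hθ one_pos).norm
    refine h1.mono' ((Complex.measurable_ofReal.comp (measurable_fst.pow_const _)).mul
      (measurable_wrightRay_integrand γ m θ 1)).aestronglyMeasurable ?_
    rw [Measure.prod_restrict]
    refine (ae_restrict_iff' (measurableSet_Ioi.prod measurableSet_Ioi)).2
      (ae_of_all _ fun q ⟨(hq1 : 0 < q.1), (hq2 : 0 < q.2)⟩ => ?_)
    rw [hf, norm_mul, norm_mul, norm_mul, norm_exp_angle, mul_one, norm_smul, mul_comm ‖hankelFun _ _‖,
      ← mul_assoc, mul_comm ‖((q.1 ^ (p - 1) : ℝ) : ℂ)‖]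
    refine mul_le_mul_of_nonneg_right (mul_le_mul_of_nonneg_right ?_ (norm_nonneg _)) (norm_nonneg _)
    rw [Complex.norm_exp, Real.norm_of_nonneg (Real.exp_pos _).le, Real.exp_le_exp,
      ← Complex.ofReal_neg, Complex.re_ofReal_mul]
    nlinarith [hre q.2 hq2]
  have h1 : ∫ z in Ioi (0 : ℝ), z ^ (p - 1) * wright (-γ) m (-z) =
      (∫ z in Ioi (0 : ℝ), ∫ r in Ioi (0 : ℝ), f (z, r)).im / Real.pi := by
    rw [← Complex.imCLM_apply, ← Complex.imCLM.integral_comp_comm hfi.integral_prod_left,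
      ← integral_div]
    refine integral_congr_ae (ae_of_all _ fun z => ?_)
    simp only [hf, integral_const_mul, Complex.imCLM_apply, Complex.im_ofReal_mul]
    rw [wright_eq_ray m z hγ hθ one_pos, mul_div_assoc, wrightRay]
  -- With the order exchanged, the `z`-integral is Euler's integral at `s = σ^γ`. It contributes
  -- `Γ(p) σ^(-γp)` and leaves Hankel's integral with exponent `m + γp`.
  have h2 : ∫ r in Ioi (0 : ℝ), ∫ z in Ioi (0 : ℝ), f (z, r) =
      Real.Gamma p * hankelRay (m + γ * p) θ 1 := by
    rw [hankelRay, ← integral_const_mul]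
    refine setIntegral_congr_fun measurableSet_Ioi fun r (hr : 0 < r) => ?_
    have h0 := ray_ne_zero hθ' one_pos hr.le
    have h3 := integral_cexp_neg_mul_rpow hp (hc0.trans_le (hre r hr))
    -- Composing the powers is legitimate because `γ arg σ` stays in the principal range.
    have h4 : (ray θ 1 r ^ (γ : ℂ)) ^ (-p : ℂ) = ray θ 1 r ^ (-(γ * p) : ℂ) := by
      have harg := arg_ray_mem hθ' one_pos hr.le
      have him : (Complex.log (ray θ 1 r) * γ).im = γ * (ray θ 1 r).arg := by
        rw [Complex.im_mul_ofReal, Complex.log_im, mul_comm]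
      have h6 : 0 ≤ γ * (ray θ 1 r).arg := mul_nonneg hγ.1.le harg.1
      have h7 : γ * (ray θ 1 r).arg ≤ γ * θ := mul_le_mul_of_nonneg_left harg.2 hγ.1.le
      rw [← Complex.cpow_mul _ (by rw [him]; linarith) (by rw [him]; linarith), mul_neg]
    rw [h4] at h3
    have h5 : hankelFun (m + γ * p) (ray θ 1 r) =
        hankelFun m (ray θ 1 r) * ray θ 1 r ^ (-(γ * p) : ℂ) := by
      rw [hankelFun, hankelFun, mul_assoc, ← Complex.cpow_add _ _ h0]
      congr 2
      push_cast
      ring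
    calc ∫ z in Ioi (0 : ℝ), f (z, r) = ∫ z in Ioi (0 : ℝ), (hankelFun m (ray θ 1 r) *
          Complex.exp (θ * Complex.I)) * (Complex.exp (-(ray θ 1 r ^ (γ : ℂ)) * z) *
            ((z ^ (p - 1) : ℝ) : ℂ)) := by
          refine integral_congr_ae (ae_of_all _ fun z => ?_)
          simp only [hf]
          rw [show -(ray θ 1 r ^ (γ : ℂ)) * z = -z * ray θ 1 r ^ (γ : ℂ) by ring]
          ring
      _ = _ := by
          rw [integral_const_mul, h3, h5]
          ring
  rw [h1, integral_integral_swap hfi, h2, Complex.im_ofReal_mul, hankelRay_im _ hθ one_pos]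
  field_simp

/-! ### Mittag-Leffler functions -/

lemma mlGamma_pos {b m : ℝ} (hb : 0 ≤ b) (hm : 0 < m) (n : ℕ) : 0 < Real.Gamma (b * n + m) :=
  Real.Gamma_pos_of_pos (by positivity)

/-- Once `(b - 1) n ≥ 1`, `Γ(bn + m) ≥ Γ(n + 1) = n!`, so the exponential series dominates. -/
lemma summable_mittagLeffler {b m : ℝ} (hb : 1 < b) (hm : 0 < m) (x : ℝ) :
    Summable fun n : ℕ => x ^ n / Real.Gamma (b * n + m) := by
  refine Summable.of_norm_bounded_eventually_nat (Real.summable_pow_div_factorial |x|) ?_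
  have h : Tendsto (fun n : ℕ => (b - 1) * (n : ℝ)) atTop atTop :=
    tendsto_natCast_atTop_atTop.const_mul_atTop (by linarith)
  filter_upwards [h.eventually_ge_atTop 1, eventually_ge_atTop 1] with n hn hn1
  have hn1' : (1 : ℝ) ≤ n := by exact_mod_cast hn1
  rw [norm_div, norm_pow, Real.norm_eq_abs, Real.norm_of_nonneg (mlGamma_pos (by linarith) hm n).le]
  refine div_le_div_of_nonneg_left (by positivity) (by positivity) ?_
  rw [← Real.Gamma_nat_eq_factorial]
  exact Real.Gamma_strictMonoOn_Ici.monotoneOn (by simp; linarith) (by simp; nlinarith) (by nlinarith)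

lemma continuous_mittagLeffler {b m : ℝ} (hb : 1 < b) (hm : 0 < m) :
    Continuous (mittagLeffler b m) := by
  rw [continuous_iff_continuousAt]
  intro x
  have h : ContinuousOn (mittagLeffler b m) (Metric.ball 0 (|x| + 1)) := by
    refine continuousOn_tsum (fun n => by fun_prop) (summable_mittagLeffler hb hm (|x| + 1)) ?_
    intro n y hy
    rw [norm_div, norm_pow, Real.norm_of_nonneg (mlGamma_pos (by linarith) hm n).le]
    have hy' : ‖y‖ ≤ |x| + 1 := (mem_ball_zero_iff.1 hy).le
    exact div_le_div_of_nonneg_right (pow_le_pow_left₀ (norm_nonneg _) hy' n)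
      (mlGamma_pos (by linarith) hm n).le
  exact h.continuousAt (Metric.isOpen_ball.mem_nhds (by simp))

lemma mittagLeffler_shift {b m : ℝ} (hb : 1 < b) (hm : 0 < m) (x : ℝ) :
    mittagLeffler b m x = 1 / Real.Gamma m + x * mittagLeffler b (m + b) x := by
  rw [mittagLeffler, (summable_mittagLeffler hb hm x).tsum_eq_zero_add, mittagLeffler,
    ← tsum_mul_left]
  congr 1
  · simp
  · refine tsum_congr fun n => ?_
    rw [pow_succ', mul_div_assoc, show b * ((n + 1 : ℕ) : ℝ) + m = b * n + (m + b) by push_cast; ring]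

lemma mittagLeffler_zero_right (b m : ℝ) : mittagLeffler b m 0 = 1 / Real.Gamma m := by
  rw [mittagLeffler, tsum_eq_single 0]
  · simp
  · intro n hn; simp [hn]

/-- The function `t^(m-1) E_{b,m}(-l t^b)`. -/
noncomputable def mlKernel (b l m t : ℝ) : ℝ := t ^ (m - 1) * mittagLeffler b m (-l * t ^ b)

lemma hasSum_mlKernel {b m : ℝ} (hb : 1 < b) (hm : 0 < m) (l : ℝ) {t : ℝ} (ht : 0 < t) :
    HasSum (fun n : ℕ => (-l) ^ n * t ^ (b * n + m - 1) / Real.Gamma (b * n + m))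
      (mlKernel b l m t) := by
  refine ((summable_mittagLeffler hb hm (-l * t ^ b)).hasSum.mul_left (t ^ (m - 1))).congr_fun
    fun n => ?_
  rw [mul_pow, ← Real.rpow_natCast (t ^ b), ← Real.rpow_mul ht.le,
    show b * n + m - 1 = b * n + (m - 1) by ring, Real.rpow_add ht]
  ring

lemma mlKernel_shift {b m : ℝ} (hb : 1 < b) (hm : 0 < m) (l : ℝ) {t : ℝ} (ht : 0 < t) :
    mlKernel b l m t = t ^ (m - 1) / Real.Gamma m - l * mlKernel b l (m + b) t := by
  rw [mlKernel, mlKernel, mittagLeffler_shift hb hm, show m + b - 1 = (m - 1) + b by ring,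
    Real.rpow_add ht]
  ring

lemma continuous_mlKernel {b m : ℝ} (hb : 1 < b) (hm : 1 ≤ m) (l : ℝ) :
    Continuous (mlKernel b l m) := by
  have h := continuous_mittagLeffler hb (by linarith : 0 < m)
  have h1 : Continuous fun t : ℝ => t ^ (m - 1) := Real.continuous_rpow_const (by linarith)
  have h2 : Continuous fun t : ℝ => t ^ b := Real.continuous_rpow_const (by linarith)
  exact h1.mul (h.comp (continuous_const.mul h2))

lemma continuousOn_mlKernel {b m : ℝ} (hb : 1 < b) (hm : 0 < m) (l : ℝ) :
    ContinuousOn (mlKernel b l m) (Ioi 0) := by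
  have h2 : Continuous fun t : ℝ => t ^ b := Real.continuous_rpow_const (by linarith)
  exact (ContinuousOn.rpow_const continuousOn_id fun x hx => Or.inl (ne_of_gt hx)).mul
    ((continuous_mittagLeffler hb hm).comp (continuous_const.mul h2)).continuousOn

lemma intervalIntegrable_mlKernel {b m : ℝ} (hb : 1 < b) (hm : 0 < m) (l t : ℝ) :
    IntervalIntegrable (mlKernel b l m) volume 0 t := by
  have h2 : Continuous fun t : ℝ => t ^ b := Real.continuous_rpow_const (by linarith)
  exact (intervalIntegral.intervalIntegrable_rpow' (by linarith)).mul_continuousOn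
    ((continuous_mittagLeffler hb hm).comp (continuous_const.mul h2)).continuousOn

lemma integral_beta {p q t : ℝ} (hp : 0 < p) (hq : 0 < q) (ht : 0 < t) :
    ∫ s in (0 : ℝ)..t, (t - s) ^ (q - 1) * s ^ (p - 1) =
      t ^ (p + q - 1) * (Real.Gamma p * Real.Gamma q / Real.Gamma (p + q)) := by
  have h := Complex.betaIntegral_scaled p q ht
  have h2 := Complex.Gamma_mul_Gamma_eq_betaIntegral (s := p) (t := q) (by simpa) (by simpa)
  have h3 : Complex.betaIntegral p q =
      ((Real.Gamma p * Real.Gamma q / Real.Gamma (p + q) : ℝ) : ℂ) := by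
    rw [← Complex.ofReal_add, Complex.Gamma_ofReal, Complex.Gamma_ofReal, Complex.Gamma_ofReal] at h2
    have h4 : ((Real.Gamma (p + q) : ℝ) : ℂ) ≠ 0 :=
      Complex.ofReal_ne_zero.2 (Real.Gamma_pos_of_pos (by linarith)).ne'
    push_cast
    rw [eq_div_iff h4, h2, mul_comm]
  rw [h3] at h
  have h5 : ((∫ s in (0 : ℝ)..t, (t - s) ^ (q - 1) * s ^ (p - 1) : ℝ) : ℂ) =
      ∫ x in (0 : ℝ)..t, (x : ℂ) ^ ((p : ℂ) - 1) * ((t : ℂ) - x) ^ ((q : ℂ) - 1) := by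
    rw [← intervalIntegral.integral_ofReal]
    refine intervalIntegral.integral_congr fun s hs => ?_
    rw [uIcc_of_le ht.le] at hs
    rw [Complex.ofReal_mul, Complex.ofReal_cpow hs.1, Complex.ofReal_cpow (sub_nonneg.2 hs.2), mul_comm]
    push_cast
    rfl
  rw [h] at h5
  rw [← Complex.ofReal_inj, h5, Complex.ofReal_mul, Complex.ofReal_cpow ht.le]
  push_cast
  rfl

/-- A non-integrable function would have integral `0` by convention, whereas the value in
`integral_beta` is positive. -/
lemma intervalIntegrable_beta {p q t : ℝ} (hp : 0 < p) (hq : 0 < q) (ht : 0 < t) :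
    IntervalIntegrable (fun s => (t - s) ^ (q - 1) * s ^ (p - 1)) volume 0 t := by
  by_contra h
  have h1 := integral_beta hp hq ht
  rw [intervalIntegral.integral_undef h] at h1
  have := Real.Gamma_pos_of_pos hp
  have := Real.Gamma_pos_of_pos hq
  have := Real.Gamma_pos_of_pos (add_pos hp hq)
  have : 0 < t ^ (p + q - 1) * (Real.Gamma p * Real.Gamma q / Real.Gamma (p + q)) := by positivity
  linarith

/-- Fractional integrals raise the second parameter. -/
theorem fracIntegral_mlKernel {b m ν : ℝ} (hb : 1 < b) (hm : 0 < m) (hν : 0 < ν) (l : ℝ) {t : ℝ}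
    (ht : 0 < t) : ∫ s in (0 : ℝ)..t, (t - s) ^ (ν - 1) / Real.Gamma ν * mlKernel b l m s =
      mlKernel b l (m + ν) t := by
  have hΓ := Real.Gamma_pos_of_pos hν
  have hb0 : 0 ≤ b := by linarith
  have hpos : ∀ n : ℕ, 0 < b * n + m := fun n => by positivity
  set F : ℕ → ℝ → ℝ := fun n s => (-l) ^ n / (Real.Gamma ν * Real.Gamma (b * n + m)) *
    ((t - s) ^ (ν - 1) * s ^ (b * n + m - 1)) with hF
  have hint : ∀ n : ℕ, ∫ s in Ioc 0 t, (t - s) ^ (ν - 1) * s ^ (b * n + m - 1) =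
      t ^ (b * n + m + ν - 1) * (Real.Gamma (b * n + m) * Real.Gamma ν /
        Real.Gamma (b * n + m + ν)) := fun n => by
    rw [← intervalIntegral.integral_of_le ht.le, integral_beta (hpos n) hν ht]
  have hFi : ∀ n, Integrable (F n) (volume.restrict (Ioc 0 t)) := fun n =>
    ((intervalIntegrable_iff_integrableOn_Ioc_of_le ht.le).1
      (intervalIntegrable_beta (hpos n) hν ht)).const_mul _
  have hFn : ∀ n, ∫ s in Ioc 0 t, F n s =
      (-l) ^ n * t ^ (b * n + (m + ν) - 1) / Real.Gamma (b * n + (m + ν)) := fun n => by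
    rw [hF, integral_const_mul, hint, ← add_assoc]
    have := (mlGamma_pos hb0 hm n).ne'
    have := hΓ.ne'
    field_simp
  have hFnn : ∀ n, ∫ s in Ioc 0 t, ‖F n s‖ =
      |(-l)| ^ n * t ^ (b * n + (m + ν) - 1) / Real.Gamma (b * n + (m + ν)) := fun n => by
    have : ∫ s in Ioc 0 t, ‖F n s‖ = ∫ s in Ioc 0 t, |(-l)| ^ n / (Real.Gamma ν *
        Real.Gamma (b * n + m)) * ((t - s) ^ (ν - 1) * s ^ (b * n + m - 1)) := by
      refine setIntegral_congr_fun measurableSet_Ioc fun s hs => ?_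
      simp only [hF, norm_mul, norm_div, norm_pow, Real.norm_eq_abs]
      rw [abs_of_pos hΓ, abs_of_pos (mlGamma_pos hb0 hm n),
        abs_of_nonneg (Real.rpow_nonneg (sub_nonneg.2 hs.2) _),
        abs_of_nonneg (Real.rpow_nonneg hs.1.le _)]
    rw [this, integral_const_mul, hint, ← add_assoc]
    have := (mlGamma_pos hb0 hm n).ne'
    have := hΓ.ne'
    field_simp
  -- The absolute integrals form the same kernel series with `-l` replaced by `|l|`.
  have hs : Summable fun n => ∫ s in Ioc 0 t, ‖F n s‖ := by
    simp_rw [hFnn]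
    have := (hasSum_mlKernel hb (by linarith : 0 < m + ν) (-|(-l)|) ht).summable
    simpa using this
  have h := hasSum_integral_of_summable_integral_norm hFi hs
  simp_rw [hFn] at h
  rw [(hasSum_mlKernel hb (by linarith : 0 < m + ν) l ht).unique h,
    intervalIntegral.integral_of_le ht.le]
  refine setIntegral_congr_fun measurableSet_Ioc fun s hs => ?_
  rw [← (hasSum_mlKernel hb hm l hs.1).tsum_eq, ← tsum_mul_left]
  refine tsum_congr fun n => ?_
  simp only [hF]
  field_simp

lemma integral_mlKernel {b m : ℝ} (hb : 1 < b) (hm : 0 < m) (l : ℝ) {t : ℝ}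
    (ht : 0 < t) : ∫ s in (0 : ℝ)..t, mlKernel b l m s = mlKernel b l (m + 1) t := by
  rw [← fracIntegral_mlKernel hb hm one_pos l ht]
  simp

lemma hasDerivAt_mlKernel {b m : ℝ} (hb : 1 < b) (hm : 0 < m) (l : ℝ) {t : ℝ}
    (ht : 0 < t) : HasDerivAt (mlKernel b l (m + 1)) (mlKernel b l m t) t := by
  have h := intervalIntegral.integral_hasDerivAt_right (intervalIntegrable_mlKernel hb hm l t)
    ((continuousOn_mlKernel hb hm l).stronglyMeasurableAtFilter isOpen_Ioi t ht)
    ((continuousOn_mlKernel hb hm l).continuousAt (Ioi_mem_nhds ht))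
  refine h.congr_of_eventuallyEq ?_
  filter_upwards [Ioi_mem_nhds ht] with s hs using (integral_mlKernel hb hm l hs).symm

/-! ### The ordinary fractional differential equation -/

lemma ceil_order {b : ℝ} (hb : b ∈ Ioc 1 2) : ⌈b⌉₊ = 2 := by
  rw [Nat.ceil_eq_iff two_ne_zero]
  norm_num
  exact hb

lemma caputo_eq {b : ℝ} (hb : b ∈ Ioc 1 2) (f : ℝ → ℂ) (t : ℝ) :
    caputo b f t = if b = 2 then iteratedDeriv 2 f t
      else fracIntegral (2 - b) (iteratedDeriv 2 f) t := by
  simp only [caputo, ceil_order hb, Nat.cast_ofNat, eq_comm (a := (2 : ℝ))]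

/-- A primitive on `[0, ∞)` of a continuous function that is `C¹` on `(0, ∞)`, with integrable
derivative, is regular. -/
lemma timeRegular_of_primitive {f g h : ℝ → ℂ} {c : ℂ}
    (hf : ∀ t, 0 ≤ t → f t = c + ∫ s in (0 : ℝ)..t, g s) (hg : Continuous g)
    (hgh : ∀ t, 0 < t → HasDerivAt g (h t) t) (hh : ContinuousOn h (Ioi 0))
    (hhi : ∀ T, IntegrableOn h (Ioc 0 T)) :
    TimeRegular f ∧ derivWithin f (Ici 0) 0 = g 0 ∧ ∀ t, 0 < t → iteratedDeriv 2 f t = h t := by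
  set F : ℝ → ℂ := fun t => c + ∫ s in (0 : ℝ)..t, g s with hF
  have hFd : ∀ t, HasDerivAt F (g t) t := fun t =>
    (intervalIntegral.integral_hasDerivAt_right (hg.intervalIntegrable _ _)
      (hg.stronglyMeasurableAtFilter _ _) hg.continuousAt).const_add c
  have hFderiv : deriv F = g := funext fun t => (hFd t).deriv
  have hF1 : ContDiff ℝ 1 F :=
    contDiff_one_iff_deriv.2 ⟨fun t => (hFd t).differentiableAt, hFderiv ▸ hg⟩
  have hfF : EqOn f F (Ici 0) := fun t ht => hf t ht
  have hderiv : ∀ t, 0 < t → deriv f t = g t := fun t ht => by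
    have : f =ᶠ[𝓝 t] F := by filter_upwards [Ioi_mem_nhds ht] with s hs using hfF (mem_Ici.2 (le_of_lt hs))
    rw [this.deriv_eq, hFderiv]
  have h2 : ∀ t, 0 < t → iteratedDeriv 2 f t = h t := fun t ht => by
    rw [iteratedDeriv_succ, iteratedDeriv_one]
    have : deriv f =ᶠ[𝓝 t] g := by filter_upwards [Ioi_mem_nhds ht] with s hs using hderiv s hs
    rw [this.deriv_eq, (hgh t ht).deriv]
  have hg1 : ContDiffOn ℝ 1 g (Ioi 0) := by
    rw [show (1 : WithTop ℕ∞) = 0 + 1 from (zero_add 1).symm,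
      contDiffOn_succ_iff_deriv_of_isOpen isOpen_Ioi]
    refine ⟨fun t ht => (hgh t ht).differentiableAt.differentiableWithinAt, by simp, ?_⟩
    rw [contDiffOn_zero]
    exact hh.congr fun t ht => (hgh t ht).deriv
  refine ⟨⟨hF1.contDiffOn.congr hfF, ?_, fun T => ?_⟩, ?_, h2⟩
  · rw [show (2 : WithTop ℕ∞) = 1 + 1 from one_add_one_eq_two.symm,
      contDiffOn_succ_iff_deriv_of_isOpen isOpen_Ioi]
    refine ⟨fun t ht => ?_, by simp, hg1.congr fun t ht => hderiv t ht⟩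
    exact ((hFd t).congr_of_eventuallyEq (by
      filter_upwards [Ioi_mem_nhds ht] with s hs using
        hfF (mem_Ici.2 (le_of_lt hs)))).differentiableAt.differentiableWithinAt
  · exact (hhi T).congr_fun (fun t ht => (h2 t ht.1).symm) measurableSet_Ioc
  · rw [derivWithin_congr hfF (hfF self_mem_Ici)]
    exact (hFd 0).hasDerivWithinAt.derivWithin (uniqueDiffOn_Ici 0 0 self_mem_Ici)

/-- `f` solves the Cauchy problem for `D^b f = -l f`. -/
structure IsOdeSolution (b l : ℝ) (c₀ c₁ : ℂ) (f : ℝ → ℂ) : Prop where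
  regular : TimeRegular f
  init : f 0 = c₀
  deriv_init : derivWithin f (Ici 0) 0 = c₁
  eqn : ∀ t, 0 < t → caputo b f t = -l * f t

lemma ofReal_integral_mlKernel {b m : ℝ} (hb : 1 < b) (hm : 0 < m) (l : ℝ) {t : ℝ}
    (ht : 0 < t) : ∫ s in (0 : ℝ)..t, (mlKernel b l m s : ℂ) = mlKernel b l (m + 1) t := by
  rw [intervalIntegral.integral_ofReal, integral_mlKernel hb hm l ht]

lemma fracIntegral_neg_mul_mlKernel {b m ν : ℝ} (hb : 1 < b) (hm : 0 < m) (hν : 0 < ν) (l : ℝ)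
    {t : ℝ} (ht : 0 < t) {f : ℝ → ℂ} (hf : ∀ s, 0 < s → f s = -l * mlKernel b l m s) :
    fracIntegral ν f t = -l * mlKernel b l (m + ν) t := by
  rw [← fracIntegral_mlKernel hb hm hν l ht, fracIntegral, ← intervalIntegral.integral_ofReal,
    ← intervalIntegral.integral_const_mul, intervalIntegral.integral_of_le ht.le,
    intervalIntegral.integral_of_le ht.le]
  refine setIntegral_congr_fun measurableSet_Ioc fun s hs => ?_
  simp only [hf s hs.1]
  push_cast
  ring

lemma integrableOn_mlKernel {b m : ℝ} (hb : 1 < b) (hm : 0 < m) (l T : ℝ) :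
    IntegrableOn (fun t => -(l : ℂ) * mlKernel b l m t) (Ioc 0 T) :=
  ((intervalIntegrable_mlKernel hb hm l T).1.ofReal).const_mul _

lemma continuousOn_neg_mul_mlKernel {b m : ℝ} (hb : 1 < b) (hm : 0 < m) (l : ℝ) :
    ContinuousOn (fun t => -(l : ℂ) * mlKernel b l m t) (Ioi 0) :=
  continuousOn_const.mul (Complex.continuous_ofReal.comp_continuousOn (continuousOn_mlKernel hb hm l))

lemma mlKernel_one {b l t : ℝ} : mlKernel b l 1 t = mittagLeffler b 1 (-l * t ^ b) := by
  simp [mlKernel]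

lemma mlKernel_two {b l t : ℝ} : mlKernel b l 2 t = t * mittagLeffler b 2 (-l * t ^ b) := by
  norm_num [mlKernel]

/-- Write `K_m` for `mlKernel b l m`. For `f = K_1` one has `f' = -l K_b` and `f'' = -l K_{b-1}`,
integrable at `0` because `b > 1`; then `I^(2-b)` raises the index `b - 1` to `1`. -/
lemma isOdeSolution_first {b : ℝ} (hb : b ∈ Ioc 1 2) (l : ℝ) :
    IsOdeSolution b l 1 0 (fun t => (mlKernel b l 1 t : ℂ)) := by
  have hb1 := hb.1
  have hb0 : 0 < b := by linarith
  have hb0' : 0 < b - 1 := by linarith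
  have h0 : mlKernel b l 1 0 = 1 := by
    rw [mlKernel_one, Real.zero_rpow hb0.ne', mul_zero, mittagLeffler_zero_right]; simp
  have hf : ∀ t, 0 ≤ t → (mlKernel b l 1 t : ℂ) =
      1 + ∫ s in (0 : ℝ)..t, -(l : ℂ) * mlKernel b l b s := fun t ht => by
    rcases ht.eq_or_lt with rfl | ht
    · simp [h0]
    · rw [intervalIntegral.integral_const_mul, ofReal_integral_mlKernel hb1 hb0 l ht,
        mlKernel_shift hb1 one_pos l ht, add_comm b]
      push_cast
      simp
      ring
  have hd : ∀ t, 0 < t → HasDerivAt (fun t => -(l : ℂ) * mlKernel b l b t)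
      (-(l : ℂ) * mlKernel b l (b - 1) t) t := fun t ht => by
    have := hasDerivAt_mlKernel hb1 hb0' l ht
    rw [sub_add_cancel] at this
    exact this.ofReal_comp.const_mul _
  obtain ⟨h1, h2, h3⟩ := timeRegular_of_primitive hf
    (continuous_const.mul (Complex.continuous_ofReal.comp (continuous_mlKernel hb1 hb1.le l)))
    hd (continuousOn_neg_mul_mlKernel hb1 hb0' l) (integrableOn_mlKernel hb1 hb0' l)
  refine ⟨h1, by simp [h0], ?_, fun t ht => ?_⟩
  · rw [h2, mlKernel, Real.zero_rpow hb0'.ne']; simp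
  · rw [caputo_eq hb]
    split_ifs with h
    · rw [h3 t ht, h]; norm_num
    · have : 0 < 2 - b := sub_pos.2 (lt_of_le_of_ne hb.2 h)
      rw [fracIntegral_neg_mul_mlKernel hb1 hb0' this l ht h3, show b - 1 + (2 - b) = 1 by ring]

/-- With `K_m` for `mlKernel b l m`, `f = K_2` has `f' = K_1` and `f'' = -l K_b`, and `I^(2-b)`
raises the index `b` to `2`. -/
lemma isOdeSolution_second {b : ℝ} (hb : b ∈ Ioc 1 2) (l : ℝ) :
    IsOdeSolution b l 0 1 (fun t => (mlKernel b l 2 t : ℂ)) := by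
  have hb1 := hb.1
  have hb0 : 0 < b := by linarith
  have hf : ∀ t, 0 ≤ t → (mlKernel b l 2 t : ℂ) =
      0 + ∫ s in (0 : ℝ)..t, (mlKernel b l 1 s : ℂ) := fun t ht => by
    rcases ht.eq_or_lt with rfl | ht
    · simp [mlKernel_two]
    · rw [ofReal_integral_mlKernel hb1 one_pos l ht, zero_add, one_add_one_eq_two]
  have hd : ∀ t, 0 < t → HasDerivAt (fun t => (mlKernel b l 1 t : ℂ))
      (-(l : ℂ) * mlKernel b l b t) t := fun t ht => by
    have h := (hasDerivAt_mlKernel hb1 hb0 l ht).ofReal_comp.const_mul (-(l : ℂ)) |>.const_add 1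
    refine h.congr_of_eventuallyEq ?_
    filter_upwards [Ioi_mem_nhds ht] with s hs
    rw [mlKernel_shift hb1 one_pos l hs, add_comm b]
    push_cast
    simp
    ring
  obtain ⟨h1, h2, h3⟩ := timeRegular_of_primitive hf
    (Complex.continuous_ofReal.comp (continuous_mlKernel hb1 le_rfl l))
    hd (continuousOn_neg_mul_mlKernel hb1 hb0 l) (integrableOn_mlKernel hb1 hb0 l)
  refine ⟨h1, by simp [mlKernel_two], ?_, fun t ht => ?_⟩
  · rw [h2, mlKernel_one, Real.zero_rpow hb0.ne', mul_zero, mittagLeffler_zero_right]; simp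
  · rw [caputo_eq hb]
    split_ifs with h
    · rw [h3 t ht, h]
    · have : 0 < 2 - b := sub_pos.2 (lt_of_le_of_ne hb.2 h)
      rw [fracIntegral_neg_mul_mlKernel hb1 hb0 this l ht h3, show b + (2 - b) = 2 by ring]

/-! ### Uniqueness through a Volterra equation -/

/-- Taylor's formula with integrable second derivative. -/
lemma TimeRegular.taylor {f : ℝ → ℂ} (hf : TimeRegular f) {t : ℝ} (ht : 0 < t) :
    ∫ s in (0 : ℝ)..t, ((t - s : ℝ) : ℂ) * iteratedDeriv 2 f s =
      f t - (f 0 + t * derivWithin f (Ici 0) 0) := by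
  have h1 := (contDiffOn_succ_iff_derivWithin (n := 0) (uniqueDiffOn_Ici (0 : ℝ))).1
    (by simpa using hf.contDiffOn_one)
  have hcont : ContinuousOn (derivWithin f (Ici 0)) (Ici 0) := h1.2.2.continuousOn
  have hdw : ∀ s ∈ Ioi (0 : ℝ), derivWithin f (Ici 0) s = deriv f s := fun s hs =>
    derivWithin_of_mem_nhds (Ici_mem_nhds hs)
  have h2 := (contDiffOn_succ_iff_deriv_of_isOpen (n := 1) isOpen_Ioi).1
    (by simpa [one_add_one_eq_two] using hf.contDiffOn_two)
  have hd2 : ∀ s ∈ Ioi (0 : ℝ), HasDerivAt (derivWithin f (Ici 0)) (iteratedDeriv 2 f s) s := by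
    intro s hs
    have h3 : HasDerivAt (deriv f) (iteratedDeriv 2 f s) s := by
      rw [iteratedDeriv_succ, iteratedDeriv_one]
      exact ((h2.2.2.differentiableOn one_ne_zero).differentiableAt (Ioi_mem_nhds hs)).hasDerivAt
    refine h3.congr_of_eventuallyEq ?_
    filter_upwards [Ioi_mem_nhds hs] with r hr using hdw r hr
  have hd1 : ∀ s ∈ Ioi (0 : ℝ), HasDerivAt f (derivWithin f (Ici 0) s) s := by
    intro s hs
    rw [hdw s hs]
    exact (h2.1.differentiableAt (Ioi_mem_nhds hs)).hasDerivAt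
  have hcs : Continuous fun s : ℝ => ((t - s : ℝ) : ℂ) := by fun_prop
  have h := intervalIntegral.integral_eq_sub_of_hasDerivAt_of_le ht.le
    (f := fun s => f s + ((t - s : ℝ) : ℂ) * derivWithin f (Ici 0) s)
    (f' := fun s => ((t - s : ℝ) : ℂ) * iteratedDeriv 2 f s)
    ((hf.contDiffOn_one.continuousOn.add (hcs.continuousOn.mul hcont)).mono Icc_subset_Ici_self)
    (fun s hs => by
      have h4 : HasDerivAt (fun s : ℝ => ((t - s : ℝ) : ℂ)) (((-1 : ℝ)) : ℂ) s :=
        ((hasDerivAt_id s).const_sub t).ofReal_comp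
      refine ((hd1 s hs.1).add (h4.mul (hd2 s hs.1))).congr_deriv ?_
      push_cast
      ring) ?_
  · rw [h]; simp
  · exact ((intervalIntegrable_iff_integrableOn_Ioc_of_le ht.le).2 (hf.integrableOn t)).continuousOn_mul
      hcs.continuousOn

/-- The semigroup property `I^b I^(2-b) = I²`. -/
lemma fracIntegral_fracIntegral {b : ℝ} (hb : 0 < b) (hb2 : b < 2) {h : ℝ → ℂ} {t : ℝ} (ht : 0 < t)
    (hh : IntegrableOn h (Ioc 0 t)) :
    fracIntegral b (fracIntegral (2 - b) h) t = ∫ s in (0 : ℝ)..t, ((t - s : ℝ) : ℂ) * h s := by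
  have hν : 0 < 2 - b := by linarith
  have hΓb := Real.Gamma_pos_of_pos hb
  have hΓν := Real.Gamma_pos_of_pos hν
  -- The product of the two kernels, cut off to `r < s`, so that Fubini's theorem applies on a
  -- square. Its integral in `s` is a Beta integral equal to `(t - r) / Γ(2)`.
  set k : ℝ → ℝ → ℝ := fun s r => if r < s then (t - s) ^ (b - 1) / Real.Gamma b *
    ((s - r) ^ (2 - b - 1) / Real.Gamma (2 - b)) else 0 with hk
  have hkey : ∀ r ∈ Ioc 0 t, IntegrableOn (fun s => k s r) (Ioc 0 t) ∧
      ∫ s in Ioc 0 t, k s r = t - r := by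
    intro r hr
    have hind : ∀ s, k s r = (Ioi r).indicator (fun s => (t - s) ^ (b - 1) / Real.Gamma b *
        ((s - r) ^ (2 - b - 1) / Real.Gamma (2 - b))) s := fun s => by
      simp only [hk, indicator, mem_Ioi]
    have hset : Ioc 0 t ∩ Ioi r = Ioc r t := by
      ext s; simp only [mem_inter_iff, mem_Ioc, mem_Ioi]
      exact ⟨fun h => ⟨h.2, h.1.2⟩, fun h => ⟨⟨hr.1.trans h.1, h.2⟩, h.1⟩⟩
    simp_rw [hind]
    rw [integrableOn_indicator_iff measurableSet_Ioi, setIntegral_indicator measurableSet_Ioi,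
      inter_comm (Ioi r), hset]
    rcases hr.2.eq_or_lt with rfl | hrt
    · simp
    have htr : 0 < t - r := sub_pos.2 hrt
    have hi := (intervalIntegrable_beta hν hb htr).comp_sub_right r
    have hv := integral_beta hν hb htr
    rw [← intervalIntegrable_iff_integrableOn_Ioc_of_le hrt.le,
      ← intervalIntegral.integral_of_le hrt.le]
    have hc : (fun s => (t - s) ^ (b - 1) / Real.Gamma b *
        ((s - r) ^ (2 - b - 1) / Real.Gamma (2 - b))) = fun s =>
        (1 / (Real.Gamma b * Real.Gamma (2 - b))) *
          ((t - r - (s - r)) ^ (b - 1) * (s - r) ^ (2 - b - 1)) := by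
      funext s
      rw [sub_sub_sub_cancel_right]
      field_simp
    rw [hc]
    constructor
    · simpa using hi.const_mul (1 / (Real.Gamma b * Real.Gamma (2 - b)))
    · rw [intervalIntegral.integral_const_mul, intervalIntegral.integral_comp_sub_right
        (fun s => (t - r - s) ^ (b - 1) * s ^ (2 - b - 1)) r, sub_self, hv,
        show 2 - b + b = 2 by ring, Real.Gamma_two]
      norm_num
      field_simp
  have hkm : Measurable (Function.uncurry k) := by
    refine Measurable.ite (measurableSet_lt measurable_snd measurable_fst) ?_ measurable_const
    exact (((measurable_const.sub measurable_fst).pow_const _).div_const _).mul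
      (((measurable_fst.sub measurable_snd).pow_const _).div_const _)
  have hknn : ∀ s ∈ Ioc 0 t, ∀ r, 0 ≤ k s r := fun s hs r => by
    simp only [hk]
    split_ifs with hrs
    · have := sub_nonneg.2 hs.2
      have := (sub_pos.2 hrs).le
      positivity
    · exact le_rfl
  have hint : Integrable (fun p : ℝ × ℝ => (k p.1 p.2 : ℂ) * h p.2)
      ((volume.restrict (Ioc 0 t)).prod (volume.restrict (Ioc 0 t))) := by
    have hm : AEStronglyMeasurable (fun p : ℝ × ℝ => (k p.1 p.2 : ℂ) * h p.2)
        ((volume.restrict (Ioc 0 t)).prod (volume.restrict (Ioc 0 t))) :=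
      (Complex.measurable_ofReal.comp hkm).aestronglyMeasurable.mul hh.aestronglyMeasurable.comp_snd
    refine (integrable_prod_iff' hm).2 ⟨?_, ?_⟩
    · refine (ae_restrict_iff' measurableSet_Ioc).2 (ae_of_all _ fun r hr => ?_)
      exact ((hkey r hr).1.ofReal).mul_const (h r)
    · have h1 : IntegrableOn (fun r => (t - r) * ‖h r‖) (Ioc 0 t) :=
        (((intervalIntegrable_iff_integrableOn_Ioc_of_le ht.le).2 hh.norm).continuousOn_mul
          (g := fun r => t - r) (by fun_prop)).1
      refine h1.congr_fun (fun r hr => ?_) measurableSet_Ioc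
      simp only [norm_mul]
      rw [integral_mul_const, ← (hkey r hr).2]
      congr 1
      refine setIntegral_congr_fun measurableSet_Ioc fun s hs => ?_
      rw [Complex.norm_real, Real.norm_of_nonneg (hknn s hs r)]
  have hswap := integral_integral_swap (f := fun s r => (k s r : ℂ) * h r) hint
  simp only [fracIntegral]
  rw [intervalIntegral.integral_of_le ht.le, intervalIntegral.integral_of_le ht.le]
  have hl : ∫ s in Ioc 0 t, (((t - s) ^ (b - 1) / Real.Gamma b : ℝ) : ℂ) *
      ∫ r in (0 : ℝ)..s, (((s - r) ^ (2 - b - 1) / Real.Gamma (2 - b) : ℝ) : ℂ) * h r =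
      ∫ s in Ioc 0 t, ∫ r in Ioc 0 t, (k s r : ℂ) * h r := by
    refine setIntegral_congr_fun measurableSet_Ioc fun s hs => ?_
    have hset : Ioo 0 s = Ioc 0 t ∩ Iio s := by
      ext r; simp only [mem_inter_iff, mem_Ioc, mem_Ioo, mem_Iio]
      exact ⟨fun h => ⟨⟨h.1, (h.2.trans_le hs.2).le⟩, h.2⟩, fun h => ⟨h.1.1, h.2⟩⟩
    rw [intervalIntegral.integral_of_le hs.1.le, integral_Ioc_eq_integral_Ioo, hset,
      ← setIntegral_indicator measurableSet_Iio, ← integral_const_mul]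
    refine integral_congr_ae (ae_of_all _ fun r => ?_)
    simp only [hk, indicator, mem_Iio]
    split_ifs
    · push_cast; ring
    · simp
  rw [hl, hswap]
  refine setIntegral_congr_fun measurableSet_Ioc fun r hr => ?_
  rw [integral_mul_const, show ∫ s in Ioc 0 t, (k s r : ℂ) = ((∫ s in Ioc 0 t, k s r : ℝ) : ℂ) from
    integral_ofReal, (hkey r hr).2]

/-- A solution of the Cauchy problem satisfies a Volterra equation. -/
lemma IsOdeSolution.volterra {b l : ℝ} {c₀ c₁ : ℂ} {f : ℝ → ℂ} (hb : b ∈ Ioc 1 2)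
    (hf : IsOdeSolution b l c₀ c₁ f) {t : ℝ} (ht : 0 < t) :
    f t = c₀ + t * c₁ - l * fracIntegral b f t := by
  have h1 := hf.regular.taylor ht
  have h2 : ∫ s in (0 : ℝ)..t, ((t - s : ℝ) : ℂ) * iteratedDeriv 2 f s =
      -l * fracIntegral b f t := by
    have h3 : ∫ s in (0 : ℝ)..t, ((t - s : ℝ) : ℂ) * iteratedDeriv 2 f s =
        fracIntegral b (caputo b f) t := by
      rcases hb.2.eq_or_lt with rfl | hb2
      · rw [fracIntegral]
        refine intervalIntegral.integral_congr fun s _ => ?_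
        simp only [caputo_eq hb, if_true]
        norm_num
      · rw [← fracIntegral_fracIntegral (by linarith [hb.1]) hb2 ht (hf.regular.integrableOn t)]
        congr 1
        funext s
        rw [caputo_eq hb, if_neg hb2.ne]
    rw [h3, fracIntegral, fracIntegral, ← intervalIntegral.integral_const_mul,
      intervalIntegral.integral_of_le ht.le, intervalIntegral.integral_of_le ht.le]
    refine setIntegral_congr_fun measurableSet_Ioc fun s hs => ?_
    simp only [hf.eqn s hs.1]
    ring
  rw [h2, hf.init, hf.deriv_init] at h1
  linear_combination -h1

/-- The difference satisfies the homogeneous Volterra equation, whose kernel is bounded because `b >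
1`. Its norm is then at most a constant times its own primitive, and Gronwall's inequality makes it
vanish. -/
lemma IsOdeSolution.unique {b l : ℝ} {c₀ c₁ : ℂ} {f g : ℝ → ℂ} (hb : b ∈ Ioc 1 2)
    (hf : IsOdeSolution b l c₀ c₁ f) (hg : IsOdeSolution b l c₀ c₁ g) {t : ℝ} (ht : 0 ≤ t) :
    f t = g t := by
  rcases ht.eq_or_lt with rfl | ht
  · rw [hf.init, hg.init]
  have hΓ := Real.Gamma_pos_of_pos (by linarith [hb.1] : 0 < b)
  set d : ℝ → ℂ := fun s => f s - g s with hd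
  have hdc : ContinuousOn d (Icc 0 t) :=
    (hf.regular.contDiffOn_one.continuousOn.sub hg.regular.contDiffOn_one.continuousOn).mono
      Icc_subset_Ici_self
  -- Constant extension beyond `[0, t]` gives a function continuous on the whole line, so that its
  -- primitive is differentiable everywhere.
  set D : ℝ → ℝ := fun s => ‖d (projIcc 0 t ht.le s)‖ with hD
  have hDc : Continuous D :=
    (hdc.comp_continuous (continuous_subtype_val.comp continuous_projIcc)
      fun s => (projIcc 0 t ht.le s).2).norm
  have hDd : ∀ s ∈ Icc 0 t, D s = ‖d s‖ := fun s hs => by simp only [hD, projIcc_of_mem ht.le hs]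
  have hker : ∀ s : ℝ, Continuous fun r : ℝ => (((s - r) ^ (b - 1) / Real.Gamma b : ℝ) : ℂ) := fun s =>
    Complex.continuous_ofReal.comp ((Real.continuous_rpow_const (by linarith [hb.1])).comp
      (continuous_const.sub continuous_id) |>.div_const _)
  have hbound : ∀ s ∈ Icc 0 t, D s ≤ |l| * (t ^ (b - 1) / Real.Gamma b) * ∫ r in (0 : ℝ)..s, D r := by
    intro s hs
    rw [hDd s hs]
    rcases hs.1.eq_or_lt with rfl | hs0
    · simp [hd, hf.init, hg.init]
    have hII : ∀ {u : ℝ → ℂ}, TimeRegular u → IntervalIntegrable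
        (fun r => (((s - r) ^ (b - 1) / Real.Gamma b : ℝ) : ℂ) * u r) volume 0 s := fun hu =>
      (((hker s).continuousOn.mul (hu.contDiffOn_one.continuousOn.mono
        (uIcc_of_le hs.1 ▸ Icc_subset_Ici_self))).intervalIntegrable)
    have heq : d s = -l * ∫ r in (0 : ℝ)..s, (((s - r) ^ (b - 1) / Real.Gamma b : ℝ) : ℂ) * d r := by
      simp only [hd, mul_sub]
      rw [intervalIntegral.integral_sub (hII hf.regular) (hII hg.regular), hf.volterra hb hs0,
        hg.volterra hb hs0, fracIntegral, fracIntegral]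
      ring
    rw [heq, norm_mul, norm_neg, Complex.norm_real, Real.norm_eq_abs, mul_assoc]
    refine mul_le_mul_of_nonneg_left ?_ (abs_nonneg _)
    rw [← intervalIntegral.integral_const_mul]
    refine intervalIntegral.norm_integral_le_of_norm_le hs.1 (ae_of_all _ fun r hr => ?_)
      ((hDc.const_mul _).intervalIntegrable _ _)
    rw [hDd r ⟨hr.1.le, hr.2.trans hs.2⟩, norm_mul, Complex.norm_real,
      Real.norm_of_nonneg (div_nonneg (Real.rpow_nonneg (sub_nonneg.2 hr.2) _) hΓ.le)]
    refine mul_le_mul_of_nonneg_right (div_le_div_of_nonneg_right (Real.rpow_le_rpow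
      (sub_nonneg.2 hr.2) (by linarith [hr.1, hs.2]) (by linarith [hb.1])) hΓ.le) (norm_nonneg _)
  have hv : ∀ s, HasDerivAt (fun s => ∫ r in (0 : ℝ)..s, D r) (D s) s := fun s =>
    intervalIntegral.integral_hasDerivAt_right (hDc.intervalIntegrable _ _)
      (hDc.stronglyMeasurableAtFilter _ _) hDc.continuousAt
  have hz := eq_zero_of_abs_deriv_le_mul_abs_self_of_eq_zero_right
    (f := fun s => ∫ r in (0 : ℝ)..s, D r) (f' := D) (a := 0) (b := t)
    (K := |l| * (t ^ (b - 1) / Real.Gamma b))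
    (fun s _ => (hv s).continuousAt.continuousWithinAt) (fun s _ => (hv s).hasDerivWithinAt)
    (by simp) fun s hs => by
      rw [Real.norm_of_nonneg (norm_nonneg _ : 0 ≤ D s), Real.norm_of_nonneg
        (intervalIntegral.integral_nonneg hs.1 fun _ _ => norm_nonneg _)]
      exact hbound s ⟨hs.1, hs.2.le⟩
  have hDt := hbound t ⟨ht.le, le_rfl⟩
  rw [hz t ⟨ht.le, le_rfl⟩, mul_zero, hDd t ⟨ht.le, le_rfl⟩] at hDt
  exact sub_eq_zero.1 (norm_le_zero_iff.1 hDt)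

/-! ### Subordination -/

lemma integrableOn_rpow_mul_wright {γ : ℝ} (hγ : γ ∈ Ioo 0 1) (m : ℝ) {p : ℝ} (hp : 0 < p) :
    IntegrableOn (fun z => z ^ (p - 1) * wright (-γ) m (-z)) (Ioi 0) := by
  obtain ⟨K, hK, h⟩ := exists_norm_wright_le hγ m 1
  refine ((integrableOn_exp_neg_smul_rpow hp one_pos).norm.const_mul K).mono' ?_ ?_
  · exact (measurable_id.pow_const _).aestronglyMeasurable.mul
      (continuous_wright hγ m).aestronglyMeasurable
  · refine (ae_restrict_iff' measurableSet_Ioi).2 (ae_of_all _ fun z (hz : 0 < z) => ?_)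
    rw [norm_mul, norm_smul, Real.norm_of_nonneg (Real.exp_pos _).le, Complex.norm_real,
      Real.norm_eq_abs (wright _ _ _)]
    have := mul_le_mul_of_nonneg_right (h z hz.le) (norm_nonneg (z ^ (p - 1)))
    linarith

lemma integrableOn_wright {γ : ℝ} (hγ : γ ∈ Ioo 0 1) (m : ℝ) :
    IntegrableOn (fun z => wright (-γ) m (-z)) (Ioi 0) := by
  simpa using integrableOn_rpow_mul_wright hγ m one_pos

/-- Mittag-Leffler functions of order `γ a` are mixtures of those of order `a`. -/
theorem integral_wright_mul_mittagLeffler {γ a : ℝ} (m : ℝ) (hγ : γ ∈ Ioo 0 1) (ha : 1 < γ * a)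
    (x : ℝ) :
    ∫ ξ in Ioi (0 : ℝ), wright (-γ) (m - γ) (-ξ) * mittagLeffler a 1 (x * ξ ^ a) =
      mittagLeffler (γ * a) m x := by
  have ha1 : 1 < a := by nlinarith [hγ.1, hγ.2]
  have ha0 : 0 < a := by linarith
  set F : ℕ → ℝ → ℝ := fun n ξ => x ^ n / Real.Gamma (a * n + 1) *
    (ξ ^ (a * n + 1 - 1) * wright (-γ) (m - γ) (-ξ)) with hF
  have hp : ∀ n : ℕ, 0 < a * n + 1 := fun n => by positivity
  have hFi : ∀ n, Integrable (F n) (volume.restrict (Ioi 0)) := fun n =>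
    (integrableOn_rpow_mul_wright hγ _ (hp n)).const_mul _
  -- The moment with `p = an + 1` has numerator `Γ(an + 1)`, which cancels the coefficient of
  -- `E_{a,1}`.
  have hFn : ∀ n, ∫ ξ in Ioi 0, F n ξ = x ^ n / Real.Gamma (γ * a * n + m) := fun n => by
    rw [hF, integral_const_mul, integral_rpow_mul_wright hγ _ (hp n)]
    have := (mlGamma_pos ha0.le one_pos n).ne'
    rw [show m - γ + γ * (a * n + 1) = γ * a * n + m by ring]
    field_simp
  -- Any rate `c ≥ 1` exceeding `|x|` would do: as `an + 1 ≥ n`, the terms are dominated by a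
  -- geometric series of ratio `|x| / c < 1`.
  set c := 2 * |x| + 1 with hc
  have hc1 : 1 ≤ c := by have := abs_nonneg x; linarith
  have hc0 : 0 < c := by linarith
  obtain ⟨K, hK, hKw⟩ := exists_norm_wright_le hγ (m - γ) c
  have hFs : Summable fun n => ∫ ξ in Ioi 0, ‖F n ξ‖ := by
    refine Summable.of_nonneg_of_le (fun n => by positivity) (fun n => ?_)
      ((summable_geometric_of_lt_one (r := |x| / c) (by positivity)
        ((div_lt_one hc0).2 (by have := abs_nonneg x; linarith))).mul_left K)
    have hG := mlGamma_pos ha0.le one_pos n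
    have h1 : ∫ ξ in Ioi 0, ‖F n ξ‖ ≤ ∫ ξ in Ioi 0, |x| ^ n / Real.Gamma (a * n + 1) *
        (K * (ξ ^ (a * n + 1 - 1) * Real.exp (-(c * ξ)))) := by
      refine setIntegral_mono_on (hFi n).norm (Integrable.const_mul (Integrable.const_mul ?_ _) _)
        measurableSet_Ioi fun ξ (hξ : 0 < ξ) => ?_
      · have := integrableOn_exp_neg_smul_rpow (hp n) hc0
        refine IntegrableOn.congr_fun (s := Ioi 0) this.norm (fun ξ (hξ : 0 < ξ) => ?_)
          measurableSet_Ioi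
        rw [norm_smul, Complex.norm_real, Real.norm_of_nonneg (Real.exp_pos _).le,
          Real.norm_of_nonneg (Real.rpow_nonneg hξ.le _), mul_comm, neg_mul]
      · simp only [hF, norm_mul, norm_div, norm_pow, Real.norm_eq_abs]
        rw [abs_of_pos hG, abs_of_nonneg (Real.rpow_nonneg hξ.le _)]
        refine mul_le_mul_of_nonneg_left ?_ (by positivity)
        have := mul_le_mul_of_nonneg_left (hKw ξ hξ.le) (Real.rpow_nonneg hξ.le (a * n + 1 - 1))
        rw [neg_mul] at this
        linarith
    refine h1.trans ?_
    rw [integral_const_mul, integral_const_mul, Real.integral_rpow_mul_exp_neg_mul_Ioi (hp n) hc0]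
    have h2 : (1 / c) ^ (a * n + 1) ≤ (1 / c) ^ (n : ℝ) :=
      Real.rpow_le_rpow_of_exponent_ge (by positivity) ((div_le_one hc0).2 hc1)
        (by have : (0 : ℝ) ≤ n := n.cast_nonneg
            nlinarith)
    rw [Real.rpow_natCast] at h2
    calc |x| ^ n / Real.Gamma (a * n + 1) * (K * ((1 / c) ^ (a * n + 1) * Real.Gamma (a * n + 1)))
        = K * (|x| ^ n * (1 / c) ^ (a * n + 1)) := by field_simp
      _ ≤ K * (|x| ^ n * (1 / c) ^ n) := by gcongr
      _ = K * (|x| / c) ^ n := by rw [← mul_pow, mul_one_div]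
  have h := hasSum_integral_of_summable_integral_norm hFi hFs
  simp_rw [hFn] at h
  rw [mittagLeffler, h.tsum_eq]
  refine setIntegral_congr_fun measurableSet_Ioi fun ξ (hξ : 0 < ξ) => ?_
  rw [mittagLeffler, ← tsum_mul_left]
  refine tsum_congr fun n => ?_
  simp only [hF]
  rw [mul_pow, ← Real.rpow_natCast (ξ ^ a), ← Real.rpow_mul hξ.le, add_sub_cancel_right]
  ring

lemma mittagLeffler_two_one (y : ℝ) : mittagLeffler 2 1 (-y ^ 2) = Real.cos y := by
  rw [mittagLeffler, ← (Real.hasSum_cos y).tsum_eq]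
  refine tsum_congr fun n => ?_
  have : (2 : ℝ) * n + 1 = ((2 * n : ℕ) : ℝ) + 1 := by push_cast; ring
  rw [this, Real.Gamma_nat_eq_factorial, neg_pow, pow_mul]

lemma mul_mittagLeffler_two_two (y : ℝ) : y * mittagLeffler 2 2 (-y ^ 2) = Real.sin y := by
  rw [mittagLeffler, ← (Real.hasSum_sin y).tsum_eq, ← tsum_mul_left]
  refine tsum_congr fun n => ?_
  have : (2 : ℝ) * n + 2 = ((2 * n + 1 : ℕ) : ℝ) + 1 := by push_cast; ring
  rw [this, Real.Gamma_nat_eq_factorial, neg_pow, pow_succ y (2 * n), pow_mul]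
  ring

/-- Mittag-Leffler functions of order less than two as cosine transforms. -/
lemma mittagLeffler_eq_integral_cos {b : ℝ} (hb : b ∈ Ioo 1 2) (m y : ℝ) :
    mittagLeffler b m (-y ^ 2) =
      ∫ ξ in Ioi (0 : ℝ), wright (-(b / 2)) (m - b / 2) (-ξ) * Real.cos (y * ξ) := by
  have h := integral_wright_mul_mittagLeffler m (γ := b / 2) (a := 2)
    ⟨by linarith [hb.1], by linarith [hb.2]⟩ (by linarith [hb.1]) (-y ^ 2)
  rw [div_mul_cancel₀ _ two_ne_zero] at h
  rw [← h]
  refine integral_congr_ae (ae_of_all _ fun ξ => ?_)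
  simp only
  rw [← mittagLeffler_two_one, mul_pow, neg_mul, Real.rpow_two]

/-- With `x = y²` the function is the cosine transform of a Wright function whose derivatives are
again integrable Wright functions. Bounding the integral directly gives the first estimate, and
integrating by parts twice gives the gain of `y²`. -/
lemma exists_abs_mittagLeffler_le {b : ℝ} (hb : b ∈ Ioo 1 2) (m : ℝ) :
    ∃ C, 0 ≤ C ∧ ∀ x, 0 ≤ x → |mittagLeffler b m (-x)| ≤ C ∧ |mittagLeffler b m (-x)| * x ≤ C := by
  have hγ : b / 2 ∈ Ioo (0 : ℝ) 1 := ⟨by linarith [hb.1], by linarith [hb.2]⟩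
  set γ := b / 2 with hγdef
  set Φ : ℝ → ℝ → ℝ := fun ν ξ => wright (-γ) ν (-ξ) with hΦ
  have hΦi : ∀ ν y, IntegrableOn (fun ξ => Φ ν ξ * Real.cos (y * ξ)) (Ioi 0) := fun ν y =>
    (integrableOn_wright hγ ν).mul_of_top_left (memLp_top_of_bound
      (by fun_prop : Continuous fun ξ => Real.cos (y * ξ)).aestronglyMeasurable 1
      (ae_of_all _ fun ξ => Real.abs_cos_le_one _))
  have hΦb : ∀ ν y, |∫ ξ in Ioi (0 : ℝ), Φ ν ξ * Real.cos (y * ξ)| ≤ ∫ ξ in Ioi (0 : ℝ), ‖Φ ν ξ‖ :=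
    fun ν y => by
      rw [← Real.norm_eq_abs]
      refine norm_integral_le_of_norm_le (integrableOn_wright hγ ν).norm (ae_of_all _ fun ξ => ?_)
      rw [norm_mul]
      exact mul_le_of_le_one_right (norm_nonneg _) (Real.abs_cos_le_one _)
  have hΦt : ∀ ν, Tendsto (Φ ν) atTop (𝓝 0) := fun ν => by
    obtain ⟨K, hK, h⟩ := exists_norm_wright_le hγ ν 1
    refine squeeze_zero_norm' (a := fun z => K * Real.exp (-1 * z)) ?_ ?_
    · filter_upwards [eventually_ge_atTop 0] with z hz using h z hz
    · have : Tendsto (fun z : ℝ => Real.exp (-1 * z)) atTop (𝓝 0) :=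
        Real.tendsto_exp_atBot.comp ((tendsto_const_mul_atBot_of_neg (by norm_num)).2 tendsto_id)
      simpa using this.const_mul K
  have hΦd : ∀ ν z, HasDerivAt (Φ ν) (-Φ (ν - γ) z) z := fun ν z => hasDerivAt_wright hγ ν z
  set μ := m - γ with hμ
  set A := ∫ ξ in Ioi (0 : ℝ), ‖Φ μ ξ‖ with hA
  set B := |Φ (μ - γ) 0| + ∫ ξ in Ioi (0 : ℝ), ‖Φ (μ - γ - γ) ξ‖ with hB
  have hA0 : 0 ≤ A := by positivity
  have hB0 : 0 ≤ B := by positivity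
  refine ⟨A + B, by positivity, fun x hx => ?_⟩
  have hE := mittagLeffler_eq_integral_cos hb m (Real.sqrt x)
  rw [Real.sq_sqrt hx] at hE
  rw [hE]
  refine ⟨(hΦb μ _).trans (by linarith), ?_⟩
  rcases hx.eq_or_lt with rfl | hx0
  · rw [mul_zero]; positivity
  set y := Real.sqrt x with hy
  have hy0 : 0 < y := Real.sqrt_pos.2 hx0
  have hyx : y ^ 2 = x := Real.sq_sqrt hx
  -- Both integrations by parts at once: the mixed sine terms cancel in the derivative, and only the
  -- cosine term survives at `0`.
  have hparts := integral_Ioi_of_hasDerivAt_of_tendsto (a := 0) (m := 0)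
    (f := fun ξ => Φ μ ξ * (Real.sin (y * ξ) * y) - Φ (μ - γ) ξ * Real.cos (y * ξ))
    (f' := fun ξ => y ^ 2 * (Φ μ ξ * Real.cos (y * ξ)) + Φ (μ - γ - γ) ξ * Real.cos (y * ξ)) ?_ ?_
    ?_ ?_
  · rw [integral_add ((hΦi μ y).const_mul _) (hΦi _ y), integral_const_mul, hyx] at hparts
    simp only [mul_zero, Real.sin_zero, zero_mul, Real.cos_zero, mul_one, zero_sub, neg_neg] at hparts
    have h1 : (∫ ξ in Ioi (0 : ℝ), Φ μ ξ * Real.cos (y * ξ)) * x =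
        Φ (μ - γ) 0 - ∫ ξ in Ioi (0 : ℝ), Φ (μ - γ - γ) ξ * Real.cos (y * ξ) := by linarith
    have h4 : |∫ ξ in Ioi (0 : ℝ), Φ μ ξ * Real.cos (y * ξ)| * x =
        |Φ (μ - γ) 0 - ∫ ξ in Ioi (0 : ℝ), Φ (μ - γ - γ) ξ * Real.cos (y * ξ)| := by
      rw [← h1, abs_mul, abs_of_nonneg hx]
    refine h4.le.trans ((abs_sub _ _).trans ?_)
    have := hΦb (μ - γ - γ) y
    linarith
  · exact (((hΦd _ _).continuousAt.mul (by fun_prop)).sub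
      ((hΦd _ _).continuousAt.mul (by fun_prop))).continuousWithinAt
  · intro ξ _
    have hl : HasDerivAt (fun ξ => y * ξ) y ξ := by simpa using (hasDerivAt_id ξ).const_mul y
    refine (((hΦd μ ξ).mul (hl.sin.mul_const y)).sub ((hΦd (μ - γ) ξ).mul hl.cos)).congr_deriv ?_
    ring
  · exact ((hΦi μ y).const_mul (y ^ 2)).add (hΦi (μ - γ - γ) y)
  · have h1 := (hΦt μ).norm.mul_const y
    have h2 := (hΦt (μ - γ)).norm
    have h3 := h1.add h2
    rw [norm_zero, zero_mul, zero_add] at h3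
    refine squeeze_zero_norm (fun ξ => ?_) h3
    refine (norm_sub_le _ _).trans (add_le_add ?_ ?_)
    · rw [norm_mul, norm_mul, Real.norm_of_nonneg hy0.le]
      exact mul_le_mul_of_nonneg_left (mul_le_of_le_one_left hy0.le (Real.abs_sin_le_one _))
        (norm_nonneg _)
    · rw [norm_mul]
      exact mul_le_of_le_one_right (norm_nonneg _) (Real.abs_cos_le_one _)

/-- At `b = 2` subordination to the cosine is unavailable, since `b / 2 < 1` fails; there the
functions are `cos y` and `sin y / y` with `x = y²`. -/
lemma exists_abs_mittagLeffler_le_of_mem_Ioc {b : ℝ} (hb : b ∈ Ioc 1 2) {m : ℝ} (hm : m = 1 ∨ m = 2) :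
    ∃ C, 0 ≤ C ∧ ∀ x, 0 ≤ x → |mittagLeffler b m (-x)| ≤ C := by
  rcases hb.2.eq_or_lt with rfl | hb2
  · refine ⟨1, zero_le_one, fun x hx => ?_⟩
    rw [← Real.sq_sqrt hx]
    rcases hm with rfl | rfl
    · rw [mittagLeffler_two_one]; exact Real.abs_cos_le_one _
    · rcases hx.eq_or_lt with rfl | hx0
      · simp [mittagLeffler_zero_right]
      · have h0 := Real.sqrt_pos.2 hx0
        have h := mul_mittagLeffler_two_two (Real.sqrt x)
        have h2 : |Real.sqrt x| * |mittagLeffler 2 2 (-Real.sqrt x ^ 2)| ≤ |Real.sqrt x| * 1 := by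
          rw [← abs_mul, h, mul_one]; exact Real.abs_sin_le_abs
        exact le_of_mul_le_mul_left h2 (abs_pos.2 h0.ne')
  · obtain ⟨C, hC, h⟩ := exists_abs_mittagLeffler_le ⟨hb.1, hb2⟩ m
    exact ⟨C, hC, fun x hx => (h x hx).1⟩

lemma continuous_mittagLeffler_abs_rpow {b m : ℝ} (hb : 1 < b) (hm : 0 < m) :
    Continuous fun k : ℝ => mittagLeffler b m (-|k| ^ b) :=
  (continuous_mittagLeffler hb hm).comp
    ((Real.continuous_rpow_const (by linarith)).comp continuous_abs).neg

/-- Boundedness of `x E(-x)` at `x = |k|^b` gives decay `|k|^(-b)`, and `b > 1`. -/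
theorem integrable_mittagLeffler_abs_rpow {b m : ℝ} (hb : b ∈ Ioo 1 2) (hm : 0 < m) :
    Integrable fun k : ℝ => mittagLeffler b m (-|k| ^ b) := by
  obtain ⟨C, hC, h⟩ := exists_abs_mittagLeffler_le hb m
  have hb0 : 0 < b := by linarith [hb.1]
  refine Integrable.mono' (g := fun k : ℝ => (2 ^ b * C) * (1 + ‖k‖) ^ (-b))
    ((integrable_one_add_norm (by simpa using hb.1)).const_mul _)
    (continuous_mittagLeffler_abs_rpow hb.1 hm).aestronglyMeasurable (ae_of_all _ fun k => ?_)
  obtain ⟨h1, h2⟩ := h (|k| ^ b) (by positivity)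
  rw [Real.rpow_neg (by positivity), ← div_eq_mul_inv, le_div_iff₀ (by positivity), Real.norm_eq_abs,
    Real.norm_eq_abs, mul_comm (2 ^ b)]
  rcases le_total |k| 1 with hk | hk
  · exact mul_le_mul h1 (Real.rpow_le_rpow (by positivity) (by linarith) hb0.le) (by positivity) hC
  · have h3 : (1 + |k|) ^ b ≤ |k| ^ b * 2 ^ b := by
      rw [← Real.mul_rpow (abs_nonneg k) zero_le_two]
      exact Real.rpow_le_rpow (by positivity) (by linarith) hb0.le
    calc _ ≤ |mittagLeffler b m (-|k| ^ b)| * (|k| ^ b * 2 ^ b) :=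
          mul_le_mul_of_nonneg_left h3 (abs_nonneg _)
      _ = |mittagLeffler b m (-|k| ^ b)| * |k| ^ b * 2 ^ b := by ring
      _ ≤ C * 2 ^ b := by gcongr

/-! ### Cosine transforms -/

lemma integrable_of_even {f : ℝ → ℂ} (hf : ∀ x, f (-x) = f x) (hi : IntegrableOn f (Ioi 0)) :
    Integrable f := by
  rw [← integrableOn_univ, ← Iic_union_Ioi (a := (0 : ℝ)), integrableOn_union,
    integrableOn_Iic_iff_integrableOn_Iio]
  refine ⟨?_, hi⟩
  have := ((Measure.measurePreserving_neg (volume : Measure ℝ)).integrableOn_comp_preimage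
    (MeasurableEquiv.neg ℝ).measurableEmbedding (s := Ioi 0)).2 hi
  simpa [Function.comp_def, hf] using this

/-- The Fourier integral of an even real function. -/
lemma integral_cexp_mul_even {f : ℝ → ℝ} (hf : ∀ x, f (-x) = f x) (hi : Integrable f) (y : ℝ) :
    ∫ k : ℝ, Complex.exp (Complex.I * k * y) * f k =
      ((2 * ∫ k in Ioi (0 : ℝ), f k * Real.cos (k * y) : ℝ) : ℂ) := by
  have hg : Integrable fun k : ℝ => Complex.exp (Complex.I * k * y) * (f k : ℂ) := by
    refine hi.ofReal.bdd_mul (c := 1)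
      (by fun_prop : Continuous fun k : ℝ => Complex.exp (Complex.I * k * y)).aestronglyMeasurable
      (ae_of_all _ fun k => le_of_eq ?_)
    rw [show Complex.I * k * y = ((k * y : ℝ) : ℂ) * Complex.I by push_cast; ring,
      Complex.norm_exp_ofReal_mul_I]
  rw [← intervalIntegral.integral_Iic_add_Ioi (b := 0) hg.integrableOn hg.integrableOn,
    ← neg_zero, ← integral_comp_neg_Ioi, neg_zero, ← integral_add _ hg.integrableOn]
  · rw [← integral_const_mul, ← integral_complex_ofReal]
    refine integral_congr_ae (ae_of_all _ fun k => ?_)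
    simp only [hf]
    have h := Complex.two_cos (k * y : ℂ)
    push_cast
    rw [mul_left_comm, h, show Complex.I * -(k : ℂ) * y = -(k * y) * Complex.I by ring,
      show Complex.I * (k : ℂ) * y = k * y * Complex.I by ring]
    ring
  · exact (hg.comp_neg).integrableOn

/-- Inversion of the cosine transform. -/
lemma cosine_inversion {f g : ℝ → ℝ} (hf : ∀ x, f (-x) = f x) (hi : Integrable f)
    (hc : Continuous f) (hg : ∀ x, g (-x) = g x) (hgi : Integrable g)
    (hfg : ∀ y, g y = 1 / Real.pi * ∫ k in Ioi (0 : ℝ), f k * Real.cos (k * y)) (k : ℝ) :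
    f k = 2 * ∫ y in Ioi (0 : ℝ), g y * Real.cos (y * k) := by
  have hπ := Real.pi_pos
  -- The factors `2π` convert the cosine transform to the kernel `exp(-2πi x w)`, for which the
  -- inversion theorem is stated.
  have hF : 𝓕 (fun x => (f x : ℂ)) = fun w => ((2 * Real.pi * g (w * (2 * Real.pi)) : ℝ) : ℂ) := by
    funext w
    have h := integral_cexp_mul_even hf hi (-(w * (2 * Real.pi)))
    have h2 := hfg (-(w * (2 * Real.pi)))
    rw [hg] at h2
    rw [h2, Real.fourier_real_eq_integral_exp_smul]
    have h3 : 2 * Real.pi * (1 / Real.pi * ∫ k in Ioi (0 : ℝ), f k * Real.cos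
        (k * -(w * (2 * Real.pi)))) = 2 * ∫ k in Ioi (0 : ℝ), f k * Real.cos
        (k * -(w * (2 * Real.pi))) := by
      rw [← mul_assoc, mul_assoc 2, mul_one_div_cancel hπ.ne', mul_one]
    rw [h3, ← h]
    refine integral_congr_ae (ae_of_all _ fun v => ?_)
    simp only [smul_eq_mul]
    congr 2
    push_cast
    ring
  have hFi : Integrable (𝓕 (fun x => (f x : ℂ))) := by
    rw [hF]
    exact ((hgi.comp_mul_right' (by positivity : 2 * Real.pi ≠ 0)).const_mul _).ofReal
  have hi' : Integrable fun x => (f x : ℂ) := hi.ofReal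
  have h := hi'.fourierInv_fourier_eq hFi
    (v := k) (Complex.continuous_ofReal.comp hc).continuousAt
  rw [hF, Real.fourierInv_eq'] at h
  have h4 := integral_cexp_mul_even hg hgi k
  rw [← Complex.ofReal_inj, ← h4, ← h]
  have h5 := Measure.integral_comp_mul_right
    (fun y : ℝ => Complex.exp (Complex.I * y * k) * (g y : ℂ)) (2 * Real.pi)
  rw [abs_of_pos (by positivity), eq_inv_smul_iff₀ (by positivity)] at h5
  rw [← h5, ← integral_smul]
  refine integral_congr_ae (ae_of_all _ fun v => ?_)
  simp only [smul_eq_mul, Complex.real_smul, RCLike.inner_apply, conj_trivial]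
  rw [show Complex.I * ((v * (2 * Real.pi) : ℝ) : ℂ) * k =
    ((2 * Real.pi * (k * v) : ℝ) : ℂ) * Complex.I by push_cast; ring]
  push_cast
  ring

/-! ### The function `X` -/

/-- `|arg s| ≤ π/2` and `α < 2` keep `α |arg s|` strictly below `π`, so `s^α` is never a negative
real. -/
lemma cpow_ne_neg_one {α : ℝ} (hα : α ∈ Ioo 0 2) {s : ℂ} (hs : 0 ≤ s.re) : 1 + s ^ (α : ℂ) ≠ 0 := by
  intro h
  have h1 : s ^ (α : ℂ) = -1 := by linear_combination h
  have hs0 : s ≠ 0 := by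
    rintro rfl
    rw [Complex.zero_cpow (by exact_mod_cast hα.1.ne')] at h1
    norm_num at h1
  have h2 : ‖s‖ ^ α = 1 := by rw [← Complex.norm_cpow_real, h1]; simp
  have h3 := cpow_re_eq s α hs0
  rw [h1, h2, one_mul] at h3
  have harg := Complex.abs_arg_le_pi_div_two_iff.2 hs
  have hπ := Real.pi_pos
  have h4 : |α * s.arg| < Real.pi := by
    rw [abs_mul, abs_of_pos hα.1]
    nlinarith [hα.1, hα.2, abs_nonneg s.arg]
  have h5 := Real.cos_lt_cos_of_nonneg_of_le_pi (abs_nonneg _) le_rfl h4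
  rw [Real.cos_abs, Real.cos_pi, ← h3] at h5
  norm_num at h5

/-- The Laplace transform of `E_{α,1}(-t^α)`. -/
noncomputable def mlLaplace (α : ℝ) (s : ℂ) : ℂ := s ^ ((α - 1 : ℝ) : ℂ) / (1 + s ^ (α : ℂ))

/-- Term-by-term transformation gives a geometric series in `-s^(-α)`. The condition `Re s > 1`
makes the series of absolute integrals converge. -/
lemma laplace_mlKernel_of_one_lt {α : ℝ} (hα : 1 < α) {s : ℂ} (hs : 1 < s.re) :
    ∫ t in Ioi (0 : ℝ), Complex.exp (-s * t) * (mlKernel α 1 1 t : ℂ) = mlLaplace α s := by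
  have hs0 : 0 < s.re := by linarith
  have hne : s ≠ 0 := fun h => by simp [h] at hs0
  have hα0 : 0 < α := by linarith
  have hp : ∀ n : ℕ, 0 < α * n + 1 := fun n => by positivity
  set F : ℕ → ℝ → ℂ := fun n t => (((-1) ^ n / Real.Gamma (α * n + 1) : ℝ) : ℂ) *
    (Complex.exp (-s * t) * ((t ^ (α * n + 1 - 1) : ℝ) : ℂ)) with hF
  have hFi : ∀ n, Integrable (F n) (volume.restrict (Ioi 0)) := fun n =>
    (integrableOn_laplace (fun ε hε => integrableOn_exp_neg_smul_rpow (hp n) hε) hs0).const_mul _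
  have hpow : ∀ n : ℕ, s ^ (-(α * n + 1 : ℝ) : ℂ) = (s ^ (-α : ℂ)) ^ n * s⁻¹ := fun n => by
    rw [← Complex.cpow_nat_mul, ← Complex.cpow_neg_one, ← Complex.cpow_add _ _ hne]
    congr 1
    push_cast
    ring
  have hFn : ∀ n, ∫ t in Ioi 0, F n t = (-(s ^ (-α : ℂ))) ^ n * s⁻¹ := fun n => by
    rw [hF, integral_const_mul, integral_cexp_neg_mul_rpow (hp n) hs0, hpow, neg_pow (s ^ _)]
    have : ((Real.Gamma (α * n + 1) : ℝ) : ℂ) ≠ 0 :=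
      Complex.ofReal_ne_zero.2 (mlGamma_pos hα0.le one_pos n).ne'
    push_cast at this ⊢
    field_simp
  have hFs : Summable fun n => ∫ t in Ioi 0, ‖F n t‖ := by
    have h1 : ∀ n, ∫ t in Ioi 0, ‖F n t‖ = (1 / s.re) ^ (α * n + 1) := fun n => by
      have h2 : ∫ t in Ioi 0, ‖F n t‖ = ∫ t in Ioi 0, 1 / Real.Gamma (α * n + 1) *
          (t ^ (α * n + 1 - 1) * Real.exp (-(s.re * t))) := by
        refine setIntegral_congr_fun measurableSet_Ioi fun t (ht : 0 < t) => ?_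
        simp only [hF, norm_mul, norm_cexp_neg_mul_ofReal, Complex.norm_real, norm_div, norm_pow,
          norm_neg, norm_one, one_pow]
        rw [Real.norm_of_nonneg (mlGamma_pos hα0.le one_pos n).le,
          Real.norm_of_nonneg (Real.rpow_nonneg ht.le _), neg_mul, mul_comm (Real.exp _)]
      rw [h2, integral_const_mul, Real.integral_rpow_mul_exp_neg_mul_Ioi (hp n) hs0]
      have := (mlGamma_pos hα0.le one_pos n).ne'
      field_simp
    simp_rw [h1]
    refine Summable.of_nonneg_of_le (fun n => by positivity) (fun n => ?_)
      (summable_geometric_of_lt_one (r := 1 / s.re) (by positivity) ((div_lt_one hs0).2 hs))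
    rw [← Real.rpow_natCast]
    exact Real.rpow_le_rpow_of_exponent_ge (by positivity) ((div_le_one hs0).2 hs.le)
      (by have : (0 : ℝ) ≤ n := n.cast_nonneg
          nlinarith)
  have h := hasSum_integral_of_summable_integral_norm hFi hFs
  simp_rw [hFn] at h
  have hlt : ‖-(s ^ (-α : ℂ))‖ < 1 := by
    rw [norm_neg, show (-α : ℂ) = ((-α : ℝ) : ℂ) from (Complex.ofReal_neg α).symm,
      Complex.norm_cpow_real]
    exact Real.rpow_lt_one_of_one_lt_of_neg (hs.trans_le (Complex.re_le_norm s)) (by linarith)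
  have h2 := ((hasSum_geometric_of_norm_lt_one hlt).mul_right s⁻¹).unique h
  have h3 : ∫ t in Ioi (0 : ℝ), Complex.exp (-s * t) * (mlKernel α 1 1 t : ℂ) =
      ∫ t in Ioi (0 : ℝ), ∑' n, F n t := by
    refine setIntegral_congr_fun measurableSet_Ioi fun t (ht : 0 < t) => ?_
    rw [← (hasSum_mlKernel hα one_pos 1 ht).tsum_eq, Complex.ofReal_tsum, ← tsum_mul_left]
    refine tsum_congr fun n => ?_
    simp only [hF]
    push_cast
    ring
  rw [h3, ← h2, mlLaplace, sub_neg_eq_add, Complex.cpow_neg, Complex.ofReal_sub, Complex.ofReal_one,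
    Complex.cpow_sub _ _ hne, Complex.cpow_one]
  have h4 : s ^ (α : ℂ) ≠ 0 := by simp [Complex.cpow_eq_zero_iff, hne]
  rw [div_div, ← mul_inv, ← one_div, div_eq_div_iff]
  · field_simp
    ring
  · have h5 : 1 + (s ^ (α : ℂ))⁻¹ ≠ 0 := fun h => by
      have : -(s ^ (-α : ℂ)) = 1 := by rw [Complex.cpow_neg]; linear_combination -h
      rw [this] at hlt
      simp at hlt
    exact mul_ne_zero h5 hne
  · refine mul_ne_zero hne fun h => ?_
    have : -(s ^ (-α : ℂ)) = 1 := by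
      rw [Complex.cpow_neg, show s ^ (α : ℂ) = -1 by linear_combination h]; norm_num
    rw [this] at hlt
    simp at hlt

lemma integrableOn_mlKernel_one {α : ℝ} (hα : α ∈ Ioo 1 2) :
    IntegrableOn (fun t => (mlKernel α 1 1 t : ℂ)) (Ioi 0) := by
  refine (integrable_mittagLeffler_abs_rpow hα one_pos).ofReal.integrableOn.congr_fun
    (fun t (ht : 0 < t) => ?_) measurableSet_Ioi
  simp only [mlKernel_one, abs_of_pos ht, neg_one_mul]
  rfl

/-- Analytic continuation from `Re s > 1`. The integral is analytic on the larger half-plane because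
the kernel is integrable, and the quotient because its denominator has no zero there. -/
lemma laplace_mlKernel {α : ℝ} (hα : α ∈ Ioo 1 2) {s : ℂ} (hs : 0 < s.re) :
    ∫ t in Ioi (0 : ℝ), Complex.exp (-s * t) * (mlKernel α 1 1 t : ℂ) = mlLaplace α s := by
  have hi : ∀ ε > 0, IntegrableOn (fun t => Real.exp (-ε * t) • (mlKernel α 1 1 t : ℂ)) (Ioi 0) := by
    intro ε hε
    refine (integrableOn_mlKernel_one hα).bdd_smul 1
      (by fun_prop : Continuous fun t : ℝ => Real.exp (-ε * t)).aestronglyMeasurable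
      ((ae_restrict_iff' measurableSet_Ioi).2 (ae_of_all _ fun t (ht : 0 < t) => ?_))
    rw [Real.norm_of_nonneg (Real.exp_pos _).le, Real.exp_le_one_iff]
    nlinarith [mul_pos hε ht]
  have hα2 : α ∈ Ioo (0 : ℝ) 2 := ⟨by linarith [hα.1], hα.2⟩
  refine AnalyticOnNhd.eqOn_of_preconnected_of_eventuallyEq (analyticOnNhd_laplace hi)
    (g := mlLaplace α) ?_ isPreconnected_rightHalfPlane (z₀ := 2) (by simp) ?_ hs
  · exact (analyticOnNhd_cpow_rightHalfPlane _).div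
      (analyticOnNhd_const.add (analyticOnNhd_cpow_rightHalfPlane _))
      fun z hz => cpow_ne_neg_one hα2 (le_of_lt hz)
  · have : {z : ℂ | 1 < z.re} ∈ 𝓝 (2 : ℂ) :=
      (isOpen_lt continuous_const Complex.continuous_re).mem_nhds (by simp)
    filter_upwards [this] with z hz using laplace_mlKernel_of_one_lt hα.1 hz

/-- The Laplace transform of `E_{α,1}(-t^α)` on the imaginary axis. -/
lemma fourier_mlKernel {α : ℝ} (hα : α ∈ Ioo 1 2) (y : ℝ) :
    ∫ t in Ioi (0 : ℝ), Complex.exp (-(-(y * Complex.I)) * t) * (mlKernel α 1 1 t : ℂ) =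
      mlLaplace α (-(y * Complex.I)) := by
  have hα2 : α ∈ Ioo (0 : ℝ) 2 := ⟨by linarith [hα.1], hα.2⟩
  have hz : Tendsto (fun ε : ℝ => (ε : ℂ) + -(y * Complex.I)) (𝓝[>] 0) (𝓝 (-(y * Complex.I))) := by
    have : Continuous fun ε : ℝ => (ε : ℂ) + -(y * Complex.I) := by fun_prop
    simpa using (this.tendsto 0).mono_left nhdsWithin_le_nhds
  have hre : (-((y : ℂ) * Complex.I)).re = 0 := by simp
  -- The axis is reached by `ε → 0+`. The exponents `α - 1` and `α` are positive, so the transform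
  -- is continuous even at `s = 0`.
  have hr : Tendsto (fun ε : ℝ => mlLaplace α ((ε : ℂ) + -(y * Complex.I))) (𝓝[>] 0)
      (𝓝 (mlLaplace α (-(y * Complex.I)))) := by
    have h1 : ContinuousAt (mlLaplace α) (-(y * Complex.I)) := by
      refine (Complex.continuousAt_cpow_const_of_re_pos (Or.inl hre.ge) ?_).div
        (continuousAt_const.add (Complex.continuousAt_cpow_const_of_re_pos (Or.inl hre.ge) ?_))
        (cpow_ne_neg_one hα2 hre.ge)
      · rw [Complex.ofReal_re]; linarith [hα.1]
      · rw [Complex.ofReal_re]; exact hα2.1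
    exact h1.tendsto.comp hz
  have hl : Tendsto (fun ε : ℝ => ∫ t in Ioi (0 : ℝ), Complex.exp (-((ε : ℂ) + -(y * Complex.I)) * t) *
      (mlKernel α 1 1 t : ℂ)) (𝓝[>] 0) (𝓝 (∫ t in Ioi (0 : ℝ),
        Complex.exp (-(-(y * Complex.I)) * t) * (mlKernel α 1 1 t : ℂ))) := by
    refine tendsto_integral_filter_of_dominated_convergence (fun t => ‖(mlKernel α 1 1 t : ℂ)‖) ?_ ?_
      (integrableOn_mlKernel_one hα).norm ?_
    · exact Eventually.of_forall fun ε => (by fun_prop : Continuous fun t : ℝ => Complex.exp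
        (-((ε : ℂ) + -(y * Complex.I)) * t)).aestronglyMeasurable.mul
        (integrableOn_mlKernel_one hα).aestronglyMeasurable
    · filter_upwards [self_mem_nhdsWithin] with ε hε
      refine (ae_restrict_iff' measurableSet_Ioi).2 (ae_of_all _ fun t (ht : 0 < t) => ?_)
      rw [norm_mul, norm_cexp_neg_mul_ofReal, Complex.add_re, hre, Complex.ofReal_re, add_zero]
      refine mul_le_of_le_one_left (norm_nonneg _) (Real.exp_le_one_iff.2 ?_)
      have : 0 < ε := hε
      nlinarith
    · refine ae_of_all _ fun t => ?_
      have : Continuous fun z : ℂ => Complex.exp (-z * t) * (mlKernel α 1 1 t : ℂ) := by fun_prop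
      exact (this.tendsto _).comp hz
  refine tendsto_nhds_unique hl (hr.congr' ?_)
  filter_upwards [self_mem_nhdsWithin] with ε hε
  refine (laplace_mlKernel hα ?_).symm
  rw [Complex.add_re, hre, Complex.ofReal_re, add_zero]
  exact hε

lemma neg_mul_I_cpow {y : ℝ} (hy : 0 < y) (c : ℝ) :
    (-((y : ℂ) * Complex.I)) ^ (c : ℂ) = (y ^ c : ℝ) *
      ((Real.cos (c * Real.pi / 2) : ℂ) - Real.sin (c * Real.pi / 2) * Complex.I) := by
  rw [← mul_neg, ofReal_mul_cpow hy (by simp), ← Complex.ofReal_cpow hy.le,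
    Complex.cpow_def_of_ne_zero (by simp), Complex.log_neg_I,
    show -((Real.pi : ℂ) / 2) * Complex.I * c = ((-(c * Real.pi / 2) : ℝ) : ℂ) * Complex.I by
      push_cast; ring, Complex.exp_mul_I, ← Complex.ofReal_cos, ← Complex.ofReal_sin, Real.cos_neg,
    Real.sin_neg]
  push_cast
  ring

/-- By `2|t| ≤ 1 + t²` the cross term costs at most the fraction `|cos(απ/2)|` of `1 + t²`, and this
is below `1` because `sin(απ/2) > 0`. -/
lemma X_denom_pos {α : ℝ} (hα : α ∈ Ioo 1 2) (t : ℝ) :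
    (1 - |Real.cos (α * Real.pi / 2)|) * (1 + t ^ 2) ≤ 1 + 2 * t * Real.cos (α * Real.pi / 2) + t ^ 2 ∧
      0 < 1 - |Real.cos (α * Real.pi / 2)| := by
  have hπ := Real.pi_pos
  constructor
  · have h1 : -(|t| * |Real.cos (α * Real.pi / 2)|) ≤ t * Real.cos (α * Real.pi / 2) := by
      rw [← abs_mul]; exact neg_abs_le _
    nlinarith [abs_nonneg (Real.cos (α * Real.pi / 2)), sq_nonneg (|t| - 1), sq_abs t]
  · have h1 : 0 < Real.sin (α * Real.pi / 2) :=
      Real.sin_pos_of_pos_of_lt_pi (by nlinarith [hα.1]) (by nlinarith [hα.2])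
    have h2 := Real.sin_sq_add_cos_sq (α * Real.pi / 2)
    have h3 : Real.cos (α * Real.pi / 2) ^ 2 < 1 ^ 2 := by nlinarith
    rw [sq_lt_sq, abs_one] at h3
    linarith

/-- At `s = -iy` the denominator of `X α y` is `|1 + s^α|²`, and the shift of angle by `π/2` turns
the cosine of `(α - 1)π/2` into `sin(απ/2)`. -/
lemma mlLaplace_re {α : ℝ} (hα : α ∈ Ioo 1 2) (y : ℝ) (hy : 0 ≤ y) :
    (mlLaplace α (-(y * Complex.I))).re = Real.pi * X α y := by
  have hα1 : 0 < α - 1 := by linarith [hα.1]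
  rcases hy.eq_or_lt with rfl | hy0
  · have h0 : (α : ℂ) - 1 ≠ 0 := by exact_mod_cast hα1.ne'
    simp [mlLaplace, X, Real.zero_rpow hα1.ne', Complex.zero_cpow h0]
  obtain ⟨hd, hd0⟩ := X_denom_pos hα (y ^ α)
  set S := Real.sin (α * Real.pi / 2) with hS
  set C := Real.cos (α * Real.pi / 2) with hC
  have hSC : S ^ 2 + C ^ 2 = 1 := Real.sin_sq_add_cos_sq _
  have hD : 0 < 1 + 2 * y ^ α * C + (y ^ α) ^ 2 := lt_of_lt_of_le (by positivity) hd
  have h1 : Real.cos ((α - 1) * Real.pi / 2) = S := by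
    rw [show (α - 1) * Real.pi / 2 = α * Real.pi / 2 - Real.pi / 2 by ring, Real.cos_sub_pi_div_two]
  have h2 : Real.sin ((α - 1) * Real.pi / 2) = -C := by
    rw [show (α - 1) * Real.pi / 2 = α * Real.pi / 2 - Real.pi / 2 by ring, Real.sin_sub_pi_div_two]
  rw [mlLaplace, neg_mul_I_cpow hy0, neg_mul_I_cpow hy0, h1, h2, ← hS, ← hC, X, abs_of_pos hy0,
    ← hS, ← hC, show (2 : ℝ) * α = α * (2 : ℕ) by push_cast; ring, Real.rpow_mul_natCast hy0.le]
  rw [Complex.div_re, Complex.normSq_apply]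
  simp
  have hD2 : (1 + y ^ α * C) * (1 + y ^ α * C) + y ^ α * S * (y ^ α * S) =
      1 + 2 * y ^ α * C + (y ^ α) ^ 2 := by
    linear_combination (y ^ α) ^ 2 * hSC
  rw [hD2]
  have := hD.ne'
  have := Real.pi_ne_zero
  field_simp
  ring

lemma X_neg (α y : ℝ) : X α (-y) = X α y := by simp [X]

lemma X_abs (α y : ℝ) : X α |y| = X α y := by simp [X]

lemma Y_neg (α y : ℝ) : Y α (-y) = Y α y := by simp [Y]

/-- `X` is the cosine transform of a Mittag-Leffler function. -/
lemma X_eq_integral_cos {α : ℝ} (hα : α ∈ Ioo 1 2) (y : ℝ) :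
    X α y = 1 / Real.pi * ∫ k in Ioi (0 : ℝ), mittagLeffler α 1 (-|k| ^ α) * Real.cos (k * y) := by
  have hcos : ∀ k : ℝ, Real.cos (k * y) = Real.cos (k * |y|) := fun k => by
    rw [← Real.cos_abs, ← Real.cos_abs (k * |y|), abs_mul, abs_mul, abs_abs]
  have h := congrArg Complex.re (fourier_mlKernel hα |y|)
  rw [mlLaplace_re hα _ (abs_nonneg y), X_abs, ← Complex.reCLM_apply,
    ← Complex.reCLM.integral_comp_comm] at h
  · rw [← mul_right_inj' Real.pi_ne_zero, ← h, ← mul_assoc, mul_one_div_cancel Real.pi_ne_zero, one_mul]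
    refine setIntegral_congr_fun measurableSet_Ioi fun k (hk : 0 < k) => ?_
    simp only [Complex.reCLM_apply]
    rw [Complex.re_mul_ofReal, neg_neg,
      show ((|y| : ℝ) : ℂ) * Complex.I * k = ((k * |y| : ℝ) : ℂ) * Complex.I by push_cast; ring,
      Complex.exp_ofReal_mul_I_re, hcos, mlKernel_one, abs_of_pos hk, neg_one_mul, mul_comm]
  · refine (integrableOn_mlKernel_one hα).bdd_mul (c := 1)
      (by fun_prop : Continuous fun t : ℝ => Complex.exp (-(-((|y| : ℝ) * Complex.I)) * t)).aestronglyMeasurable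
      (ae_of_all _ fun t => ?_)
    rw [norm_cexp_neg_mul_ofReal]
    simp

lemma continuous_X {α : ℝ} (hα : α ∈ Ioo 1 2) : Continuous (X α) := by
  have h0 : Continuous fun y : ℝ => |y| ^ (α - 1) :=
    (Real.continuous_rpow_const (by linarith [hα.1])).comp continuous_abs
  have h1 : Continuous fun y : ℝ => |y| ^ α :=
    (Real.continuous_rpow_const (by linarith [hα.1])).comp continuous_abs
  have h2 : Continuous fun y : ℝ => |y| ^ (2 * α) :=
    (Real.continuous_rpow_const (by linarith [hα.1])).comp continuous_abs
  refine continuous_const.mul ((h0.mul continuous_const).div (by fun_prop) fun y => ?_)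
  obtain ⟨hd, hd0⟩ := X_denom_pos hα (|y| ^ α)
  rw [show (2 : ℝ) * α = α * (2 : ℕ) by push_cast; ring, Real.rpow_mul_natCast (abs_nonneg y)]
  exact (lt_of_lt_of_le (by positivity) hd).ne'

/-- Decay of order `|y|^(-α-1)`: multiplying the numerator by `|y|^(α+1)` gives `|y|^(2α)`, the
leading power of the denominator. -/
lemma integrable_X {α : ℝ} (hα : α ∈ Ioo 1 2) : Integrable (X α) := by
  have hα0 : 0 < α := by linarith [hα.1]
  obtain ⟨-, hd0⟩ := X_denom_pos hα 0
  set c := 1 - |Real.cos (α * Real.pi / 2)| with hc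
  have hπ := Real.pi_pos
  refine Integrable.mono' (g := fun y : ℝ => (1 / Real.pi * (2 ^ (α + 1) / c)) * (1 + ‖y‖) ^ (-(α + 1)))
    ((integrable_one_add_norm (by simp; linarith)).const_mul _)
    (continuous_X hα).aestronglyMeasurable (ae_of_all _ fun y => ?_)
  obtain ⟨hd, -⟩ := X_denom_pos hα (|y| ^ α)
  have hD : 0 < 1 + 2 * |y| ^ α * Real.cos (α * Real.pi / 2) + (|y| ^ α) ^ 2 :=
    lt_of_lt_of_le (by positivity) hd
  rw [X, show (2 : ℝ) * α = α * (2 : ℕ) by push_cast; ring, Real.rpow_mul_natCast (abs_nonneg y),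
    norm_mul, Real.norm_of_nonneg (by positivity : 0 ≤ 1 / Real.pi), mul_assoc (1 / Real.pi), norm_div, norm_mul,
    Real.norm_of_nonneg hD.le, Real.norm_of_nonneg (by positivity : 0 ≤ |y| ^ (α - 1))]
  refine mul_le_mul_of_nonneg_left ?_ (by positivity)
  have h1 : |y| ^ (α - 1) * ‖Real.sin (α * Real.pi / 2)‖ ≤ |y| ^ (α - 1) :=
    mul_le_of_le_one_right (by positivity) (Real.abs_sin_le_one _)
  have h2 : |y| ^ (α - 1) * (1 + |y|) ^ (α + 1) ≤ 2 ^ (α + 1) * (1 + (|y| ^ α) ^ 2) := by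
    have h2p : (0 : ℝ) < 2 ^ (α + 1) := by positivity
    rcases le_total |y| 1 with hy | hy
    · have h3 : |y| ^ (α - 1) ≤ 1 := Real.rpow_le_one (abs_nonneg _) hy (by linarith [hα.1])
      have h4 : (1 + |y|) ^ (α + 1) ≤ 2 ^ (α + 1) :=
        Real.rpow_le_rpow (by positivity) (by linarith) (by linarith)
      calc _ ≤ 1 * 2 ^ (α + 1) := mul_le_mul h3 h4 (by positivity) zero_le_one
        _ ≤ _ := by nlinarith [sq_nonneg (|y| ^ α)]
    · have h4 : (1 + |y|) ^ (α + 1) ≤ 2 ^ (α + 1) * |y| ^ (α + 1) := by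
        rw [← Real.mul_rpow zero_le_two (abs_nonneg y)]
        exact Real.rpow_le_rpow (by positivity) (by linarith) (by linarith)
      have hy0 : 0 < |y| := by linarith
      have h5 : |y| ^ (α - 1) * |y| ^ (α + 1) = (|y| ^ α) ^ 2 := by
        rw [← Real.rpow_add hy0, ← Real.rpow_mul_natCast hy0.le]
        congr 1; push_cast; ring
      calc _ ≤ |y| ^ (α - 1) * (2 ^ (α + 1) * |y| ^ (α + 1)) := by gcongr
        _ = 2 ^ (α + 1) * (|y| ^ α) ^ 2 := by rw [← h5]; ring
        _ ≤ _ := by nlinarith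
  rw [Real.rpow_neg (by positivity), Real.norm_eq_abs, Real.norm_eq_abs y, ← div_eq_mul_inv, div_div, div_le_div_iff₀ hD
    (by positivity)]
  rw [Real.norm_eq_abs] at h1
  calc _ ≤ |y| ^ (α - 1) * (c * (1 + |y|) ^ (α + 1)) := by gcongr
    _ = c * (|y| ^ (α - 1) * (1 + |y|) ^ (α + 1)) := by ring
    _ ≤ c * (2 ^ (α + 1) * (1 + (|y| ^ α) ^ 2)) := by gcongr
    _ = 2 ^ (α + 1) * (c * (1 + (|y| ^ α) ^ 2)) := by ring
    _ ≤ _ := by gcongr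

lemma mittagLeffler_eq_integral_X {α : ℝ} (hα : α ∈ Ioo 1 2) (k : ℝ) :
    mittagLeffler α 1 (-|k| ^ α) = 2 * ∫ y in Ioi (0 : ℝ), X α y * Real.cos (y * k) :=
  cosine_inversion (f := fun k => mittagLeffler α 1 (-|k| ^ α)) (by simp)
    (integrable_mittagLeffler_abs_rpow hα one_pos) (continuous_mittagLeffler_abs_rpow hα.1 one_pos)
    (X_neg α) (integrable_X hα) (X_eq_integral_cos hα) k

/-! ### The function `Y` -/

lemma Y_eq_integral_X {α : ℝ} (hα : α ≠ 2) (y : ℝ) : Y α y = ∫ z in Ioi |y|, X α z / z := by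
  rw [Y, if_neg hα, ← integral_const_mul]
  refine setIntegral_congr_fun measurableSet_Ioi fun z (hz : |y| < z) => ?_
  have hz0 : 0 < z := (abs_nonneg y).trans_lt hz
  simp only [X, abs_of_pos hz0]
  rw [show α - 2 = α - 1 - 1 by ring, Real.rpow_sub_one hz0.ne' (α - 1)]
  ring

/-- Near `0` the quotient is of size `z^(α-2)`, integrable because `α > 1`; beyond `1` it is
dominated by `X`. -/
lemma integrableOn_X_div {α : ℝ} (hα : α ∈ Ioo 1 2) :
    IntegrableOn (fun z => X α z / z) (Ioi 0) := by
  have hm : Measurable fun z => X α z / z := (continuous_X hα).measurable.div measurable_id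
  rw [← Ioc_union_Ioi_eq_Ioi zero_le_one, integrableOn_union]
  constructor
  · have hπ := Real.pi_pos
    obtain ⟨-, hd0⟩ := X_denom_pos hα 0
    have h1 : IntegrableOn (fun z : ℝ => z ^ (α - 2)) (Ioc 0 1) :=
      (intervalIntegrable_iff_integrableOn_Ioc_of_le zero_le_one).1
        (intervalIntegral.intervalIntegrable_rpow' (by linarith [hα.1]))
    refine (h1.const_mul (1 / Real.pi * (1 / (1 - |Real.cos (α * Real.pi / 2)|)))).mono'
      hm.aestronglyMeasurable
      ((ae_restrict_iff' measurableSet_Ioc).2 (ae_of_all _ fun z hz => ?_))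
    have hz0 := hz.1
    obtain ⟨hd, -⟩ := X_denom_pos hα (z ^ α)
    have hD : 0 < 1 + 2 * z ^ α * Real.cos (α * Real.pi / 2) + (z ^ α) ^ 2 :=
      lt_of_lt_of_le (by positivity) hd
    have hX : X α z / z = 1 / Real.pi * (Real.sin (α * Real.pi / 2) * (1 /
        (1 + 2 * z ^ α * Real.cos (α * Real.pi / 2) + (z ^ α) ^ 2))) * z ^ (α - 2) := by
      rw [X, abs_of_pos hz0, show (2 : ℝ) * α = α * (2 : ℕ) by push_cast; ring,
        Real.rpow_mul_natCast hz0.le, show α - 2 = α - 1 - 1 by ring, Real.rpow_sub_one hz0.ne' (α - 1)]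
      ring
    rw [hX, norm_mul, norm_mul, norm_mul, Real.norm_of_nonneg (by positivity : 0 ≤ 1 / Real.pi),
      Real.norm_of_nonneg (Real.rpow_nonneg hz0.le _), Real.norm_of_nonneg (one_div_pos.2 hD).le]
    refine mul_le_mul_of_nonneg_right (mul_le_mul_of_nonneg_left ?_ (by positivity)) (by positivity)
    calc ‖Real.sin (α * Real.pi / 2)‖ * (1 / _) ≤ 1 * (1 /
          (1 + 2 * z ^ α * Real.cos (α * Real.pi / 2) + (z ^ α) ^ 2)) :=
          mul_le_mul_of_nonneg_right (Real.abs_sin_le_one _) (one_div_pos.2 hD).le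
      _ ≤ _ := by
          rw [one_mul]
          refine one_div_le_one_div_of_le hd0 (le_trans ?_ hd)
          exact le_mul_of_one_le_right hd0.le (by linarith [sq_nonneg (z ^ α)])
  · refine (integrable_X hα).norm.integrableOn.mono' hm.aestronglyMeasurable
      ((ae_restrict_iff' measurableSet_Ioi).2 (ae_of_all _ fun z (hz : 1 < z) => ?_))
    rw [norm_div]
    exact div_le_self (norm_nonneg _) (hz.le.trans (le_abs_self z))

lemma continuous_Y {α : ℝ} (hα : α ∈ Ioo 1 2) : Continuous (Y α) := by
  have h := (integrableOn_X_div hα).continuousOn_Ici_primitive_Ioi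
  have h2 : Y α = (fun b => ∫ z in Ioi b, X α z / z) ∘ fun y => |y| :=
    funext fun y => Y_eq_integral_X hα.2.ne y
  rw [h2]
  exact h.comp_continuous continuous_abs fun y => abs_nonneg y

/-- The rescaled form of the rule that integrating the kernel with second parameter `1` gives the
one with parameter `2`. -/
lemma integral_mittagLeffler_one {α : ℝ} (hα : 1 < α) (k : ℝ) :
    ∫ v in (0 : ℝ)..1, mittagLeffler α 1 (-|v * k| ^ α) = mittagLeffler α 2 (-|k| ^ α) := by
  have hα0 : α ≠ 0 := by linarith
  rcases eq_or_ne k 0 with rfl | hk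
  · simp [Real.zero_rpow hα0, mittagLeffler_zero_right]
  have hk0 : 0 < |k| := abs_pos.2 hk
  have h1 : ∫ v in (0 : ℝ)..1, mittagLeffler α 1 (-|v * k| ^ α) =
      ∫ v in (0 : ℝ)..1, mlKernel α 1 1 (|k| * v) := by
    refine intervalIntegral.integral_congr fun v hv => ?_
    rw [uIcc_of_le zero_le_one] at hv
    rw [mlKernel_one, abs_mul, abs_of_nonneg hv.1, neg_one_mul, mul_comm v]
  have h2 := intervalIntegral.mul_integral_comp_mul_left (f := mlKernel α 1 1) |k| (a := 0) (b := 1)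
  rw [mul_zero, mul_one, integral_mlKernel hα one_pos 1 hk0, one_add_one_eq_two, mlKernel_two,
    mul_right_inj' hk0.ne', neg_one_mul] at h2
  rw [h1, h2]

/-- Integrated in `y` first, the section `0 < y < z` has length `z`, which cancels the division and
leaves `|X|`. -/
lemma integrable_Y_kernel {α : ℝ} (hα : α ∈ Ioo 1 2) :
    Integrable (fun p : ℝ × ℝ => if p.1 < p.2 then X α p.2 / p.2 else 0)
      ((volume.restrict (Ioi 0)).prod (volume.restrict (Ioi 0))) := by
  have hm : Measurable (fun p : ℝ × ℝ => if p.1 < p.2 then X α p.2 / p.2 else 0) :=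
    Measurable.ite (measurableSet_lt measurable_fst measurable_snd)
      (((continuous_X hα).measurable.comp measurable_snd).div measurable_snd) measurable_const
  have hkey : ∀ z, (fun y => if y < z then X α z / z else 0) = (Iio z).indicator fun _ => X α z / z := by
    intro z; funext y; simp [indicator]
  have hset : ∀ z : ℝ, Iio z ∩ Ioi 0 = Ioo 0 z := fun z => by ext; simp [and_comm]
  refine (integrable_prod_iff' hm.aestronglyMeasurable).2 ⟨ae_of_all _ fun z => ?_, ?_⟩
  · simp only
    rw [hkey]
    refine (integrable_indicator_iff measurableSet_Iio).2 ?_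
    rw [IntegrableOn, Measure.restrict_restrict measurableSet_Iio, hset]
    exact integrableOn_const (by simp)
  · refine IntegrableOn.congr_fun (s := Ioi 0) (integrable_X hα).norm.integrableOn
      (fun z (hz : 0 < z) => ?_) measurableSet_Ioi
    have h1 : ∀ y, ‖if y < z then X α z / z else 0‖ = (Iio z).indicator (fun _ => ‖X α z / z‖) y :=
      fun y => by simp only [indicator, mem_Iio]; split_ifs <;> simp
    simp only [h1]
    rw [integral_indicator measurableSet_Iio, Measure.restrict_restrict measurableSet_Iio, hset,
      setIntegral_const, Real.volume_real_Ioo_of_le hz.le, norm_div, Real.norm_of_nonneg hz.le, sub_zero,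
      smul_eq_mul]
    field_simp

lemma integral_Y_kernel {α : ℝ} (hα : α ∈ Ioo 1 2) {y : ℝ} (hy : 0 < y) :
    ∫ z in Ioi (0 : ℝ), (if y < z then X α z / z else 0) = Y α y := by
  have h1 : ∀ z, (if y < z then X α z / z else 0) = (Ioi y).indicator (fun z => X α z / z) z :=
    fun z => by simp [indicator]
  simp_rw [h1]
  rw [integral_indicator measurableSet_Ioi, Measure.restrict_restrict measurableSet_Ioi,
    Y_eq_integral_X hα.2.ne, abs_of_pos hy, Ioi_inter_Ioi, sup_of_le_left hy.le]

lemma Y_two_apply {y : ℝ} (hy : 0 < y) :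
    Y 2 y = (Iio (1 : ℝ)).indicator (fun _ => (1 / 2 : ℝ)) y := by
  simp [Y, indicator, abs_of_pos hy]

lemma integrable_Y {α : ℝ} (hα : α ∈ Ioc 1 2) : Integrable (Y α) := by
  suffices h : IntegrableOn (fun y => (Y α y : ℂ)) (Ioi 0) by
    have := (integrable_of_even (by simp [Y_neg]) h).re
    simpa using this
  refine Integrable.ofReal ?_
  rcases hα.2.eq_or_lt with rfl | hα2
  · refine IntegrableOn.congr_fun (s := Ioi 0) (f := (Iio (1 : ℝ)).indicator (fun _ => (1 / 2 : ℝ))) ?_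
      (fun y hy => (Y_two_apply hy).symm) measurableSet_Ioi
    rw [integrableOn_indicator_iff measurableSet_Iio, Iio_inter_Ioi]
    exact integrableOn_const (by simp)
  · exact IntegrableOn.congr_fun (s := Ioi 0) (integrable_Y_kernel ⟨hα.1, hα2⟩).integral_prod_left
      (fun y hy => integral_Y_kernel ⟨hα.1, hα2⟩ hy) measurableSet_Ioi

/-- The cosine transform of `Y` is a Mittag-Leffler function. -/
theorem mittagLeffler_eq_integral_Y {α : ℝ} (hα : α ∈ Ioc 1 2) (k : ℝ) :
    mittagLeffler α 2 (-|k| ^ α) = 2 * ∫ y in Ioi (0 : ℝ), Y α y * Real.cos (y * k) := by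
  rw [← integral_mittagLeffler_one hα.1]
  rcases hα.2.eq_or_lt with rfl | hα2
  · have h1 : ∫ y in Ioi (0 : ℝ), Y 2 y * Real.cos (y * k) =
        ∫ y in Ioi (0 : ℝ), (Iio (1 : ℝ)).indicator (fun y => 1 / 2 * Real.cos (y * k)) y := by
      refine setIntegral_congr_fun measurableSet_Ioi fun y (hy : 0 < y) => ?_
      rw [Y_two_apply hy]
      simp only [indicator]
      split_ifs <;> simp
    rw [h1, integral_indicator measurableSet_Iio, Measure.restrict_restrict measurableSet_Iio,
      Iio_inter_Ioi, ← integral_Ioc_eq_integral_Ioo, ← intervalIntegral.integral_of_le zero_le_one,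
      ← intervalIntegral.integral_const_mul]
    refine intervalIntegral.integral_congr fun v _ => ?_
    rw [Real.rpow_two, sq_abs, mittagLeffler_two_one]
    ring
  have hα' : α ∈ Ioo 1 2 := ⟨hα.1, hα2⟩
  have hi1 : Integrable (fun p : ℝ × ℝ => (if p.1 < p.2 then X α p.2 / p.2 else 0) * Real.cos (p.1 * k))
      ((volume.restrict (Ioi 0)).prod (volume.restrict (Ioi 0))) :=
    (integrable_Y_kernel hα').mul_bdd (c := 1) (by fun_prop :
      Continuous fun p : ℝ × ℝ => Real.cos (p.1 * k)).aestronglyMeasurable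
      (ae_of_all _ fun p => Real.abs_cos_le_one _)
  have h1 : ∫ y in Ioi (0 : ℝ), Y α y * Real.cos (y * k) =
      ∫ y in Ioi (0 : ℝ), ∫ z in Ioi (0 : ℝ), (if y < z then X α z / z else 0) * Real.cos (y * k) := by
    refine setIntegral_congr_fun measurableSet_Ioi fun y (hy : 0 < y) => ?_
    rw [integral_mul_const, integral_Y_kernel hα' hy]
  rw [h1, integral_integral_swap (f := fun y z => (if y < z then X α z / z else 0) * Real.cos (y * k)) hi1]
  -- The substitution `y = zv` removes the factor `1 / z` and leaves the cosine transform of `X` at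
  -- `vk`, to be averaged over `v ∈ (0, 1]`.
  have h2 : ∫ z in Ioi (0 : ℝ), ∫ y in Ioi (0 : ℝ), (if y < z then X α z / z else 0) * Real.cos (y * k) =
      ∫ z in Ioi (0 : ℝ), ∫ v in Ioc (0 : ℝ) 1, X α z * Real.cos (z * (v * k)) := by
    refine setIntegral_congr_fun measurableSet_Ioi fun z (hz : 0 < z) => ?_
    have h3 : ∀ y, (if y < z then X α z / z else 0) * Real.cos (y * k) =
        (Iio z).indicator (fun y => X α z / z * Real.cos (y * k)) y := fun y => by
      simp only [indicator, mem_Iio]; split_ifs <;> simp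
    simp_rw [h3]
    rw [integral_indicator measurableSet_Iio, Measure.restrict_restrict measurableSet_Iio,
      Iio_inter_Ioi, ← integral_Ioc_eq_integral_Ioo, ← intervalIntegral.integral_of_le hz.le,
      ← intervalIntegral.integral_of_le zero_le_one, intervalIntegral.integral_const_mul,
      intervalIntegral.integral_const_mul]
    have h4 := intervalIntegral.mul_integral_comp_mul_left (f := fun y => Real.cos (y * k)) z (a := 0) (b := 1)
    rw [mul_zero, mul_one] at h4
    rw [← h4, ← mul_assoc, div_mul_cancel₀ _ hz.ne']
    simp_rw [mul_assoc]
  have hi2 : Integrable (fun p : ℝ × ℝ => X α p.1 * Real.cos (p.1 * (p.2 * k)))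
      ((volume.restrict (Ioi 0)).prod (volume.restrict (Ioc 0 1))) :=
    ((integrable_X hα').integrableOn.comp_fst _).mul_bdd (c := 1) (by fun_prop :
      Continuous fun p : ℝ × ℝ => Real.cos (p.1 * (p.2 * k))).aestronglyMeasurable
      (ae_of_all _ fun p => Real.abs_cos_le_one _)
  rw [h2, integral_integral_swap (f := fun z v => X α z * Real.cos (z * (v * k))) hi2,
    intervalIntegral.integral_of_le zero_le_one, ← integral_const_mul]
  refine integral_congr_ae (ae_of_all _ fun v => ?_)
  exact mittagLeffler_eq_integral_X hα' (v * k)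

lemma ofReal_eq_fourier_of_cosine {f g : ℝ → ℝ} (hf : ∀ x, f (-x) = f x) (hi : Integrable f)
    {y : ℝ} (h : g y = 1 / Real.pi * ∫ k in Ioi (0 : ℝ), f k * Real.cos (k * y)) :
    (g y : ℂ) = 1 / (2 * Real.pi) * ∫ k : ℝ, Complex.exp (Complex.I * k * y) * (f k : ℂ) := by
  rw [integral_cexp_mul_even hf hi, h]
  generalize ∫ k in Ioi (0 : ℝ), f k * Real.cos (k * y) = I
  have : (Real.pi : ℂ) ≠ 0 := Complex.ofReal_ne_zero.2 Real.pi_ne_zero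
  push_cast
  field_simp

theorem X_eq_fourier {α : ℝ} (hα : α ∈ Ioo 1 2) (y : ℝ) :
    (X α y : ℂ) = 1 / (2 * Real.pi) *
      ∫ k : ℝ, Complex.exp (Complex.I * k * y) * (mittagLeffler α 1 (-|k| ^ α) : ℂ) :=
  ofReal_eq_fourier_of_cosine (by simp) (integrable_mittagLeffler_abs_rpow hα one_pos)
    (X_eq_integral_cos hα y)

/-- Inversion runs in the opposite direction from `X`: the transform of `Y` is known from
`mittagLeffler_eq_integral_Y`, and its integrability allows `Y` to be recovered. -/
theorem Y_eq_fourier {α : ℝ} (hα : α ∈ Ioo 1 2) (y : ℝ) :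
    (Y α y : ℂ) = 1 / (2 * Real.pi) *
      ∫ k : ℝ, Complex.exp (Complex.I * k * y) * (mittagLeffler α 2 (-|k| ^ α) : ℂ) := by
  have hi := integrable_mittagLeffler_abs_rpow hα two_pos
  refine ofReal_eq_fourier_of_cosine (by simp) hi ?_
  rw [cosine_inversion (g := fun k => 1 / (2 * Real.pi) * mittagLeffler α 2 (-|k| ^ α)) (Y_neg α)
    (integrable_Y ⟨hα.1, hα.2.le⟩) (continuous_Y hα) (by simp) (hi.const_mul _) (fun k => ?_) y]
  · simp_rw [mul_assoc]
    rw [integral_const_mul]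
    ring
  · rw [mittagLeffler_eq_integral_Y ⟨hα.1, hα.2.le⟩]
    ring

/-! ### The symbol -/

theorem angularF_eq (ρ α : ℝ) (μ : Measure S2) (k : E3) :
    angularF ρ α μ k = (∫ y : S2, |⟪k, (y : E3)⟫| ^ α ∂μ) / ρ := by
  simp [angularF, symbolQ]

theorem continuous_angularF (ρ : ℝ) {α : ℝ} (hα : 0 ≤ α) (μ : Measure S2) [IsFiniteMeasure μ] :
    Continuous (angularF ρ α μ) := by
  have h : Continuous fun k : E3 => ∫ y : S2, |⟪k, (y : E3)⟫| ^ α ∂μ := by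
    have := continuous_parametric_integral_of_continuous (μ := μ) (s := univ)
      (f := fun (k : E3) (y : S2) => |⟪k, (y : E3)⟫| ^ α) (by
        refine Continuous.rpow_const ?_ fun _ => Or.inr hα
        fun_prop) isCompact_univ
    simpa using this
  rw [funext (angularF_eq ρ α μ)]
  exact h.div_const ρ

theorem angularF_nonneg {ρ : ℝ} (hρ : 0 < ρ) (α : ℝ) (μ : Measure S2) (k : E3) :
    0 ≤ angularF ρ α μ k := by
  rw [angularF_eq]
  exact div_nonneg (integral_nonneg fun y => by positivity) hρ.le

theorem angularF_smul (ρ α : ℝ) (μ : Measure S2) (c : ℝ) (k : E3) :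
    angularF ρ α μ (c • k) = |c| ^ α * angularF ρ α μ k := by
  rw [angularF_eq, angularF_eq, ← mul_div_assoc, ← integral_const_mul]
  simp_rw [inner_smul_left, abs_mul, RCLike.conj_to_real,
    Real.mul_rpow (abs_nonneg _) (abs_nonneg _)]

theorem symbolQ_eq {ρ : ℝ} (hρ : 0 < ρ) (α : ℝ) (μ : Measure S2) (k : E3) :
    symbolQ α μ k = -(ρ * angularF ρ α μ k) := by
  rw [angularF]; field_simp

/-! ### Tempered distributions whose Fourier transforms are functions -/

theorem two_pi_ne_zero' : (2 * Real.pi : ℝ) ≠ 0 := by positivity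

theorem ae_two_pi_smul {p : E3 → Prop} (h : ∀ᵐ k : E3, p k) :
    ∀ᵐ k : E3, p ((2 * Real.pi) • k) :=
  (Measure.quasiMeasurePreserving_smul (volume : Measure E3) two_pi_ne_zero').ae h

theorem ae_of_ae_two_pi_smul {p : E3 → Prop} (h : ∀ᵐ k : E3, p ((2 * Real.pi) • k)) :
    ∀ᵐ k : E3, p k := by
  have := (Measure.quasiMeasurePreserving_smul (volume : Measure E3)
    (inv_ne_zero two_pi_ne_zero')).ae h
  filter_upwards [this] with k hk
  rwa [smul_smul, mul_inv_cancel₀ two_pi_ne_zero', one_smul] at hk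

theorem HasFourierFunction.congr {T : 𝓢'(E3, ℂ)} {g g' : E3 → ℂ} (h : HasFourierFunction T g)
    (hg : g =ᵐ[volume] g') : HasFourierFunction T g' := by
  intro φ
  have hae : (fun k : E3 => g ((2 * Real.pi) • k) * φ k) =ᵐ[volume]
      fun k : E3 => g' ((2 * Real.pi) • k) * φ k := by
    filter_upwards [ae_two_pi_smul hg] with k hk
    rw [hk]
  exact ⟨(h φ).1.congr hae, (h φ).2.trans (integral_congr_ae hae)⟩

theorem HasFourierFunction.apply_eq {T : 𝓢'(E3, ℂ)} {g : E3 → ℂ} (h : HasFourierFunction T g)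
    (φ : 𝓢(E3, ℂ)) : T φ = ∫ k : E3, g ((2 * Real.pi) • k) * (𝓕⁻ φ) k := by
  rw [← (h (𝓕⁻ φ)).2, TemperedDistribution.fourier_apply, FourierTransform.fourier_fourierInv_eq]

theorem HasFourierFunction.ext {T T' : 𝓢'(E3, ℂ)} {g : E3 → ℂ} (h : HasFourierFunction T g)
    (h' : HasFourierFunction T' g) : T = T' := by
  ext φ
  rw [h.apply_eq, h'.apply_eq]

/-- Test with a smooth bump that equals `1` on the given compact set. -/
theorem locallyIntegrable_of_integrable_mul_schwartz {h : E3 → ℂ}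
    (hh : ∀ φ : 𝓢(E3, ℂ), Integrable fun k => h k * φ k) : LocallyIntegrable h := by
  rw [locallyIntegrable_iff]
  intro K hK
  obtain ⟨R, hR, hKR⟩ := hK.isBounded.subset_closedBall_lt 0 (0 : E3)
  let b : ContDiffBump (0 : E3) := ⟨R, R + 1, hR, by linarith⟩
  have hc : HasCompactSupport (Complex.ofRealCLM ∘ b) := b.hasCompactSupport.comp_left rfl
  have hs : ContDiff ℝ (⊤ : ℕ∞) (Complex.ofRealCLM ∘ b) :=
    Complex.ofRealCLM.contDiff.comp b.contDiff
  refine (hh (hc.toSchwartzMap hs)).integrableOn.congr_fun (s := K) (fun k hk => ?_)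
    hK.measurableSet
  have : b k = 1 := b.one_of_mem_closedBall (hKR hk)
  simp [this]

/-- The difference integrates to zero against every smooth compactly supported function, so the
fundamental lemma of the calculus of variations applies. -/
theorem HasFourierFunction.ae_eq {T : 𝓢'(E3, ℂ)} {g g' : E3 → ℂ} (h : HasFourierFunction T g)
    (h' : HasFourierFunction T g') : g =ᵐ[volume] g' := by
  refine ae_of_ae_two_pi_smul ?_
  set d : E3 → ℂ := fun k => g ((2 * Real.pi) • k) - g' ((2 * Real.pi) • k) with hd
  have hint : ∀ φ : 𝓢(E3, ℂ), Integrable fun k => d k * φ k := fun φ =>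
    ((h φ).1.sub (h' φ).1).congr (.of_forall fun k => by simp [hd, sub_mul])
  have hzero : ∀ φ : 𝓢(E3, ℂ), ∫ k, d k * φ k = 0 := fun φ => by
    simp only [hd, sub_mul]
    rw [integral_sub (h φ).1 (h' φ).1, ← (h φ).2, ← (h' φ).2, sub_self]
  have := ae_eq_zero_of_integral_contDiff_smul_eq_zero
    (locallyIntegrable_of_integrable_mul_schwartz hint) (fun f hf hfc => by
      have hc : HasCompactSupport (Complex.ofRealCLM ∘ f) := hfc.comp_left rfl
      have hs : ContDiff ℝ (⊤ : ℕ∞) (Complex.ofRealCLM ∘ f) := Complex.ofRealCLM.contDiff.comp hf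
      rw [← hzero (hc.toSchwartzMap hs)]
      refine integral_congr_ae (.of_forall fun k => ?_)
      simp [mul_comm])
  filter_upwards [this] with k hk
  exact sub_eq_zero.mp hk

theorem exists_hasFourierFunction {g : E3 → ℂ} (hg : Continuous g) {C : ℝ}
    (hC : ∀ k, ‖g k‖ ≤ C) : ∃ T, HasFourierFunction T g := by
  have hg' : Continuous fun k : E3 => g ((2 * Real.pi) • k) := by fun_prop
  have hL : MemLp (fun k : E3 => g ((2 * Real.pi) • k)) ⊤ volume :=
    memLp_top_of_bound hg'.aestronglyMeasurable C (.of_forall fun k => hC _)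
  refine ⟨𝓕⁻ (Lp.toTemperedDistribution (hL.toLp _) : 𝓢'(E3, ℂ)), fun φ => ⟨?_, ?_⟩⟩
  · exact φ.integrable.bdd_mul (c := C) hg'.aestronglyMeasurable (.of_forall fun k => hC _)
  · rw [FourierTransform.fourier_fourierInv_eq, Lp.toTemperedDistribution_apply]
    refine integral_congr_ae ?_
    filter_upwards [hL.coeFn_toLp] with k hk
    rw [hk, smul_eq_mul, mul_comm]

theorem hasFourierFunction_delta :
    HasFourierFunction (TemperedDistribution.delta (0 : E3)) fun _ => 1 := by
  intro φ
  refine ⟨by simpa using φ.integrable, ?_⟩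
  rw [TemperedDistribution.fourier_delta_zero]
  simp

theorem hasFourierFunction_zero : HasFourierFunction 0 fun _ => 0 := by
  intro φ
  simp

/-! ### The Cauchy problem in Fourier space -/

section Cauchy

variable {ρ α b : ℝ} {μ : Measure S2} {u₀ v₀ : 𝓢'(E3, ℂ)} {c₀ c₁ : ℂ} {w : ℝ → ℝ → ℂ}

/-- The Fourier functions of the initial data are determined almost everywhere, so for almost every
`k` the scalar problem has the constants `c₀`, `c₁` as data, and its uniqueness fixes the transform
at all times. -/
theorem IsCauchySolution.hasFourierFunction {u : ℝ≥0 → 𝓢'(E3, ℂ)} (hρ : 0 < ρ) (hb : b ∈ Ioc 1 2)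
    (hu₀ : HasFourierFunction u₀ fun _ => c₀) (hv₀ : HasFourierFunction v₀ fun _ => c₁)
    (hw : ∀ l, IsOdeSolution b l c₀ c₁ (w l)) (hu : IsCauchySolution ρ α b μ u₀ v₀ u) (t : ℝ≥0) :
    HasFourierFunction (u t) fun k => w (angularF ρ α μ k) t := by
  obtain ⟨U, U₀, V₀, hU₀, hV₀, hU, hode⟩ := hu
  refine (hU t).congr ?_
  filter_upwards [hode, hU₀.ae_eq hu₀, hV₀.ae_eq hv₀] with k ⟨h1, h2, h3, h4⟩ h5 h6
  refine IsOdeSolution.unique hb (f := fun s => U s k) ⟨h1, h2.trans h5, h3.trans h6, fun s hs => ?_⟩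
    (hw _) t.2
  have := h4 s hs
  rw [symbolQ_eq hρ] at this
  have hρ' : (ρ : ℂ) ≠ 0 := by exact_mod_cast hρ.ne'
  refine mul_left_cancel₀ hρ' (this.trans ?_)
  push_cast
  ring

theorem exists_isCauchySolution (hρ : 0 < ρ)
    (hu₀ : HasFourierFunction u₀ fun _ => c₀) (hv₀ : HasFourierFunction v₀ fun _ => c₁)
    (hw : ∀ l, IsOdeSolution b l c₀ c₁ (w l))
    (hcont : ∀ t : ℝ≥0, Continuous fun k => w (angularF ρ α μ k) t)
    (hbdd : ∀ t : ℝ≥0, ∃ C, ∀ k, ‖w (angularF ρ α μ k) t‖ ≤ C) :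
    ∃ u, IsCauchySolution ρ α b μ u₀ v₀ u := by
  have : ∀ t : ℝ≥0, ∃ T, HasFourierFunction T fun k => w (angularF ρ α μ k) t := fun t => by
    obtain ⟨C, hC⟩ := hbdd t
    exact exists_hasFourierFunction (hcont t) hC
  choose u hu using this
  refine ⟨u, fun t k => w (angularF ρ α μ k) t, _, _, hu₀, hv₀, hu, .of_forall fun k => ?_⟩
  refine ⟨(hw _).regular, (hw _).init, (hw _).deriv_init, fun t ht => ?_⟩
  rw [(hw _).eqn t ht, symbolQ_eq hρ]
  push_cast
  ring

theorem existsUnique_isCauchySolution (hρ : 0 < ρ) (hb : b ∈ Ioc 1 2)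
    (hu₀ : HasFourierFunction u₀ fun _ => c₀) (hv₀ : HasFourierFunction v₀ fun _ => c₁)
    (hw : ∀ l, IsOdeSolution b l c₀ c₁ (w l))
    (hcont : ∀ t : ℝ≥0, Continuous fun k => w (angularF ρ α μ k) t)
    (hbdd : ∀ t : ℝ≥0, ∃ C, ∀ k, ‖w (angularF ρ α μ k) t‖ ≤ C) :
    ∃! u, IsCauchySolution ρ α b μ u₀ v₀ u := by
  obtain ⟨u, hu⟩ := exists_isCauchySolution hρ hu₀ hv₀ hw hcont hbdd
  refine ⟨u, hu, fun u' hu' => funext fun t => ?_⟩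
  exact (hu'.hasFourierFunction hρ hb hu₀ hv₀ hw t).ext (hu.hasFourierFunction hρ hb hu₀ hv₀ hw t)

end Cauchy

section Fundamental

variable {ρ α b : ℝ} {μ : Measure S2}

theorem IsFirstFundamental.hasFourierFunction {G : ℝ≥0 → 𝓢'(E3, ℂ)} (hρ : 0 < ρ)
    (hb : b ∈ Ioc 1 2) (hG : IsFirstFundamental ρ α b μ G) (t : ℝ≥0) :
    HasFourierFunction (G t) fun k =>
      (mittagLeffler b 1 (-(angularF ρ α μ k * (t : ℝ) ^ b)) : ℂ) := by
  have := IsCauchySolution.hasFourierFunction hρ hb hasFourierFunction_delta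
    hasFourierFunction_zero (isOdeSolution_first hb) hG t
  simpa only [mlKernel_one, neg_mul] using this

theorem IsSecondFundamental.hasFourierFunction {H : ℝ≥0 → 𝓢'(E3, ℂ)} (hρ : 0 < ρ)
    (hb : b ∈ Ioc 1 2) (hH : IsSecondFundamental ρ α b μ H) (t : ℝ≥0) :
    HasFourierFunction (H t) fun k =>
      (((t : ℝ) * mittagLeffler b 2 (-(angularF ρ α μ k * (t : ℝ) ^ b)) : ℝ) : ℂ) := by
  have := IsCauchySolution.hasFourierFunction hρ hb hasFourierFunction_zero
    hasFourierFunction_delta (isOdeSolution_second hb) hH t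
  simpa only [mlKernel_two, neg_mul] using this

theorem existsUnique_isFirstFundamental (hρ : 0 < ρ) (hα : 0 ≤ α) (hb : b ∈ Ioc 1 2)
    [IsFiniteMeasure μ] : ∃! G, IsFirstFundamental ρ α b μ G := by
  refine existsUnique_isCauchySolution hρ hb hasFourierFunction_delta
    hasFourierFunction_zero (isOdeSolution_first hb) (fun t => ?_) fun t => ?_
  · simp only [mlKernel_one]
    have h1 := continuous_mittagLeffler hb.1 one_pos
    have h2 := continuous_angularF ρ hα μ
    fun_prop
  · obtain ⟨C, -, hC⟩ := exists_abs_mittagLeffler_le_of_mem_Ioc hb (Or.inl rfl)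
    refine ⟨C, fun k => ?_⟩
    have ht : (0 : ℝ) ≤ t := t.2
    rw [mlKernel_one, Complex.norm_real, Real.norm_eq_abs, neg_mul]
    exact hC _ (mul_nonneg (angularF_nonneg hρ _ _ _) (by positivity))

theorem existsUnique_isSecondFundamental (hρ : 0 < ρ) (hα : 0 ≤ α) (hb : b ∈ Ioc 1 2)
    [IsFiniteMeasure μ] : ∃! H, IsSecondFundamental ρ α b μ H := by
  refine existsUnique_isCauchySolution hρ hb hasFourierFunction_zero
    hasFourierFunction_delta (isOdeSolution_second hb) (fun t => ?_) fun t => ?_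
  · simp only [mlKernel_two]
    have h1 := continuous_mittagLeffler hb.1 two_pos
    have h2 := continuous_angularF ρ hα μ
    fun_prop
  · obtain ⟨C, -, hC⟩ := exists_abs_mittagLeffler_le_of_mem_Ioc hb (Or.inr rfl)
    refine ⟨t * C, fun k => ?_⟩
    have ht : (0 : ℝ) ≤ t := t.2
    rw [mlKernel_two, Complex.norm_real, Real.norm_eq_abs, neg_mul, abs_mul, abs_of_nonneg ht]
    exact mul_le_mul_of_nonneg_left
      (hC _ (mul_nonneg (angularF_nonneg hρ _ _ _) (by positivity))) ht

end Fundamental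

/-! ### Dilations and subordination -/

theorem fourierInv_comp_smul {c : ℝ} (hc : 0 < c) (φ φ' : 𝓢(E3, ℂ)) (h : ∀ x, φ' x = φ (c • x))
    (k : E3) : ((c ^ 3 : ℝ) : ℂ) * (𝓕⁻ φ') (c • k) = (𝓕⁻ φ) k := by
  rw [SchwartzMap.fourierInv_coe, SchwartzMap.fourierInv_coe, Real.fourierInv_eq',
    Real.fourierInv_eq']
  set f : E3 → ℂ := fun v => Complex.exp (↑(2 * Real.pi * ⟪v, k⟫) * Complex.I) • φ v with hf
  have key : (∫ v : E3, Complex.exp (↑(2 * Real.pi * ⟪v, c • k⟫) * Complex.I) • φ' v) =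
      ∫ v : E3, f (c • v) := by
    refine integral_congr_ae (.of_forall fun v => ?_)
    simp only [hf, h, inner_smul_left, inner_smul_right, RCLike.conj_to_real]
  rw [key, Measure.integral_comp_smul (volume : Measure E3) f c]
  have h3 : Module.finrank ℝ E3 = 3 := by simp
  rw [h3, abs_of_pos (by positivity), Complex.real_smul, ← mul_assoc, ← Complex.ofReal_mul,
    mul_inv_cancel₀ (by positivity), Complex.ofReal_one, one_mul]

/-- Stretching space by `c` replaces the transform `g(k)` by `c³ g(ck)`. -/
theorem HasFourierFunction.dilate_apply {T : 𝓢'(E3, ℂ)} {g : E3 → ℂ} (hT : HasFourierFunction T g)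
    {c : ℝ} (hc : 0 < c) (φ : 𝓢(E3, ℂ)) :
    dilate c T φ = ((c ^ 3 : ℝ) : ℂ) * ∫ k : E3, g (c • (2 * Real.pi) • k) * (𝓕⁻ φ) k := by
  have h3 : Module.finrank ℝ E3 = 3 := by simp
  set φ' : 𝓢(E3, ℂ) := SchwartzMap.compCLMOfContinuousLinearEquiv ℂ
    (ContinuousLinearEquiv.smulLeft (R₁ := ℝ) (M₁ := E3) (Units.mk0 c hc.ne')) φ with hφ'
  have hφ : ∀ x, φ' x = φ (c • x) := fun x => rfl
  have : dilate c T φ = ((c ^ 3 : ℝ) : ℂ) * T φ' := by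
    rw [dilate, dif_pos hc.ne', abs_of_pos hc]
    rfl
  rw [this, hT.apply_eq, ← integral_const_mul]
  have hsub := Measure.integral_comp_smul (volume : Measure E3)
    (fun k : E3 => ((c ^ 3 : ℝ) : ℂ) * (g ((2 * Real.pi) • k) * (𝓕⁻ φ') k)) c
  rw [h3, abs_of_pos (by positivity)] at hsub
  have hc3 : (c ^ 3 : ℝ) ≠ 0 := by positivity
  rw [← inv_smul_eq_iff₀ (inv_ne_zero hc3), inv_inv] at hsub
  rw [← hsub, Complex.real_smul]
  congr 1
  refine integral_congr_ae (.of_forall fun k => ?_)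
  simp only
  rw [← fourierInv_comp_smul hc φ φ' hφ k, smul_comm (2 * Real.pi) c k]
  ring

/-- Fubini's theorem applies because `E_{a,1}` is bounded on the negative half-line while the Wright
weight and `ψ` are integrable. -/
theorem subordination {γ a m : ℝ} (hγ : γ ∈ Ioo 0 1) (ha : 1 < γ * a) (ha2 : a ≤ 2)
    {Λ : E3 → ℝ} (hΛ : Continuous Λ) (hΛ0 : ∀ k, 0 ≤ Λ k) {ψ : E3 → ℂ} (hψ : Integrable ψ) :
    IntegrableOn (fun ξ : ℝ => (wright (-γ) (m - γ) (-ξ) : ℂ) *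
      ∫ k, (mittagLeffler a 1 (-(Λ k * ξ ^ a)) : ℂ) * ψ k) (Ioi 0) ∧
    ∫ ξ in Ioi (0 : ℝ), (wright (-γ) (m - γ) (-ξ) : ℂ) *
      ∫ k, (mittagLeffler a 1 (-(Λ k * ξ ^ a)) : ℂ) * ψ k =
      ∫ k, (mittagLeffler (γ * a) m (-Λ k) : ℂ) * ψ k := by
  have ha1 : 1 < a := by nlinarith [hγ.1, hγ.2]
  obtain ⟨C, -, hC⟩ := exists_abs_mittagLeffler_le_of_mem_Ioc ⟨ha1, ha2⟩ (Or.inl rfl)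
  have hE := continuous_mittagLeffler ha1 one_pos
  have hw : Integrable (fun ξ : ℝ => (wright (-γ) (m - γ) (-ξ) : ℂ)) (volume.restrict (Ioi 0)) :=
    (integrableOn_wright hγ (m - γ)).ofReal
  -- Writing `|ξ|` keeps the Mittag-Leffler argument nonpositive for every real `ξ`, so the bound
  -- `C` holds everywhere.
  have hprod : Integrable (Function.uncurry fun (ξ : ℝ) (k : E3) =>
      (mittagLeffler a 1 (-(Λ k * |ξ| ^ a)) : ℂ) * ((wright (-γ) (m - γ) (-ξ) : ℂ) * ψ k))
      ((volume.restrict (Ioi 0)).prod volume) := by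
    refine (hw.mul_prod hψ).bdd_mul (c := C) ?_ (.of_forall fun p => ?_)
    · refine Continuous.aestronglyMeasurable ?_
      refine Complex.continuous_ofReal.comp (hE.comp (Continuous.neg ?_))
      exact (hΛ.comp continuous_snd).mul
        ((continuous_abs.comp continuous_fst).rpow_const fun _ => Or.inr (by linarith))
    · rw [Complex.norm_real, Real.norm_eq_abs]
      exact hC _ (mul_nonneg (hΛ0 _) (by positivity))
  have hcongr : ∀ ξ ∈ Ioi (0 : ℝ), (∫ k, (mittagLeffler a 1 (-(Λ k * |ξ| ^ a)) : ℂ) *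
      ((wright (-γ) (m - γ) (-ξ) : ℂ) * ψ k)) = (wright (-γ) (m - γ) (-ξ) : ℂ) *
      ∫ k, (mittagLeffler a 1 (-(Λ k * ξ ^ a)) : ℂ) * ψ k := fun ξ hξ => by
    rw [← integral_const_mul, abs_of_pos hξ]
    refine integral_congr_ae (.of_forall fun k => ?_)
    simp only
    ring
  refine ⟨IntegrableOn.congr_fun (s := Ioi 0) hprod.integral_prod_left hcongr measurableSet_Ioi, ?_⟩
  rw [← setIntegral_congr_fun measurableSet_Ioi hcongr, integral_integral_swap hprod]
  refine integral_congr_ae (.of_forall fun k => ?_)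
  simp only
  rw [← integral_wright_mul_mittagLeffler m hγ ha (-Λ k), ← integral_complex_ofReal,
    ← integral_mul_const]
  refine setIntegral_congr_fun measurableSet_Ioi fun ξ hξ => ?_
  rw [abs_of_pos hξ, neg_mul]
  push_cast
  ring

section Subordination

variable {ρ α : ℝ} {μ : Measure S2} {G₁ : ℝ≥0 → 𝓢'(E3, ℂ)}

theorem dilate_isFirstFundamental (hρ : 0 < ρ) (hα : α ∈ Ioc 1 2)
    (hG : IsFirstFundamental ρ α α μ G₁) (s : ℝ≥0) {c : ℝ} (hc : 0 < c) (φ : 𝓢(E3, ℂ)) :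
    dilate c (G₁ s) φ = ((c ^ 3 : ℝ) : ℂ) * ∫ k : E3, (mittagLeffler α 1
      (-(angularF ρ α μ ((2 * Real.pi) • k) * (s : ℝ) ^ α * c ^ α)) : ℂ) * (𝓕⁻ φ) k := by
  rw [(hG.hasFourierFunction hρ hα s).dilate_apply hc]
  congr 1
  refine integral_congr_ae (.of_forall fun k => ?_)
  simp only
  rw [angularF_smul, abs_of_pos hc]
  congr 4
  ring

/-- Subordination of the dilates of the first fundamental solution of order `α`; the scaling
parameter is `c ξ`. -/
theorem subordination_dilate {γ m : ℝ} (hρ : 0 < ρ) (hγ : γ ∈ Ioo 0 1) (hγα : 1 < γ * α)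
    (hα : α ∈ Ioc 1 2) [IsFiniteMeasure μ] (hG : IsFirstFundamental ρ α α μ G₁) (s : ℝ≥0)
    {c : ℝ} (hc : 0 < c) (φ : 𝓢(E3, ℂ)) :
    IntegrableOn (fun ξ : ℝ => ((wright (-γ) (m - γ) (-ξ) / ξ ^ 3 : ℝ) : ℂ) *
      dilate (c * ξ) (G₁ s) φ) (Ioi 0) ∧
    ∫ ξ in Ioi (0 : ℝ), ((wright (-γ) (m - γ) (-ξ) / ξ ^ 3 : ℝ) : ℂ) *
      dilate (c * ξ) (G₁ s) φ =
      ((c ^ 3 : ℝ) : ℂ) * ∫ k, (mittagLeffler (γ * α) m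
        (-(angularF ρ α μ ((2 * Real.pi) • k) * (c * s) ^ α)) : ℂ) * (𝓕⁻ φ) k := by
  have hcont : Continuous fun k : E3 => angularF ρ α μ ((2 * Real.pi) • k) * (c * s) ^ α :=
    ((continuous_angularF ρ (by linarith [hα.1]) μ).comp (continuous_const_smul _)).mul_const _
  obtain ⟨h1, h2⟩ := subordination (m := m) hγ hγα hα.2 hcont
    (fun k => mul_nonneg (angularF_nonneg hρ _ _ _) (by positivity)) (𝓕⁻ φ).integrable
  -- The weight `ξ^(-3)` cancels the `ξ³` in the Jacobian `(cξ)³` of the dilation.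
  have hcongr : ∀ ξ ∈ Ioi (0 : ℝ), ((c ^ 3 : ℝ) : ℂ) * ((wright (-γ) (m - γ) (-ξ) : ℂ) *
      ∫ k, (mittagLeffler α 1 (-(angularF ρ α μ ((2 * Real.pi) • k) * (c * s) ^ α * ξ ^ α)) : ℂ) *
        (𝓕⁻ φ) k) =
      ((wright (-γ) (m - γ) (-ξ) / ξ ^ 3 : ℝ) : ℂ) * dilate (c * ξ) (G₁ s) φ := fun ξ hξ => by
    have hξ0 : (0 : ℝ) < ξ := hξ
    rw [dilate_isFirstFundamental hρ hα hG s (mul_pos hc hξ0)]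
    have : ∀ k : E3, angularF ρ α μ ((2 * Real.pi) • k) * (c * s) ^ α * ξ ^ α =
        angularF ρ α μ ((2 * Real.pi) • k) * (s : ℝ) ^ α * (c * ξ) ^ α := fun k => by
      rw [Real.mul_rpow hc.le s.coe_nonneg, Real.mul_rpow hc.le hξ0.le]
      ring
    simp only [this]
    have hξ' : (ξ : ℂ) ≠ 0 := by exact_mod_cast hξ0.ne'
    generalize (∫ k : E3, (mittagLeffler α 1
      (-(angularF ρ α μ ((2 * Real.pi) • k) * (s : ℝ) ^ α * (c * ξ) ^ α)) : ℂ) * (𝓕⁻ φ) k) = I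
    push_cast
    field_simp
  refine ⟨IntegrableOn.congr_fun (s := Ioi 0) (h1.const_mul _) hcongr measurableSet_Ioi, ?_⟩
  rw [← setIntegral_congr_fun measurableSet_Ioi hcongr, integral_const_mul, h2]

end Subordination

/-! ### Integrals over planes -/

section Slice

theorem norm_coe_sphere (ω : S2) : ‖(ω : E3)‖ = 1 := by simp

/-- The orthogonal splitting `E3 = ℝ ω ⊕ ω^⊥`. -/
noncomputable def sliceEquiv (ω : S2) : ℝ × (Submodule.span ℝ {(ω : E3)})ᗮ ≃ᵐ E3 :=
  ((LinearIsometryEquiv.toSpanUnitSingleton (𝕜 := ℝ) (ω : E3)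
      (norm_coe_sphere ω)).toMeasurableEquiv.prodCongr (MeasurableEquiv.refl _)).trans
    ((MeasurableEquiv.toLp 2 _).trans
      (Submodule.span ℝ {(ω : E3)}).orthogonalDecomposition.symm.toMeasurableEquiv)

theorem sliceEquiv_apply (ω : S2) (p : ℝ × (Submodule.span ℝ {(ω : E3)})ᗮ) :
    sliceEquiv ω p = p.1 • (ω : E3) + p.2 := by
  rfl

theorem measurePreserving_sliceEquiv (ω : S2) : MeasurePreserving (sliceEquiv ω) := by
  have h1 : MeasurePreserving (Prod.map (LinearIsometryEquiv.toSpanUnitSingleton (𝕜 := ℝ) (ω : E3)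
      (norm_coe_sphere ω)) (id : (Submodule.span ℝ {(ω : E3)})ᗮ → _)) volume volume :=
    (LinearIsometryEquiv.measurePreserving _).prod (MeasurePreserving.id _)
  exact ((LinearIsometryEquiv.measurePreserving
    (Submodule.span ℝ {(ω : E3)}).orthogonalDecomposition.symm).comp
      (WithLp.volume_preserving_toLp _ _)).comp h1

/-- The integral of `f` over the plane `ω · x = s`. -/
noncomputable def slice (f : E3 → ℂ) (ω : S2) (s : ℝ) : ℂ :=
  ∫ w : (Submodule.span ℝ {(ω : E3)})ᗮ, f (s • (ω : E3) + (w : E3))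

/-- The exponent `4` exceeds the dimension of `E3`, so the same majorant is integrable on lines and
planes. -/
theorem norm_schwartz_le {V : Type*} [NormedAddCommGroup V] [NormedSpace ℝ V] (f : 𝓢(V, ℂ)) :
    ∃ C, 0 ≤ C ∧ ∀ x, ‖f x‖ ≤ C * (1 + ‖x‖) ^ (-4 : ℝ) := by
  have key := SchwartzMap.one_add_le_sup_seminorm_apply (𝕜 := ℝ) (m := (4, 0)) (k := 4) (n := 0)
    le_rfl le_rfl f
  simp only [norm_iteratedFDeriv_zero] at key
  refine ⟨_, (by positivity : (0 : ℝ) ≤ _).trans (key 0), fun x => ?_⟩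
  have h0 : (0 : ℝ) < 1 + ‖x‖ := by positivity
  have : (1 + ‖x‖) ^ (-4 : ℝ) = ((1 + ‖x‖) ^ 4)⁻¹ := by
    rw [Real.rpow_neg h0.le]; norm_num
  rw [this, ← div_eq_mul_inv, le_div_iff₀ (by positivity), mul_comm]
  exact key x

theorem norm_le_norm_smul_add (ω : S2) (s : ℝ) (w : (Submodule.span ℝ {(ω : E3)})ᗮ) :
    ‖w‖ ≤ ‖s • (ω : E3) + (w : E3)‖ := by
  have h : ⟪s • (ω : E3), (w : E3)⟫ = 0 :=
    Submodule.inner_right_of_mem_orthogonal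
      (Submodule.smul_mem _ _ (Submodule.mem_span_singleton_self _)) w.2
  have := norm_add_sq_eq_norm_sq_add_norm_sq_of_inner_eq_zero _ _ h
  refine (sq_le_sq₀ (norm_nonneg _) (norm_nonneg _)).1 ?_
  rw [sq, sq, this, Submodule.coe_norm]
  nlinarith [mul_self_nonneg ‖s • (ω : E3)‖]

theorem norm_schwartz_slice_le (f : 𝓢(E3, ℂ)) : ∃ C, 0 ≤ C ∧ ∀ (ω : S2) (s : ℝ)
    (w : (Submodule.span ℝ {(ω : E3)})ᗮ),
    ‖f (s • (ω : E3) + (w : E3))‖ ≤ C * (1 + ‖w‖) ^ (-4 : ℝ) := by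
  obtain ⟨C, hC0, hC⟩ := norm_schwartz_le f
  refine ⟨C, hC0, fun ω s w => (hC _).trans ?_⟩
  refine mul_le_mul_of_nonneg_left ?_ hC0
  exact Real.rpow_le_rpow_of_nonpos (by positivity)
    (by linarith [norm_le_norm_smul_add ω s w]) (by norm_num)

theorem integrable_one_add_norm_orthogonal (ω : S2) :
    Integrable fun w : (Submodule.span ℝ {(ω : E3)})ᗮ => (1 + ‖w‖) ^ (-4 : ℝ) := by
  refine integrable_one_add_norm ?_
  have h := Submodule.finrank_le (Submodule.span ℝ {(ω : E3)})ᗮ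
  have h3 : Module.finrank ℝ E3 = 3 := by simp
  rw [h3] at h
  have : (Module.finrank ℝ (Submodule.span ℝ {(ω : E3)})ᗮ : ℝ) ≤ 3 := by exact_mod_cast h
  linarith

theorem continuous_slice (f : 𝓢(E3, ℂ)) (ω : S2) : Continuous (slice f ω) := by
  obtain ⟨C, -, hC⟩ := norm_schwartz_slice_le f
  have hf := f.continuous
  refine continuous_of_dominated (bound := fun w => C * (1 + ‖w‖) ^ (-4 : ℝ))
    (fun s => ?_) (fun s => .of_forall fun w => hC ω s w)
    ((integrable_one_add_norm_orthogonal ω).const_mul C) (.of_forall fun w => ?_)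
  · exact Continuous.aestronglyMeasurable (by fun_prop)
  · fun_prop

/-- Fubini's theorem along the planes orthogonal to `ω`. -/
theorem integral_mul_eq_integral_slice (f : 𝓢(E3, ℂ)) (ω : S2) {Z : ℝ → ℂ}
    (hZ : Integrable (fun p : ℝ × (Submodule.span ℝ {(ω : E3)})ᗮ =>
      Z p.1 * f (p.1 • (ω : E3) + (p.2 : E3))) (volume.prod volume)) :
    ∫ x : E3, Z ⟪(ω : E3), x⟫ * f x = ∫ s, Z s * slice f ω s := by
  rw [← (measurePreserving_sliceEquiv ω).integral_comp' (fun x : E3 => Z ⟪(ω : E3), x⟫ * f x)]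
  have h : ∀ p : ℝ × (Submodule.span ℝ {(ω : E3)})ᗮ, ⟪(ω : E3), sliceEquiv ω p⟫ = p.1 := fun p => by
    have h0 : ⟪(ω : E3), (p.2 : E3)⟫ = 0 :=
      Submodule.mem_orthogonal_singleton_iff_inner_right.mp p.2.2
    rw [sliceEquiv_apply, inner_add_right, h0, real_inner_smul_right, real_inner_self_eq_norm_sq,
      norm_coe_sphere]
    ring
  simp only [h]
  simp only [sliceEquiv_apply]
  rw [Measure.volume_eq_prod, integral_prod _ hZ]
  refine integral_congr_ae (.of_forall fun s => ?_)
  exact integral_const_mul (Z s) _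

theorem integrable_comp_slice (f : 𝓢(E3, ℂ)) (ω : S2) :
    Integrable (fun p : ℝ × (Submodule.span ℝ {(ω : E3)})ᗮ =>
      f (p.1 • (ω : E3) + (p.2 : E3))) (volume.prod volume) := by
  have := (measurePreserving_sliceEquiv ω).integrable_comp_of_integrable f.integrable
  exact this

theorem integrable_slice (f : 𝓢(E3, ℂ)) (ω : S2) : Integrable (slice f ω) :=
  (integrable_comp_slice f ω).integral_prod_left

/-- The projection-slice theorem: the character at frequency `rω` is constant on the planes
orthogonal to `ω`. -/
theorem fourierInv_slice (f : 𝓢(E3, ℂ)) (ω : S2) (r : ℝ) :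
    𝓕⁻ (slice f ω) r = (𝓕⁻ f) (r • (ω : E3)) := by
  rw [SchwartzMap.fourierInv_coe, Real.fourierInv_eq', Real.fourierInv_eq']
  have h := integral_mul_eq_integral_slice f ω
    (Z := fun s => Complex.exp (↑(2 * Real.pi * (r * s)) * Complex.I)) (by
      refine (integrable_comp_slice f ω).bdd_mul (c := 1) ?_ (.of_forall fun p => ?_)
      · exact Continuous.aestronglyMeasurable (by fun_prop)
      · rw [Complex.norm_exp_ofReal_mul_I])
  refine Eq.trans ?_ (h.symm.trans ?_)
  · refine integral_congr_ae (.of_forall fun s => ?_)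
    simp
  · refine integral_congr_ae (.of_forall fun x => ?_)
    simp only [inner_smul_right, smul_eq_mul, real_inner_comm x]

theorem integrable_schwartz_smul (g : 𝓢(E3, ℂ)) (ω : S2) :
    Integrable fun r : ℝ => g (r • (ω : E3)) := by
  obtain ⟨C, hC0, hC⟩ := norm_schwartz_le g
  have hg := g.continuous
  have hi : Integrable fun r : ℝ => (1 + ‖r‖) ^ (-4 : ℝ) :=
    integrable_one_add_norm (by rw [Module.finrank_self]; norm_num)
  refine (hi.const_mul C).mono' (Continuous.aestronglyMeasurable (by fun_prop))
    (.of_forall fun r => ?_)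
  simpa [norm_smul] using hC (r • (ω : E3))

theorem slice_eq_integral (f : 𝓢(E3, ℂ)) (ω : S2) (s : ℝ) :
    slice f ω s = ∫ r : ℝ, Complex.exp (↑(-2 * Real.pi * (r * s)) * Complex.I) *
      (𝓕⁻ f) (r • (ω : E3)) := by
  have hq : 𝓕⁻ (slice f ω) = fun r => (𝓕⁻ f) (r • (ω : E3)) := funext (fourierInv_slice f ω)
  have hint : Integrable (𝓕 (slice f ω)) := by
    have : 𝓕 (slice f ω) = fun r => (𝓕⁻ f) ((-r) • (ω : E3)) := by
      funext r
      rw [← fourierInv_slice, Real.fourierInv_eq_fourier_neg, neg_neg]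
    rw [this]
    exact (integrable_schwartz_smul (𝓕⁻ f) ω).comp_neg
  have h := congrFun ((continuous_slice f ω).fourier_fourierInv_eq (integrable_slice f ω) hint) s
  rw [hq, Real.fourier_eq'] at h
  rw [← h]
  refine integral_congr_ae (.of_forall fun r => ?_)
  simp only [smul_eq_mul]
  congr 4
  simp
  ring

end Slice

/-! ### Plane distributions on the Fourier side -/

theorem fourierInv_laplacian (f : 𝓢(E3, ℂ)) (k : E3) :
    (𝓕⁻ (Δ f)) k = ((-(2 * Real.pi) ^ 2 * ‖k‖ ^ 2 : ℝ) : ℂ) * (𝓕⁻ f) k := by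
  have hT : (fun x : E3 => ‖x‖ ^ 2).HasTemperateGrowth := by fun_prop
  have h : ∀ g : 𝓢(E3, ℂ), (𝓕⁻ g) k = (𝓕 g) (-k) := fun g => rfl
  have h2 : Δ f = 𝓕⁻ (-(2 * Real.pi) ^ 2 • SchwartzMap.smulLeftCLM ℂ (fun x : E3 => ‖x‖ ^ 2)
      (𝓕 f)) := by
    rw [SchwartzMap.laplacian_eq_fourierMultiplierCLM, FourierTransform.fourierInv_smul]
    rfl
  rw [h, h2, FourierTransform.fourier_fourierInv_eq, h, _root_.smul_apply,
    SchwartzMap.smulLeftCLM_apply_apply hT, norm_neg, Complex.real_smul, Complex.real_smul]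
  push_cast
  ring

/-- `Z(ω·x/c)` varies only along `ω`, so its Fourier transform lives on the line `ℝω`, where its
density is the rescaled cosine transform of `Z`. Integrability of `Z` and Schwartz decay justify
both exchanges of integrals. -/
theorem plane_pairing {Z E : ℝ → ℝ} (hZ : Integrable Z) (hZe : ∀ y, Z (-y) = Z y)
    (hE : ∀ k, E k = 2 * ∫ y in Ioi (0 : ℝ), Z y * Real.cos (y * k)) (f : 𝓢(E3, ℂ)) (ω : S2)
    {c : ℝ} (hc : 0 < c) :
    ∫ x : E3, (Z (⟪(ω : E3), x⟫ / c) : ℂ) * f x =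
      c * ∫ r : ℝ, (E (2 * Real.pi * c * r) : ℂ) * (𝓕⁻ f) (r • (ω : E3)) := by
  obtain ⟨C, -, hC⟩ := norm_schwartz_slice_le f
  have hZc : Integrable fun s => (Z (s / c) : ℂ) := (hZ.comp_div hc.ne').ofReal
  rw [integral_mul_eq_integral_slice f ω (Z := fun s => (Z (s / c) : ℂ))]
  swap
  · have hf := f.continuous
    refine (hZc.norm.mul_prod ((integrable_one_add_norm_orthogonal ω).const_mul C)).mono'
      (hZc.aestronglyMeasurable.comp_fst.mul (Continuous.aestronglyMeasurable (by fun_prop)))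
      (.of_forall fun p => ?_)
    rw [norm_mul]
    exact mul_le_mul_of_nonneg_left (hC ω p.1 p.2) (norm_nonneg _)
  have hq := integrable_schwartz_smul (𝓕⁻ f) ω
  have hprod : Integrable (Function.uncurry fun (s r : ℝ) =>
      Complex.exp (↑(-2 * Real.pi * (r * s)) * Complex.I) *
        ((Z (s / c) : ℂ) * (𝓕⁻ f) (r • (ω : E3)))) (volume.prod volume) := by
    refine (hZc.mul_prod hq).bdd_mul (c := 1) (Continuous.aestronglyMeasurable (by fun_prop))
      (.of_forall fun p => ?_)
    rw [Complex.norm_exp_ofReal_mul_I]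
  have h1 : ∀ s, (Z (s / c) : ℂ) * slice f ω s = ∫ r : ℝ,
      Complex.exp (↑(-2 * Real.pi * (r * s)) * Complex.I) *
        ((Z (s / c) : ℂ) * (𝓕⁻ f) (r • (ω : E3))) := fun s => by
    rw [slice_eq_integral, ← integral_const_mul]
    refine integral_congr_ae (.of_forall fun r => ?_)
    simp only
    ring
  simp only [h1]
  rw [integral_integral_swap hprod, ← integral_const_mul]
  refine integral_congr_ae (.of_forall fun r => ?_)
  simp only
  have h2 := integral_cexp_mul_even hZe hZ (-(2 * Real.pi * c * r))
  have h3 : E (2 * Real.pi * c * r) =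
      2 * ∫ y in Ioi (0 : ℝ), Z y * Real.cos (y * -(2 * Real.pi * c * r)) := by
    rw [hE]
    simp only [mul_neg, Real.cos_neg]
  rw [← h3] at h2
  rw [← h2, ← mul_assoc]
  have h4 := Measure.integral_comp_div (fun y : ℝ =>
    Complex.exp (Complex.I * y * ((-(2 * Real.pi * c * r) : ℝ) : ℂ)) * (Z y : ℂ)) c
  rw [abs_of_pos hc, Complex.real_smul] at h4
  rw [← h4, ← integral_mul_const]
  refine integral_congr_ae (.of_forall fun s => ?_)
  simp only
  rw [← mul_assoc]
  congr 3
  have hc' : (c : ℂ) ≠ 0 := by exact_mod_cast hc.ne'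
  push_cast
  field_simp

theorem planeX_eq {α : ℝ} (hα : α ∈ Ioc 1 2) (ω : S2) {c : ℝ} (hc : 0 < c) (f : 𝓢(E3, ℂ)) :
    planeX α ω c f = c * ∫ r : ℝ, (mittagLeffler α 1 (-|2 * Real.pi * c * r| ^ α) : ℂ) *
      (𝓕⁻ f) (r • (ω : E3)) := by
  rw [planeX]
  rcases hα.2.eq_or_lt with rfl | hα2
  -- For `α = 2` the planes at `±c` contribute conjugate exponentials, whose half-sum is the cosine
  -- `E_{2,1}`.
  · have hq := integrable_schwartz_smul (𝓕⁻ f) ω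
    have hint : ∀ s : ℝ, Integrable fun r : ℝ =>
        Complex.exp (↑(-2 * Real.pi * (r * s)) * Complex.I) * (𝓕⁻ f) (r • (ω : E3)) := fun s =>
      hq.bdd_mul (c := 1) (Continuous.aestronglyMeasurable (by fun_prop))
        (.of_forall fun r => by rw [Complex.norm_exp_ofReal_mul_I])
    have h1 := slice_eq_integral f ω c
    have h2 := slice_eq_integral f ω (-c)
    rw [slice] at h1 h2
    simp only [neg_smul] at h2
    rw [if_pos rfl, h1, h2, ← integral_add (hint c) (hint (-c)), ← integral_const_mul,
      ← integral_const_mul]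
    refine integral_congr_ae (.of_forall fun r => ?_)
    simp only
    rw [Real.rpow_two, sq_abs, mittagLeffler_two_one, Complex.ofReal_cos, Complex.cos]
    have e1 : ((-2 * Real.pi * (r * c) : ℝ) : ℂ) * Complex.I =
      -((2 * Real.pi * c * r : ℝ) : ℂ) * Complex.I := by push_cast; ring
    have e2 : ((-2 * Real.pi * (r * -c) : ℝ) : ℂ) * Complex.I =
      ((2 * Real.pi * c * r : ℝ) : ℂ) * Complex.I := by push_cast; ring
    rw [e1, e2]
    push_cast
    ring
  · rw [if_neg hα2.ne]
    exact plane_pairing (integrable_X ⟨hα.1, hα2⟩) (X_neg α)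
      (E := fun k => mittagLeffler α 1 (-|k| ^ α)) (mittagLeffler_eq_integral_X ⟨hα.1, hα2⟩) f ω hc

theorem planeY_eq {α : ℝ} (hα : α ∈ Ioc 1 2) (ω : S2) {c : ℝ} (hc : 0 < c) (f : 𝓢(E3, ℂ)) :
    planeY α ω c f = c * ∫ r : ℝ, (mittagLeffler α 2 (-|2 * Real.pi * c * r| ^ α) : ℂ) *
      (𝓕⁻ f) (r • (ω : E3)) :=
  plane_pairing (integrable_Y hα) (Y_neg α)
    (E := fun k => mittagLeffler α 2 (-|k| ^ α)) (mittagLeffler_eq_integral_Y hα) f ω hc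

/-! ### Polar coordinates -/

theorem integral_volumeIoiPow (n : ℕ) (g : ℝ → ℂ) :
    ∫ r : Ioi (0 : ℝ), g r ∂(Measure.volumeIoiPow n) = ∫ r in Ioi (0 : ℝ), (r ^ n : ℝ) * g r := by
  simp only [Measure.volumeIoiPow, ENNReal.ofReal]
  rw [integral_withDensity_eq_integral_smul (measurable_subtype_coe.pow_const _).real_toNNReal,
    integral_subtype_comap measurableSet_Ioi fun a : ℝ => Real.toNNReal (a ^ n) • g a]
  refine setIntegral_congr_fun measurableSet_Ioi fun x hx => ?_
  rw [NNReal.smul_def, Real.coe_toNNReal _ (pow_nonneg (le_of_lt hx) _), Complex.real_smul]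

theorem integrable_polar {g : E3 → ℂ} (hg : Integrable g) :
    Integrable (fun p : S2 × Ioi (0 : ℝ) => g ((p.2 : ℝ) • (p.1 : E3)))
      ((volume : Measure E3).toSphere.prod (Measure.volumeIoiPow 2)) := by
  have h3 : Module.finrank ℝ E3 - 1 = 2 := by simp
  have hmp := (volume : Measure E3).measurePreserving_homeomorphUnitSphereProd
  rw [h3] at hmp
  rw [← hmp.integrable_comp_emb (Homeomorph.measurableEmbedding _)]
  have hg' : Integrable (fun x : ({0}ᶜ : Set E3) => g x) (Measure.comap Subtype.val volume) :=
    (integrableOn_iff_comap_subtypeVal (measurableSet_singleton _).compl).1 hg.integrableOn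
  refine hg'.congr (.of_forall fun x => ?_)
  have hx : ‖(x : E3)‖ ≠ 0 := norm_ne_zero_iff.2 x.2
  simp [smul_smul, hx]

theorem integral_polar {g : E3 → ℂ} (hg : Integrable g) :
    Integrable (fun ω : S2 => ∫ r in Ioi (0 : ℝ), (r ^ 2 : ℝ) * g (r • (ω : E3)))
      (volume : Measure E3).toSphere ∧
    ∫ ω : S2, (∫ r in Ioi (0 : ℝ), (r ^ 2 : ℝ) * g (r • (ω : E3)))
      ∂(volume : Measure E3).toSphere = ∫ k, g k := by
  have h3 : Module.finrank ℝ E3 - 1 = 2 := by simp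
  have hmp := (volume : Measure E3).measurePreserving_homeomorphUnitSphereProd
  rw [h3] at hmp
  have hp := integrable_polar hg
  have heq : ∀ ω : S2, ∫ r : Ioi (0 : ℝ), g ((r : ℝ) • (ω : E3)) ∂(Measure.volumeIoiPow 2) =
      ∫ r in Ioi (0 : ℝ), (r ^ 2 : ℝ) * g (r • (ω : E3)) := fun ω =>
    integral_volumeIoiPow 2 fun r => g (r • (ω : E3))
  refine ⟨hp.integral_prod_left.congr (.of_forall heq), ?_⟩
  rw [← integral_congr_ae (.of_forall heq), ← integral_prod _ hp,
    ← hmp.integral_comp (Homeomorph.measurableEmbedding _)]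
  have : ∫ x : ({0}ᶜ : Set E3), g x ∂(Measure.comap Subtype.val volume) = ∫ x, g x := by
    rw [integral_subtype_comap (measurableSet_singleton _).compl g, restrict_compl_singleton]
  rw [← this]
  refine integral_congr_ae (.of_forall fun x => ?_)
  have hx : ‖(x : E3)‖ ≠ 0 := norm_ne_zero_iff.2 x.2
  simp [smul_smul, hx]

/-- Polar coordinates with the radius running over the whole line. -/
theorem integral_polar_line {g : E3 → ℂ} (hg : Integrable g)
    (hline : ∀ ω : S2, Integrable fun r : ℝ => ((r ^ 2 : ℝ) : ℂ) * g (r • (ω : E3))) :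
    Integrable (fun ω : S2 => ∫ r : ℝ, ((r ^ 2 : ℝ) : ℂ) * g (r • (ω : E3)))
      (volume : Measure E3).toSphere ∧
    ∫ ω : S2, (∫ r : ℝ, ((r ^ 2 : ℝ) : ℂ) * g (r • (ω : E3)))
      ∂(volume : Measure E3).toSphere = 2 * ∫ k, g k := by
  obtain ⟨h1, h2⟩ := integral_polar hg
  obtain ⟨h3, h4⟩ := integral_polar hg.comp_neg
  -- The negative half-line is the positive one for the reflected function, so every point is
  -- counted twice.
  have heq : ∀ ω : S2, (∫ r in Ioi (0 : ℝ), (r ^ 2 : ℝ) * g (-(r • (ω : E3)))) +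
      (∫ r in Ioi (0 : ℝ), (r ^ 2 : ℝ) * g (r • (ω : E3))) =
      ∫ r : ℝ, ((r ^ 2 : ℝ) : ℂ) * g (r • (ω : E3)) := fun ω => by
    rw [← intervalIntegral.integral_Iic_add_Ioi (b := 0) (hline ω).integrableOn (hline ω).integrableOn]
    congr 1
    have := integral_comp_neg_Ioi 0 fun r : ℝ => ((r ^ 2 : ℝ) : ℂ) * g (r • (ω : E3))
    rw [neg_zero] at this
    rw [← this]
    simp only [neg_sq, neg_smul]
  refine ⟨(h3.add h1).congr (.of_forall heq), ?_⟩
  rw [← integral_congr_ae (.of_forall heq), integral_add h3 h1, h2, h4, integral_neg_eq_self]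
  ring

/-! ### Zeros of the symbol -/

theorem ae_inner_eq_zero_of_angularF_eq_zero {ρ α : ℝ} (hρ : 0 < ρ) (hα : 0 < α)
    {μ : Measure S2} [IsFiniteMeasure μ] {k : E3} (hk : angularF ρ α μ k = 0) :
    ∀ᵐ y : S2 ∂μ, ⟪k, (y : E3)⟫ = 0 := by
  rw [angularF_eq, div_eq_zero_iff, or_iff_left hρ.ne'] at hk
  have hc : Continuous fun y : S2 => |⟪k, (y : E3)⟫| ^ α :=
    Continuous.rpow_const (by fun_prop) fun _ => Or.inr hα.le
  have hi : Integrable (fun y : S2 => |⟪k, (y : E3)⟫| ^ α) μ := by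
    rw [← integrableOn_univ]
    exact hc.continuousOn.integrableOn_compact isCompact_univ
  rw [integral_eq_zero_iff_of_nonneg (fun y => by positivity) hi] at hk
  filter_upwards [hk] with y hy
  simpa [Real.rpow_eq_zero (abs_nonneg _) hα.ne'] using hy

/-- The zeros lie in the subspace of those `k` orthogonal to `μ`-almost every `y`. If it were all of
`E3`, almost every `y` would be orthogonal to a basis, impossible on the unit sphere unless `μ = 0`;
a proper subspace has measure zero. -/
theorem volume_angularF_eq_zero {ρ α : ℝ} (hρ : 0 < ρ) (hα : 0 < α) {μ : Measure S2}
    [IsFiniteMeasure μ] (hμ : μ ≠ 0) : volume {k : E3 | angularF ρ α μ k = 0} = 0 := by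
  let V : Submodule ℝ E3 :=
    { carrier := {k | ∀ᵐ y : S2 ∂μ, ⟪k, (y : E3)⟫ = 0}
      add_mem' := fun {a b} ha hb => by
        change ∀ᵐ y : S2 ∂μ, ⟪a + b, (y : E3)⟫ = 0
        filter_upwards [ha, hb] with y hy hy'
        rw [inner_add_left, hy, hy', add_zero]
      zero_mem' := by
        change ∀ᵐ y : S2 ∂μ, ⟪(0 : E3), (y : E3)⟫ = 0
        exact .of_forall fun y => inner_zero_left _
      smul_mem' := fun c a ha => by
        change ∀ᵐ y : S2 ∂μ, ⟪c • a, (y : E3)⟫ = 0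
        filter_upwards [ha] with y hy
        rw [real_inner_smul_left, hy, mul_zero] }
  refine measure_mono_null (fun k hk => ae_inner_eq_zero_of_angularF_eq_zero hρ hα hk)
    (Measure.addHaar_submodule volume V fun hV => hμ ?_)
  have hall : ∀ k : E3, ∀ᵐ y : S2 ∂μ, ⟪k, (y : E3)⟫ = 0 := fun k => by
    have : k ∈ V := hV ▸ Submodule.mem_top
    exact this
  have hbasis : ∀ᵐ y : S2 ∂μ, ∀ i, ⟪EuclideanSpace.single i (1 : ℝ), (y : E3)⟫ = 0 :=
    ae_all_iff.2 fun i => hall _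
  refine ae_eq_bot.1 (eventually_false_iff_eq_bot.1 ?_)
  filter_upwards [hbasis] with y hy
  have h0 : (y : E3) = 0 := by
    ext i
    simpa [EuclideanSpace.inner_single_left] using hy i
  have := norm_eq_of_mem_sphere y
  rw [h0, norm_zero] at this
  exact zero_ne_one this

/-- By homogeneity the zeros of `F` on the sphere span a cone of zeros in space, and surface measure
is a multiple of the volume of such a cone. -/
theorem ae_angularF_pos {ρ α : ℝ} (hρ : 0 < ρ) (hα : 0 < α) {μ : Measure S2}
    [IsFiniteMeasure μ] (hμ : μ ≠ 0) :
    ∀ᵐ ω : S2 ∂(volume : Measure E3).toSphere, 0 < angularF ρ α μ ω := by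
  have hc := continuous_angularF ρ hα.le μ
  have hm : MeasurableSet {ω : S2 | angularF ρ α μ ω = 0} :=
    (isClosed_eq (hc.comp continuous_subtype_val) continuous_const).measurableSet
  have h0 : (volume : Measure E3).toSphere {ω : S2 | angularF ρ α μ ω = 0} = 0 := by
    rw [Measure.toSphere_apply' _ hm, measure_mono_null ?_ (volume_angularF_eq_zero hρ hα hμ),
      mul_zero]
    rintro _ ⟨r, -, _, ⟨ω, hω, rfl⟩, rfl⟩
    change angularF ρ α μ (r • (ω : E3)) = 0
    rw [angularF_smul, show angularF ρ α μ ω = 0 from hω, mul_zero]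
  filter_upwards [measure_eq_zero_iff_ae_notMem.1 h0] with ω hω
  exact lt_of_le_of_ne (angularF_nonneg hρ α μ _) (Ne.symm hω)

/-! ### The spherical integrals -/

theorem integrable_sq_mul_schwartz (g : 𝓢(E3, ℂ)) (ω : S2) :
    Integrable fun r : ℝ => ((r ^ 2 : ℝ) : ℂ) * g (r • (ω : E3)) := by
  have hT : (fun x : E3 => ‖x‖ ^ 2).HasTemperateGrowth := by fun_prop
  refine (integrable_schwartz_smul (SchwartzMap.smulLeftCLM ℂ (fun x : E3 => ‖x‖ ^ 2) g) ω).congr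
    (.of_forall fun r => ?_)
  simp only
  rw [SchwartzMap.smulLeftCLM_apply_apply hT, norm_smul, norm_coe_sphere, mul_one,
    Real.norm_eq_abs, sq_abs, Complex.real_smul]

/-- With `c = t F(ω)^(1/α)`, the factor `F(ω)^(-1/α)` reduces the factor `c` in `P` to `t`, and
homogeneity turns `|2πcr|^α` into `F(2πrω) t^α`. The Laplacian supplies `-4π² r²`, whose `r²` is the
polar Jacobian; counting each point twice on full lines gives the constant `-8π² t`. The abstract
`P` covers both plane pairings. -/
theorem spherical_integral {ρ α m t : ℝ} (hρ : 0 < ρ) (hα : α ∈ Ioc 1 2) (hm : m = 1 ∨ m = 2)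
    (ht : 0 < t) {μ : Measure S2} [IsFiniteMeasure μ] (hμ : μ ≠ 0) (φ : 𝓢(E3, ℂ))
    {P : S2 → ℝ → ℂ} (hP : ∀ ω c, 0 < c → P ω c =
      c * ∫ r : ℝ, (mittagLeffler α m (-|2 * Real.pi * c * r| ^ α) : ℂ) *
        (𝓕⁻ (Δ φ)) (r • (ω : E3))) :
    Integrable (fun ω : S2 => ((angularF ρ α μ ω ^ (-1 / α) : ℝ) : ℂ) *
      P ω (t * angularF ρ α μ ω ^ (1 / α))) (volume : Measure E3).toSphere ∧
    ∫ ω : S2, ((angularF ρ α μ ω ^ (-1 / α) : ℝ) : ℂ) *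
      P ω (t * angularF ρ α μ ω ^ (1 / α)) ∂(volume : Measure E3).toSphere =
      ((-(8 * Real.pi ^ 2 * t) : ℝ) : ℂ) * ∫ k : E3, (mittagLeffler α m
        (-(angularF ρ α μ ((2 * Real.pi) • k) * t ^ α)) : ℂ) * (𝓕⁻ φ) k := by
  have hα0 : 0 < α := by linarith [hα.1]
  obtain ⟨C, -, hC⟩ := exists_abs_mittagLeffler_le_of_mem_Ioc hα hm
  have hE : Continuous (mittagLeffler α m) :=
    continuous_mittagLeffler hα.1 (by rcases hm with rfl | rfl <;> norm_num)
  have hF := continuous_angularF ρ hα0.le μ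
  set w : E3 → ℂ := fun k =>
    (mittagLeffler α m (-(angularF ρ α μ ((2 * Real.pi) • k) * t ^ α)) : ℂ) with hw
  have hwc : Continuous w := by fun_prop
  have hwb : ∀ k, ‖w k‖ ≤ C := fun k => by
    rw [hw, Complex.norm_real, Real.norm_eq_abs]
    exact hC _ (mul_nonneg (angularF_nonneg hρ _ _ _) (by positivity))
  have hg : Integrable fun k => w k * (𝓕⁻ φ) k :=
    (𝓕⁻ φ).integrable.bdd_mul (c := C) hwc.aestronglyMeasurable (.of_forall hwb)
  obtain ⟨h1, h2⟩ := integral_polar_line hg fun ω => by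
    have hwl : Continuous fun r : ℝ => w (r • (ω : E3)) := by fun_prop
    refine ((integrable_sq_mul_schwartz (𝓕⁻ φ) ω).bdd_mul (c := C) hwl.aestronglyMeasurable
      (.of_forall fun r => hwb _)).congr (.of_forall fun r => ?_)
    simp only
    ring
  have key : (fun ω : S2 => ((-(4 * Real.pi ^ 2 * t) : ℝ) : ℂ) *
      ∫ r : ℝ, ((r ^ 2 : ℝ) : ℂ) * (w (r • (ω : E3)) * (𝓕⁻ φ) (r • (ω : E3))))
      =ᵐ[(volume : Measure E3).toSphere]
      fun ω : S2 => ((angularF ρ α μ ω ^ (-1 / α) : ℝ) : ℂ) *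
        P ω (t * angularF ρ α μ ω ^ (1 / α)) := by
    filter_upwards [ae_angularF_pos hρ hα0 hμ] with ω hω
    have hc : 0 < t * angularF ρ α μ ω ^ (1 / α) := by positivity
    have hpow : (angularF ρ α μ ω ^ (1 / α)) ^ α = angularF ρ α μ ω := by
      rw [← Real.rpow_mul hω.le, one_div_mul_cancel hα0.ne', Real.rpow_one]
    have hcancel : angularF ρ α μ ω ^ (-1 / α) * (t * angularF ρ α μ ω ^ (1 / α)) = t := by
      rw [mul_left_comm, ← Real.rpow_add hω, neg_div, neg_add_cancel, Real.rpow_zero, mul_one]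
    rw [hP ω _ hc, ← mul_assoc, ← Complex.ofReal_mul, hcancel, ← integral_const_mul,
      ← integral_const_mul]
    refine integral_congr_ae (.of_forall fun r => ?_)
    simp only
    have harg : angularF ρ α μ ((2 * Real.pi) • r • (ω : E3)) * t ^ α =
        |2 * Real.pi * (t * angularF ρ α μ ω ^ (1 / α)) * r| ^ α := by
      rw [smul_smul, angularF_smul,
        show 2 * Real.pi * (t * angularF ρ α μ ω ^ (1 / α)) * r =
          (2 * Real.pi * r) * (t * angularF ρ α μ ω ^ (1 / α)) by ring,
        abs_mul _ (t * _), abs_of_pos hc, Real.mul_rpow (abs_nonneg _) hc.le,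
        Real.mul_rpow ht.le (by positivity), hpow]
      ring
    rw [fourierInv_laplacian, norm_smul, norm_coe_sphere, mul_one, Real.norm_eq_abs, sq_abs,
      ← harg]
    simp only [hw]
    push_cast
    ring
  refine ⟨(h1.const_mul _).congr key, ?_⟩
  rw [← integral_congr_ae key, integral_const_mul, h2]
  push_cast
  ring

/-! ### Fundamental solutions paired with test functions -/

section Formulas

variable {ρ α : ℝ} {μ : Measure S2}

theorem IsFirstFundamental.apply_eq {b : ℝ} {G : ℝ≥0 → 𝓢'(E3, ℂ)} (hρ : 0 < ρ)
    (hb : b ∈ Ioc 1 2) (hG : IsFirstFundamental ρ α b μ G) (t : ℝ≥0) (φ : 𝓢(E3, ℂ)) :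
    G t φ = ∫ k : E3, (mittagLeffler b 1
      (-(angularF ρ α μ ((2 * Real.pi) • k) * (t : ℝ) ^ b)) : ℂ) * (𝓕⁻ φ) k :=
  (hG.hasFourierFunction hρ hb t).apply_eq φ

theorem IsSecondFundamental.apply_eq {b : ℝ} {H : ℝ≥0 → 𝓢'(E3, ℂ)} (hρ : 0 < ρ)
    (hb : b ∈ Ioc 1 2) (hH : IsSecondFundamental ρ α b μ H) (t : ℝ≥0) (φ : 𝓢(E3, ℂ)) :
    H t φ = ((t : ℝ) : ℂ) * ∫ k : E3, (mittagLeffler b 2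
      (-(angularF ρ α μ ((2 * Real.pi) • k) * (t : ℝ) ^ b)) : ℂ) * (𝓕⁻ φ) k := by
  rw [(hH.hasFourierFunction hρ hb t).apply_eq φ, ← integral_const_mul]
  refine integral_congr_ae (.of_forall fun k => ?_)
  simp only
  push_cast
  ring

end Formulas

end FracWave

/-! ### Assembly of the main theorem -/

theorem mainTheorem1 (ρ α β : ℝ) (hρ : 0 < ρ) (hβ : 1 < β) (hβα : β < α) (hα : α ≤ 2)
    (μ : Measure S2) [IsFiniteMeasure μ] :
    -- the fundamental solutions for the orders `β` and `α` exist and are unique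
    (∃! G : ℝ≥0 → 𝓢'(E3, ℂ), IsFirstFundamental ρ α β μ G) ∧
    (∃! H : ℝ≥0 → 𝓢'(E3, ℂ), IsSecondFundamental ρ α β μ H) ∧
    (∃! G : ℝ≥0 → 𝓢'(E3, ℂ), IsFirstFundamental ρ α α μ G) ∧
    (∃! H : ℝ≥0 → 𝓢'(E3, ℂ), IsSecondFundamental ρ α α μ H) ∧
    -- `X_α` and `Y_α` are the inverse Fourier transforms of Mittag-Leffler functions
    (α < 2 → ∀ y : ℝ,
      Integrable (fun k : ℝ => mittagLeffler α 1 (-|k| ^ α)) ∧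
      (X α y : ℂ) = 1 / (2 * Real.pi) *
        ∫ k : ℝ, Complex.exp (Complex.I * k * y) * (mittagLeffler α 1 (-|k| ^ α) : ℂ)) ∧
    (α < 2 → ∀ y : ℝ,
      Integrable (fun k : ℝ => mittagLeffler α 2 (-|k| ^ α)) ∧
      (Y α y : ℂ) = 1 / (2 * Real.pi) *
        ∫ k : ℝ, Complex.exp (Complex.I * k * y) * (mittagLeffler α 2 (-|k| ^ α) : ℂ)) ∧
    -- the formulas, `(G, H)` being the pair for the order `β` and `(G₁, H₁)` that for `α`
    ∀ G H G₁ H₁ : ℝ≥0 → 𝓢'(E3, ℂ),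
      IsFirstFundamental ρ α β μ G → IsSecondFundamental ρ α β μ H →
      IsFirstFundamental ρ α α μ G₁ → IsSecondFundamental ρ α α μ H₁ →
      ∀ (t : ℝ≥0), 0 < t → ∀ φ : 𝓢(E3, ℂ),
        -- `G(t, x) = ∫ M_γ(ξ) G₁(t^γ, x / ξ) dξ / ξ³`
        (IntegrableOn (fun ξ : ℝ => (wrightM (β / α) ξ / ξ ^ 3 : ℝ) *
            dilate ξ (G₁ (t ^ (β / α))) φ) (Ioi 0) ∧
          G t φ = ∫ ξ in Ioi (0 : ℝ), (wrightM (β / α) ξ / ξ ^ 3 : ℝ) *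
            dilate ξ (G₁ (t ^ (β / α))) φ) ∧
        -- `G(t, x) = t^(-3γ) ∫ M_γ(ξ) G₁(1, x t^(-γ) / ξ) dξ / ξ³`
        (IntegrableOn (fun ξ : ℝ => (wrightM (β / α) ξ / ξ ^ 3 : ℝ) *
            dilate ((t : ℝ) ^ (β / α) * ξ) (G₁ 1) φ) (Ioi 0) ∧
          G t φ = ((t : ℝ) ^ (-3 * (β / α)) : ℝ) *
            ∫ ξ in Ioi (0 : ℝ), (wrightM (β / α) ξ / ξ ^ 3 : ℝ) *
              dilate ((t : ℝ) ^ (β / α) * ξ) (G₁ 1) φ) ∧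
        -- `H(t, x) = t^(1-3γ) ∫ N_γ(ξ) G₁(1, x t^(-γ) / ξ) dξ / ξ³`
        (IntegrableOn (fun ξ : ℝ => (wrightN (β / α) ξ / ξ ^ 3 : ℝ) *
            dilate ((t : ℝ) ^ (β / α) * ξ) (G₁ 1) φ) (Ioi 0) ∧
          H t φ = ((t : ℝ) ^ (1 - 3 * (β / α)) : ℝ) *
            ∫ ξ in Ioi (0 : ℝ), (wrightN (β / α) ξ / ξ ^ 3 : ℝ) *
              dilate ((t : ℝ) ^ (β / α) * ξ) (G₁ 1) φ) ∧
        -- the spherical integrals for `G₁` and `H₁`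
        (μ ≠ 0 →
          (Integrable (fun ω : S2 => (angularF ρ α μ ω ^ (-1 / α) : ℝ) *
              planeX α ω (t * angularF ρ α μ ω ^ (1 / α)) (Δ φ))
              (volume : Measure E3).toSphere ∧
            G₁ t φ = -(1 / (8 * Real.pi ^ 2 * t) : ℝ) *
              ∫ ω : S2, (angularF ρ α μ ω ^ (-1 / α) : ℝ) *
                planeX α ω (t * angularF ρ α μ ω ^ (1 / α)) (Δ φ)
                ∂(volume : Measure E3).toSphere) ∧
          (Integrable (fun ω : S2 => (angularF ρ α μ ω ^ (-1 / α) : ℝ) *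
              planeY α ω (t * angularF ρ α μ ω ^ (1 / α)) (Δ φ))
              (volume : Measure E3).toSphere ∧
            H₁ t φ = -(1 / (8 * Real.pi ^ 2) : ℝ) *
              ∫ ω : S2, (angularF ρ α μ ω ^ (-1 / α) : ℝ) *
                planeY α ω (t * angularF ρ α μ ω ^ (1 / α)) (Δ φ)
                ∂(volume : Measure E3).toSphere)) := by
  have hα1 : α ∈ Ioc 1 2 := ⟨hβ.trans hβα, hα⟩
  have hβ1 : β ∈ Ioc 1 2 := ⟨hβ, hβα.le.trans hα⟩
  have hα0 : 0 < α := one_pos.trans hα1.1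
  have hγ : β / α ∈ Ioo 0 1 := ⟨by positivity, (div_lt_one hα0).2 hβα⟩
  have hγα : β / α * α = β := div_mul_cancel₀ β hα0.ne'
  have hγα1 : 1 < β / α * α := hγα.symm ▸ hβ
  refine ⟨existsUnique_isFirstFundamental hρ hα0.le hβ1,
    existsUnique_isSecondFundamental hρ hα0.le hβ1,
    existsUnique_isFirstFundamental hρ hα0.le hα1,
    existsUnique_isSecondFundamental hρ hα0.le hα1,
    fun h y => ⟨integrable_mittagLeffler_abs_rpow ⟨hα1.1, h⟩ one_pos, X_eq_fourier ⟨hα1.1, h⟩ y⟩,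
    fun h y => ⟨integrable_mittagLeffler_abs_rpow ⟨hα1.1, h⟩ two_pos, Y_eq_fourier ⟨hα1.1, h⟩ y⟩,
    fun G H G₁ H₁ hG hH hG₁ hH₁ t ht φ => ?_⟩
  have ht0 : (0 : ℝ) < t := ht
  have htγ : (0 : ℝ) < (t : ℝ) ^ (β / α) := Real.rpow_pos_of_pos ht0 _
  have hpow : ((t : ℝ) ^ (β / α)) ^ α = (t : ℝ) ^ β := by
    rw [← Real.rpow_mul ht0.le, hγα]
  have hcube : ((t : ℝ) ^ (β / α)) ^ 3 = (t : ℝ) ^ (3 * (β / α)) := by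
    rw [← Real.rpow_natCast, ← Real.rpow_mul ht0.le, mul_comm]
    norm_num
  refine ⟨?_, ?_, ?_, fun hμ => ⟨?_, ?_⟩⟩
  -- Here all of the scaling sits in the time `t^γ`, and the dilation factor is `1`; `m = 1` is the
  -- weight `M_γ`.
  · obtain ⟨h1, h2⟩ := subordination_dilate (m := 1) hρ hγ hγα1 hα1 hG₁ (t ^ (β / α)) one_pos φ
    simp only [one_mul, NNReal.coe_rpow, hpow, hγα, one_pow, Complex.ofReal_one] at h1 h2
    exact ⟨h1, (hG.apply_eq hρ hβ1 t φ).trans h2.symm⟩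
  -- Here the time is `1` and the dilation factor is `t^γ`, whose cube cancels the prefactor
  -- `t^(-3γ)`.
  · obtain ⟨h1, h2⟩ := subordination_dilate (m := 1) hρ hγ hγα1 hα1 hG₁ 1 htγ φ
    simp only [NNReal.coe_one, mul_one, hpow, hγα, hcube] at h1 h2
    refine ⟨h1, ?_⟩
    rw [hG.apply_eq hρ hβ1 t φ]
    refine Eq.trans ?_ (congrArg _ h2).symm
    rw [← mul_assoc, ← Complex.ofReal_mul, ← Real.rpow_add ht0,
      show -3 * (β / α) + 3 * (β / α) = 0 by ring, Real.rpow_zero, Complex.ofReal_one, one_mul]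
  -- `m = 2` is the weight `N_γ`; the remaining power of `t` is the factor in `t E_{β,2}`.
  · obtain ⟨h1, h2⟩ := subordination_dilate (m := 2) hρ hγ hγα1 hα1 hG₁ 1 htγ φ
    simp only [NNReal.coe_one, mul_one, hpow, hγα, hcube] at h1 h2
    refine ⟨h1, ?_⟩
    rw [hH.apply_eq hρ hβ1 t φ]
    refine Eq.trans ?_ (congrArg _ h2).symm
    rw [← mul_assoc, ← Complex.ofReal_mul, ← Real.rpow_add ht0,
      show 1 - 3 * (β / α) + 3 * (β / α) = 1 by ring, Real.rpow_one]
  · obtain ⟨h1, h2⟩ := spherical_integral hρ hα1 (Or.inl rfl) ht0 hμ φ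
      (P := fun ω c => planeX α ω c (Δ φ)) fun ω c hc => planeX_eq hα1 ω hc (Δ φ)
    refine ⟨h1, ?_⟩
    rw [h2, hG₁.apply_eq hρ hα1 t φ, ← mul_assoc, ← Complex.ofReal_neg, ← Complex.ofReal_mul,
      show -(1 / (8 * Real.pi ^ 2 * (t : ℝ))) * -(8 * Real.pi ^ 2 * (t : ℝ)) = 1 by
        field_simp, Complex.ofReal_one, one_mul]
  -- The prefactor has no `1/t`, so a factor `t` remains, matching `t E_{α,2}`.
  · obtain ⟨h1, h2⟩ := spherical_integral hρ hα1 (Or.inr rfl) ht0 hμ φ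
      (P := fun ω c => planeY α ω c (Δ φ)) fun ω c hc => planeY_eq hα1 ω hc (Δ φ)
    refine ⟨h1, ?_⟩
    rw [h2, hH₁.apply_eq hρ hα1 t φ, ← mul_assoc, ← Complex.ofReal_neg, ← Complex.ofReal_mul,
      show -(1 / (8 * Real.pi ^ 2)) * -(8 * Real.pi ^ 2 * (t : ℝ)) = t by field_simp]
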